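/- Let $I=\{1,\dots,m\}$ be a finite index set, let $\{A_i\}_{i\in I}$ be invertible $2\times2$ real matrices with strictly positive entries, and let $(w_i)_{i\in I}$ satisfy $w_i>0$ and $\sum_i w_i=1$. Let $\mu$ be the Bernoulli measure with weights $(w_i)$ on $I^{\mathbb N}$, and let $\lambda$ be the top Lyapunov exponent, i.e. the $\mu$-almost sure (existing and constant) limit $$\lambda=\lim_{n\to\infty}\frac1n\log\|A_{i_n}\cdots A_{i_1}\|.$$ For $A=\begin{pmatrix}p&q\\ r&s\end{pmatrix}$ put $$F(A)=\frac12\begin{pmatrix}p-q-r+s&p+q-r-s\\ p-q+r-s&p+q+r+s\end{pmatrix},$$ let $f_i$ be the Möbius map $x\mapsto\frac{\alpha x+\beta}{\gamma x+\delta}$ of $F(A_i)=\begin{pmatrix}\alpha&\beta\\ \gamma&\delta\end{pmatrix}$, and $f_i^{\top}$ that of the transpose of $F(A_i)$. Define the sequence $\boldsymbol v=(\boldsymbol v_n)_{n\ge0}$ by $$\boldsymbol v_0=\sum_{i}w_i\,\frac12\log\frac{\det F(A_i)}{f_i'(0)},\qquad \boldsymbol v_n=-\sum_i w_i\frac{(-f_i(0))^n}{n}\quad(n\ge1),$$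 and the infinite matrix $T=(b_{k,n})_{k,n\ge0}$ by $b_{k,0}=0$ for $k\ge0$, $b_{0,n}=\sum_i w_i\,(f_i^{\top}(0))^n$ for $n\ge1$, and, for $k,n\ge1$, $$b_{k,n}=\sum_i w_i\sum_{\ell=1}^{\min\{k,n\}}\binom n\ell\binom{k-1}{\ell-1}(f_i^{\top}(0))^{n-\ell}(-f_i(0))^{k-\ell}(f_i'(0))^{\ell}.$$ For $M\ge1$ let $T_M$ be the upper-left $M\times M$ submatrix of $T$ and $\boldsymbol v^{(M)}$ the vector of the first $M$ components of $\boldsymbol v$. Then for every $\varepsilon>0$ there are positive integers $N=N(\varepsilon)$ and $M=M(\varepsilon)$ such that $$\Bigl|\lambda-\sum_{n=0}^{N-1}\bigl(T_M^{\,n}\boldsymbol v^{(M)}\bigr)_0\Bigr|<\varepsilon,$$ where $N=O(\log(1/\varepsilon))$ and $M=O(\log(N/\varepsilon))$ as $\varepsilon\to0^+$. Moreover, $\lambda$ can be approximated with $O((\log(1/\varepsilon))^3)$ arithmetic operations: there is one program for a real random access machine (a finite program with rational constants, using $+,-,\times,\div$ and comparisons of real numbers, and addition, truncated subtraction and comparison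 of natural-number indices), the same for all $m$, $(A_i)$, $(w_i)$ and $\varepsilon$, which on input $m$, the entries of the $A_i$, the weights $w_i$ and any $\varepsilon>0$ halts with an output at distance less than $\varepsilon$ from $\lambda$, the total number of executed steps (operations, index operations, assignments and tests) being $O((\log(1/\varepsilon))^3)$ as $\varepsilon\to0^+$. The constants in all $O(\cdot)$ depend only on $(A_i)$ and $(w_i)$. -/

import Mathlib

open Filter Topology MeasureTheory Asymptotics

noncomputable section

namespace LyapunovKernel

/-! ### The matrix family and its top Lyapunov exponent -/

/-- A finite family of invertible matrices with positive entries, together with a probability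
vector with positive weights. -/
structure PositiveFamily {m : ℕ} (A : Fin m → Matrix (Fin 2) (Fin 2) ℝ) (w : Fin m → ℝ) :
    Prop where
  entry_pos : ∀ i a b, 0 < A i a b
  det_ne_zero : ∀ i, (A i).det ≠ 0
  weight_pos : ∀ i, 0 < w i
  weight_sum : ∑ i, w i = 1

/-- The measure on the index set that gives mass `w i` to the point `i`. -/
def weightMeasure {m : ℕ} (w : Fin m → ℝ) : Measure (Fin m) :=
  ∑ i, ENNReal.ofReal (w i) • Measure.dirac i

/-- The Bernoulli measure with weights `w` on the space of sequences of indices. -/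
def bernoulliMeasure {m : ℕ} (w : Fin m → ℝ) : Measure (ℕ → Fin m) :=
  Measure.infinitePi fun _ => weightMeasure w

/-- `matProd A ω n = A (ω (n-1)) * ⋯ * A (ω 1) * A (ω 0)`. -/
def matProd {m : ℕ} (A : Fin m → Matrix (Fin 2) (Fin 2) ℝ) (ω : ℕ → Fin m) :
    ℕ → Matrix (Fin 2) (Fin 2) ℝ
  | 0 => 1
  | n + 1 => A (ω n) * matProd A ω n

/-- The sum of the absolute values of the entries (the choice of the norm does not affect the
Lyapunov exponent). -/
def entryNorm (P : Matrix (Fin 2) (Fin 2) ℝ) : ℝ := ∑ a, ∑ b, |P a b|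

/-- `lam` is the top Lyapunov exponent: for almost every sequence of indices it is the limit of
`(1 / n) log ‖A (ω (n-1)) ⋯ A (ω 0)‖`. -/
def IsTopLyapunovExponent {m : ℕ} (A : Fin m → Matrix (Fin 2) (Fin 2) ℝ) (w : Fin m → ℝ)
    (lam : ℝ) : Prop :=
  ∀ᵐ ω ∂(bernoulliMeasure w),
    Tendsto (fun n : ℕ => (1 / (n : ℝ)) * Real.log (entryNorm (matProd A ω n))) atTop (𝓝 lam)

/-! ### The infinite matrix `T` and the vector `v` -/

/-- The matrix of the projective action of `A` in the coordinate `x ∈ [-1, 1]`, where `x` stands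
for the point `((1 + x) / 2, (1 - x) / 2)` of the simplex. -/
def projMatrix (A : Matrix (Fin 2) (Fin 2) ℝ) : Matrix (Fin 2) (Fin 2) ℝ :=
  (1 / 2 : ℝ) •
    !![A 0 0 - A 0 1 - A 1 0 + A 1 1, A 0 0 + A 0 1 - A 1 0 - A 1 1;
       A 0 0 - A 0 1 + A 1 0 - A 1 1, A 0 0 + A 0 1 + A 1 0 + A 1 1]

/-- The Möbius transformation of a matrix, at real points other than its pole. -/
def mobius (B : Matrix (Fin 2) (Fin 2) ℝ) (x : ℝ) : ℝ :=
  (B 0 0 * x + B 0 1) / (B 1 0 * x + B 1 1)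

/-- The projective Möbius map `f` of the matrix `A`. -/
def projMap (A : Matrix (Fin 2) (Fin 2) ℝ) : ℝ → ℝ := mobius (projMatrix A)

/-- The transposed Möbius map of the matrix `A`. -/
def projMapT (A : Matrix (Fin 2) (Fin 2) ℝ) : ℝ → ℝ := mobius (projMatrix A).transpose

/-- The sequence with entries `c` at `n = 0` and `-(-x) ^ n / n` at `n ≥ 1`. -/
def baseVec (x c : ℝ) (n : ℕ) : ℝ := if n = 0 then c else -((-x) ^ n / (n : ℝ))

/-- The vector `v`. -/
def kernelVec {m : ℕ} (A : Fin m → Matrix (Fin 2) (Fin 2) ℝ) (w : Fin m → ℝ) (n : ℕ) : ℝ :=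
  ∑ i, w i * baseVec (projMap (A i) 0)
    (1 / 2 * Real.log ((projMatrix (A i)).det / deriv (projMap (A i)) 0)) n

/-- The entry in row `k` and column `n` of the infinite matrix `T`. -/
def kernelEntry {m : ℕ} (A : Fin m → Matrix (Fin 2) (Fin 2) ℝ) (w : Fin m → ℝ) (k n : ℕ) : ℝ :=
  if n = 0 then 0
  else if k = 0 then ∑ i, w i * projMapT (A i) 0 ^ n
  else ∑ i, w i * ∑ l ∈ Finset.Icc 1 (min k n),
    (n.choose l : ℝ) * ((k - 1).choose (l - 1) : ℝ) * projMapT (A i) 0 ^ (n - l) *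
      (-projMap (A i) 0) ^ (k - l) * deriv (projMap (A i)) 0 ^ l

/-- The upper-left `M × M` submatrix of `T`. -/
def truncMatrix {m : ℕ} (A : Fin m → Matrix (Fin 2) (Fin 2) ℝ) (w : Fin m → ℝ) (M : ℕ) :
    Matrix (Fin M) (Fin M) ℝ :=
  Matrix.of fun k n => kernelEntry A w k n

/-- The first `M` components of `v`. -/
def truncVec {m : ℕ} (A : Fin m → Matrix (Fin 2) (Fin 2) ℝ) (w : Fin m → ℝ) (M : ℕ) :
    Fin M → ℝ :=
  fun n => kernelVec A w n

/-- The approximation of the Lyapunov exponent by `N` terms of the series of truncated matrices: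
`∑_{n < N} (T_M ^ n v^(M))_0`. -/
def truncSum {m : ℕ} (A : Fin m → Matrix (Fin 2) (Fin 2) ℝ) (w : Fin m → ℝ) (N : ℕ) (M : ℕ)
    [NeZero M] : ℝ :=
  ∑ n ∈ Finset.range N, ((truncMatrix A w M ^ n).mulVec (truncVec A w M)) 0

/-! ### Real random access machine programs

A program is a finite object whose only constants are natural and rational numbers. It works on
index registers, which hold natural numbers, and on finitely many arrays of exact real numbers
("banks"), addressed through the index registers. The only operations on reals are
`+`, `-`, `*`, `/` and the comparison `<`. Every executed instruction and every executed test costs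
one step, those on indices included, so that the number of steps bounds the number of arithmetic
operations. -/

/-- The memory: index registers, and banks of real cells. -/
structure Memory where
  idx : ℕ → ℕ
  cell : ℕ → ℕ → ℝ

/-- A reference to a real cell: the cell of bank `bank` at the address held by the index
register `reg`. -/
structure Ref where
  bank : ℕ
  reg : ℕ

/-- The content of the referenced cell. -/
def Ref.read (x : Ref) (s : Memory) : ℝ := s.cell x.bank (s.idx x.reg)

/-- Overwrite the referenced cell. -/
def Ref.write (x : Ref) (s : Memory) (c : ℝ) : Memory where
  idx := s.idx
  cell := Function.update s.cell x.bank
    (Function.update (s.cell x.bank) (s.idx x.reg) c)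

/-- Overwrite an index register. -/
def Memory.setIdx (s : Memory) (d : ℕ) (j : ℕ) : Memory where
  idx := Function.update s.idx d j
  cell := s.cell

/-- The instructions; the first argument is always the destination. -/
inductive Instr where
  | idxConst (d : ℕ) (j : ℕ)
  | idxAdd (d a b : ℕ)
  | idxSub (d a b : ℕ)
  | const (d : Ref) (q : ℚ)
  | copy (d x : Ref)
  | add (d x y : Ref)
  | sub (d x y : Ref)
  | mul (d x y : Ref)
  | div (d x y : Ref)

/-- An instruction can be executed unless it divides by zero. -/
def Instr.Defined : Instr → Memory → Prop
  | .div _ _ y, s => y.read s ≠ 0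
  | _, _ => True

/-- The effect of an instruction. -/
def Instr.apply : Instr → Memory → Memory
  | .idxConst d j, s => s.setIdx d j
  | .idxAdd d a b, s => s.setIdx d (s.idx a + s.idx b)
  | .idxSub d a b, s => s.setIdx d (s.idx a - s.idx b)
  | .const d q, s => d.write s (q : ℝ)
  | .copy d x, s => d.write s (x.read s)
  | .add d x y, s => d.write s (x.read s + y.read s)
  | .sub d x y, s => d.write s (x.read s - y.read s)
  | .mul d x y, s => d.write s (x.read s * y.read s)
  | .div d x y, s => d.write s (x.read s / y.read s)

/-- The tests. -/
inductive Test where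
  | idxLt (a b : ℕ)
  | realLt (x y : Ref)

/-- The truth of a test. -/
def Test.Holds : Test → Memory → Prop
  | .idxLt a b, s => s.idx a < s.idx b
  | .realLt x y, s => x.read s < y.read s

/-- Structured programs. -/
inductive Program where
  | instr (i : Instr)
  | seq (p q : Program)
  | ite (b : Test) (p q : Program)
  | while (b : Test) (p : Program)

/-- `Runs p s t s'`: the program `p`, started in memory `s`, halts after exactly `t` steps in
memory `s'`. -/
inductive Runs : Program → Memory → ℕ → Memory → Prop where
  | instr (i : Instr) (s : Memory) : i.Defined s → Runs (.instr i) s 1 (i.apply s)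
  | seq {p q : Program} {s s' s'' : Memory} {t t' : ℕ} :
      Runs p s t s' → Runs q s' t' s'' → Runs (.seq p q) s (t + t') s''
  | iteTrue {b : Test} {p q : Program} {s s' : Memory} {t : ℕ} :
      b.Holds s → Runs p s t s' → Runs (.ite b p q) s (t + 1) s'
  | iteFalse {b : Test} {p q : Program} {s s' : Memory} {t : ℕ} :
      ¬ b.Holds s → Runs q s t s' → Runs (.ite b p q) s (t + 1) s'
  | whileTrue {b : Test} {p : Program} {s s' s'' : Memory} {t t' : ℕ} :
      b.Holds s → Runs p s t s' → Runs (.while b p) s' t' s'' →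
        Runs (.while b p) s (t + 1 + t') s''
  | whileFalse {b : Test} {p : Program} {s : Memory} :
      ¬ b.Holds s → Runs (.while b p) s 1 s

/-- The initial memory: index register `0` holds the number `m` of matrices, bank `0` holds the
tolerance `ε` at address `0`, bank `1` the weights, and banks `2, 3, 4, 5` the entries
`(0,0), (0,1), (1,0), (1,1)` of the matrices; everything else is `0`. -/
def inputMemory {m : ℕ} (A : Fin m → Matrix (Fin 2) (Fin 2) ℝ) (w : Fin m → ℝ) (ε : ℝ) :
    Memory where
  idx := fun r => if r = 0 then m else 0
  cell := fun bank j =>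
    if bank = 0 then (if j = 0 then ε else 0)
    else if h : j < m then
      match bank with
      | 1 => w ⟨j, h⟩
      | 2 => A ⟨j, h⟩ 0 0
      | 3 => A ⟨j, h⟩ 0 1
      | 4 => A ⟨j, h⟩ 1 0
      | 5 => A ⟨j, h⟩ 1 1
      | _ => 0
    else 0

/-- The output is the cell at address `0` of bank `0`. -/
def Memory.output (s : Memory) : ℝ := s.cell 0 0

end LyapunovKernel

end

/-! Let h_i be half the entry sum of A_i. Then F(A_i) = h_i [[a_i, b_i], [c_i, 1]] with b_i =
f_i(0), c_i = f_iᵀ(0), a_i - b_i c_i = f_i'(0). The row vector ((1+x)/2, (1-x)/2) times A_i is h_i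
(1 + b_i x) times the row vector of the point f_iᵀ(x) = (a_i x + c_i)/(b_i x + 1)
(`simplexSum_mul`). Put L g = ∑ w_i g ∘ f_iᵀ and φ(x) = ∑ w_i log(1 + b_i x). The mean of log
‖product of n matrices‖ is then log 2 + n ∑ w_i log h_i + ∑_{k<n} (L^k φ)(0), so the mean growth
rate is ∑ w_i log h_i + lim (L^k φ)(0). Positivity makes the log norm additive up to a bounded
error; the strong law for independent blocks, with block length tending to infinity, turns the mean
rate into an almost sure limit.

For n ≥ 1, column n of T lists the Taylor coefficients of L(x^n), and v lists those of φ + ∑ w_i log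
h_i. The zero column 0 means T g = L g - g(0). As L fixes constants, the series of the (T^n v)_0
telescopes, also after truncation: N + 1 terms add up to ∑ w_i log h_i + (L_M^N φ)(0)
(`truncSum_eq`).

Two errors remain. The maps f_iᵀ contract the pseudo-hyperbolic distance |x-y|/(1-xy) by a factor r
< 1 (`osc_comp`), so (L^N φ)(0) converges like r^N. For the truncation, multiplication by f_iᵀ has
norm at most r on power series with weights r^{-k} in ℓ²; this says that f_iᵀ maps the disc of
radius 1/r into that of radius r, and it is proved by an elementary dissipation inequality. Hence
the k-th coefficient of (f_iᵀ)^n is at most r^{n+k}, and the Taylor remainders of all powers are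
O(r^M) uniformly in n. With C = 1/(1-r) the truncated operator has ℓ¹ norm at most C, and the error
after N steps is at most C^{N+3} r^M. So N = O(log(1/ε)) and M = O(N + log(1/ε)) suffice.

For the operation count, a three-term recurrence yields each Taylor coefficient of a power in O(1)
operations, so one application of the truncated operator costs O(m M²) and the whole iteration O(m N
M²). N and M are found by comparing geometric sequences with ε/8, and log h_i is replaced by a
partial sum of a series. -/

namespace LyapunovKernel

/-! ### Contractive Möbius maps `x ↦ (a x + c) / (b x + 1)` -/

/-- The coefficients of a Möbius map `x ↦ (a x + c) / (b x + 1)` that maps `[-1, 1]` into itself,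
with quantitative bounds in terms of `κ`. -/
structure ContractiveMobius (a b c κ : ℝ) : Prop where
  abs_b : |b| ≤ κ
  abs_c : |c| ≤ κ
  right : |a + c| ≤ 1 + b
  left : |a - c| ≤ 1 - b
  gap_pos : 0 ≤ a - b * c → a + |b - c| ≤ κ
  gap_neg : a - b * c ≤ 0 → -a + |b + c| ≤ κ

/-- With D = a - bc and E = b - c, the right side minus the left is A g² + 2DE xg + DB x², where A =
1 - a + cE and B = 1 - a - bE. It is nonnegative because AB - DE² = (1-a)² - (b-c)². The meaning is
an energy balance for multiplication by the Möbius series: state x, input g, output Dx + cg, next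
state g - bx, stored energy |D| x². -/
theorem dissipation_of_nonneg {a b c : ℝ} (hd : 0 ≤ a - b * c) (hb : |b| ≤ 1) (hc : |c| ≤ 1)
    (h : a + |b - c| ≤ 1) (x g : ℝ) :
    ((a - b * c) * x + c * g) ^ 2 + (a - b * c) * (-b * x + g) ^ 2 ≤
      g ^ 2 + (a - b * c) * x ^ 2 := by
  obtain ⟨hb1, hb2⟩ := abs_le.1 hb
  obtain ⟨hc1, hc2⟩ := abs_le.1 hc
  have h1 : b - c ≤ 1 - a := by linarith [le_abs_self (b - c)]
  have h2 : -(b - c) ≤ 1 - a := by linarith [neg_abs_le (b - c)]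
  have hA : 0 ≤ 1 - a + c * (b - c) := by nlinarith
  have hB : 0 ≤ 1 - a - b * (b - c) := by nlinarith
  have hdet : (a - b * c) * (b - c) ^ 2 ≤ (1 - a + c * (b - c)) * (1 - a - b * (b - c)) := by
    nlinarith [mul_nonneg (sub_nonneg.2 h1) (sub_nonneg.2 h2)]
  have key : ∀ A B E D : ℝ, 0 ≤ A → 0 ≤ B → 0 ≤ D → D * E ^ 2 ≤ A * B →
      0 ≤ A * g ^ 2 + D * B * x ^ 2 + 2 * D * E * x * g := by
    intro A B E D hA hB hD hdet
    rcases hA.eq_or_lt with rfl | hA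
    · have h0 : D * E ^ 2 = 0 := le_antisymm (by simpa using hdet) (by positivity)
      have h1 : D * E = 0 := by
        rcases mul_eq_zero.1 h0 with h | h
        · simp [h]
        · simp [pow_eq_zero_iff] at h; simp [h]
      have : 0 ≤ D * B * x ^ 2 := by positivity
      rw [show 2 * D * E * x * g = 2 * (D * E) * x * g by ring, h1]
      linarith
    · have h1 : 0 ≤ (A * g + D * E * x) ^ 2 + D * x ^ 2 * (A * B - D * E ^ 2) := by
        have := sub_nonneg.2 hdet
        positivity
      have h2 : 0 ≤ A * (A * g ^ 2 + D * B * x ^ 2 + 2 * D * E * x * g) := by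
        nlinarith
      exact nonneg_of_mul_nonneg_right h2 hA
  have := key _ _ (b - c) _ hA hB hd hdet
  nlinarith

theorem dissipation {a b c : ℝ} (hb : |b| ≤ 1) (hc : |c| ≤ 1)
    (hpos : 0 ≤ a - b * c → a + |b - c| ≤ 1) (hneg : a - b * c ≤ 0 → -a + |b + c| ≤ 1)
    (x g : ℝ) :
    ((a - b * c) * x + c * g) ^ 2 + |a - b * c| * (-b * x + g) ^ 2 ≤
      g ^ 2 + |a - b * c| * x ^ 2 := by
  rcases le_total 0 (a - b * c) with hd | hd
  · rw [abs_of_nonneg hd]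
    exact dissipation_of_nonneg hd hb hc (hpos hd) x g
  · rw [abs_of_nonpos hd]
    -- A negative determinant is reduced to a positive one by negating the map, that is, a and c.
    have := dissipation_of_nonneg (a := -a) (b := b) (c := -c) (by linarith) hb (by simpa using hc)
      (by simpa using hneg hd) x g
    nlinarith

/-- The common rate of contraction and of decay of the coefficients. -/
noncomputable def rate (S : ℝ) : ℝ := 2 / (2 + S ^ 2)

/-- The reciprocal of `1 - rate S`. -/
noncomputable def growth (S : ℝ) : ℝ := 1 + 2 / S ^ 2

theorem rate_pos (S : ℝ) : 0 < rate S := by unfold rate; positivity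

theorem rate_lt_one {S : ℝ} (hS : 0 < S) : rate S < 1 := by
  unfold rate
  rw [div_lt_one (by positivity)]
  nlinarith [pow_pos hS 2]

theorem growth_eq {S : ℝ} (hS : 0 < S) : growth S = (1 - rate S)⁻¹ := by
  unfold growth rate
  have : (1 - 2 / (2 + S ^ 2)) = S ^ 2 / (2 + S ^ 2) := by field_simp; ring
  rw [this, inv_div]; field_simp; ring

theorem rate_eq {S : ℝ} (hS : 0 < S) : rate S = 1 - 1 / growth S := by
  rw [growth_eq hS]; simp

theorem three_le_growth {S : ℝ} (hS : 0 < S) (hS1 : S ≤ 1) : 3 ≤ growth S := by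
  unfold growth
  have : 2 ≤ 2 / S ^ 2 := by
    rw [le_div_iff₀ (by positivity)]
    nlinarith
  linarith

theorem two_div_le_growth {S : ℝ} (hS : 0 < S) (hS1 : S ≤ 1) : 2 / S ≤ growth S := by
  unfold growth
  have : 2 / S ≤ 2 / S ^ 2 := by
    apply div_le_div_of_nonneg_left <;> nlinarith [pow_pos hS 2]
  linarith

theorem one_sub_le_rate {S : ℝ} (hS : 0 < S) : 1 - S ≤ rate S := by
  unfold rate
  rw [le_div_iff₀ (by positivity)]
  nlinarith [pow_pos hS 2, mul_nonneg hS.le (sq_nonneg (1 - S))]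

/-- This is what allows one number r to serve twice: 2/(2+S²) is the contraction factor of the
distance, and r² ≥ 1 - S lets the map be rescaled by r and still satisfy the hypotheses of
`dissipation`. -/
theorem one_sub_le_rate_sq {S : ℝ} (hS : 0 < S) (hS1 : S ≤ 1) : 1 - S ≤ rate S ^ 2 := by
  unfold rate
  rw [div_pow, le_div_iff₀ (by positivity)]
  nlinarith [pow_pos hS 2, pow_pos hS 3, pow_pos hS 5, mul_nonneg hS.le (sub_nonneg.2 hS1),
    mul_nonneg (pow_pos hS 3).le (sub_nonneg.2 hS1)]

namespace ContractiveMobius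

variable {a b c S : ℝ}

theorem abs_a (h : ContractiveMobius a b c (1 - S)) : |a| ≤ 1 := by
  have h1 := abs_le.1 h.right
  have h2 := abs_le.1 h.left
  rw [abs_le]; constructor <;> linarith

/-- The determinant `a - b c` has absolute value at most `1`. -/
theorem abs_det (h : ContractiveMobius a b c (1 - S)) (hS : 0 < S) : |a - b * c| ≤ 1 := by
  obtain ⟨hb1, hb2⟩ := abs_le.1 h.abs_b
  obtain ⟨hc1, hc2⟩ := abs_le.1 h.abs_c
  rw [abs_le]
  constructor
  · rcases le_total 0 (a - b * c) with hd | hd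
    · linarith
    · have := h.gap_neg hd
      have h1 := mul_nonneg (sub_nonneg.2 (le_abs_self (b + c))) (by linarith : 0 ≤ 1 + b)
      have h2 := mul_nonneg (sub_nonneg.2 (neg_abs_le (b + c))) (by linarith : 0 ≤ 1 - b)
      nlinarith [sq_nonneg b]
  · rcases le_total 0 (a - b * c) with hd | hd
    · have := h.gap_pos hd
      have h1 := mul_nonneg (sub_nonneg.2 (le_abs_self (b - c))) (by linarith : 0 ≤ 1 + b)
      have h2 := mul_nonneg (sub_nonneg.2 (neg_abs_le (b - c))) (by linarith : 0 ≤ 1 - b)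
      nlinarith [sq_nonneg b]
    · linarith

theorem denom_ge (h : ContractiveMobius a b c (1 - S)) {x : ℝ} (hx : |x| ≤ 1) :
    S ≤ 1 + b * x := by
  have : |b * x| ≤ (1 - S) * 1 := by
    rw [abs_mul]; exact mul_le_mul h.abs_b hx (abs_nonneg _) ((abs_nonneg _).trans h.abs_b)
  linarith [neg_abs_le (b * x)]

theorem denom_pos (h : ContractiveMobius a b c (1 - S)) (hS : 0 < S) {x : ℝ} (hx : |x| ≤ 1) :
    0 < b * x + 1 := by
  linarith [h.denom_ge hx]

theorem abs_apply_le (h : ContractiveMobius a b c (1 - S)) (hS : 0 < S) {x : ℝ} (hx : |x| ≤ 1) :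
    |(a * x + c) / (b * x + 1)| ≤ 1 := by
  have hp := h.denom_pos hS hx
  rw [abs_div, abs_of_pos hp, div_le_one hp, abs_le]
  obtain ⟨h1, h2⟩ := abs_le.1 h.right
  obtain ⟨h3, h4⟩ := abs_le.1 h.left
  obtain ⟨h5, h6⟩ := abs_le.1 hx
  constructor <;> nlinarith

/-- The form that measures the contraction of the pseudo-hyperbolic distance. -/
theorem det_mul_le (h : ContractiveMobius a b c (1 - S)) (hS : 0 < S) {x y : ℝ}
    (hx : |x| ≤ 1) (hy : |y| ≤ 1) :
    (|a - b * c| + S ^ 2 / 2) * (1 - x * y) ≤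
      (b * x + 1) * (b * y + 1) - (a * x + c) * (a * y + c) := by
  -- Both sides are affine in x and in y, so it suffices to compare them at the corners (±1, ±1),
  -- with weights (1±x)(1±y)/4. At the two equal-sign corners the left side vanishes.
  have h1 : 0 ≤ (1 + b) ^ 2 - (a + c) ^ 2 := by
    have := sq_le_sq' (abs_le.1 h.right).1 (abs_le.1 h.right).2
    linarith
  have h2 : 0 ≤ (1 - b) ^ 2 - (a - c) ^ 2 := by
    have := sq_le_sq' (abs_le.1 h.left).1 (abs_le.1 h.left).2
    linarith
  -- The mixed corners. For D = a - bc ≥ 0 the difference 1 - b² - c² + a² - 2D equals (1-a)² -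
  -- (b-c)², which is at least S² because 1 - a ≥ S + |b-c|.
  have h3 : 2 * |a - b * c| + S ^ 2 ≤ 1 - b ^ 2 - c ^ 2 + a ^ 2 := by
    rcases le_total 0 (a - b * c) with hd | hd
    · have h0 := h.gap_pos hd
      rw [abs_of_nonneg hd]
      have e1 := le_abs_self (b - c)
      have e2 := neg_abs_le (b - c)
      nlinarith
    · have h0 := h.gap_neg hd
      rw [abs_of_nonpos hd]
      have e1 := le_abs_self (b + c)
      have e2 := neg_abs_le (b + c)
      nlinarith
  obtain ⟨x1, x2⟩ := abs_le.1 hx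
  obtain ⟨y1, y2⟩ := abs_le.1 hy
  have p1 := mul_nonneg (mul_nonneg (by linarith : 0 ≤ 1 + x) (by linarith : 0 ≤ 1 + y)) h1
  have p2 := mul_nonneg (mul_nonneg (by linarith : 0 ≤ 1 - x) (by linarith : 0 ≤ 1 - y)) h2
  have p3 := mul_nonneg (mul_nonneg (by linarith : 0 ≤ 1 + x) (by linarith : 0 ≤ 1 - y))
    (sub_nonneg.2 h3)
  have p4 := mul_nonneg (mul_nonneg (by linarith : 0 ≤ 1 - x) (by linarith : 0 ≤ 1 + y))
    (sub_nonneg.2 h3)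
  linarith

/-- A bound `K` on the oscillation of `g` relative to the pseudo-hyperbolic distance is improved
by composition with the Möbius map. -/
theorem osc_comp (h : ContractiveMobius a b c (1 - S)) (hS : 0 < S) {g : ℝ → ℝ} {K : ℝ}
    (hK : 0 ≤ K)
    (hg : ∀ x y, |x| ≤ 1 → |y| ≤ 1 → |g x - g y| * (1 - x * y) ≤ K * |x - y|)
    {x y : ℝ} (hx : |x| ≤ 1) (hy : |y| ≤ 1) :
    |g ((a * x + c) / (b * x + 1)) - g ((a * y + c) / (b * y + 1))| * (1 - x * y) ≤
      rate S * K * |x - y| := by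
  have hpx := h.denom_pos hS hx
  have hpy := h.denom_pos hS hy
  have hxy : x * y ≤ 1 := by
    have : |x * y| ≤ 1 := by
      rw [abs_mul]; exact mul_le_one₀ hx (abs_nonneg _) hy
    exact (le_abs_self _).trans this
  rcases hxy.eq_or_lt with e | hlt
  · have := rate_pos S
    rw [e]; simp; positivity
  have key := h.det_mul_le hS hx hy
  have hm := hg _ _ (h.abs_apply_le hS hx) (h.abs_apply_le hS hy)
  set G := |g ((a * x + c) / (b * x + 1)) - g ((a * y + c) / (b * y + 1))| with hG
  set Nn := (b * x + 1) * (b * y + 1) - (a * x + c) * (a * y + c) with hN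
  -- Together with `e2`: the images have pseudo-hyperbolic distance |a - bc| |x-y| / Nn.
  have e1 : 1 - (a * x + c) / (b * x + 1) * ((a * y + c) / (b * y + 1)) =
      Nn / ((b * x + 1) * (b * y + 1)) := by
    rw [div_mul_div_comm, one_sub_div (mul_pos hpx hpy).ne']
  have e2 : |(a * x + c) / (b * x + 1) - (a * y + c) / (b * y + 1)| =
      |a - b * c| * |x - y| / ((b * x + 1) * (b * y + 1)) := by
    rw [div_sub_div _ _ hpx.ne' hpy.ne', abs_div, abs_of_pos (mul_pos hpx hpy), ← abs_mul]
    congr 2; ring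
  rw [e1, e2, ← mul_div_assoc, ← mul_div_assoc,
    div_le_div_iff_of_pos_right (mul_pos hpx hpy)] at hm
  have hD := h.abs_det hS
  have hD0 := abs_nonneg (a - b * c)
  have h1 : |a - b * c| * (1 - x * y) ≤ rate S * Nn := by
    -- The quotient t/(t + S²/2) increases with t, and at t = 1, the bound for |a - bc|, it equals
    -- `rate S`.
    have : |a - b * c| ≤ rate S * (|a - b * c| + S ^ 2 / 2) := by
      unfold rate
      rw [div_mul_eq_mul_div, le_div_iff₀ (by positivity)]
      nlinarith [sq_nonneg S]
    calc |a - b * c| * (1 - x * y) ≤ rate S * (|a - b * c| + S ^ 2 / 2) * (1 - x * y) := by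
          apply mul_le_mul_of_nonneg_right this; linarith
      _ ≤ rate S * Nn := by
          rw [mul_assoc]; exact mul_le_mul_of_nonneg_left key (rate_pos S).le
  have hNpos : 0 < Nn := by
    have : 0 < (|a - b * c| + S ^ 2 / 2) * (1 - x * y) := by
      apply mul_pos
      · positivity
      · linarith
    linarith
  have h2 : Nn * (G * (1 - x * y)) ≤ Nn * (rate S * K * |x - y|) := by
    calc Nn * (G * (1 - x * y)) = (G * Nn) * (1 - x * y) := by ring
      _ ≤ K * (|a - b * c| * |x - y|) * (1 - x * y) :=
          mul_le_mul_of_nonneg_right hm (by linarith)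
      _ = K * |x - y| * (|a - b * c| * (1 - x * y)) := by ring
      _ ≤ K * |x - y| * (rate S * Nn) := mul_le_mul_of_nonneg_left h1 (by positivity)
      _ = _ := by ring
  exact le_of_mul_le_mul_left h2 hNpos

end ContractiveMobius

/-! ### Taylor coefficients of powers of a Möbius map -/

open PowerSeries in
/-- The power series of `x / (1 + b x)`. -/
noncomputable def tailSeries (b : ℝ) : PowerSeries ℝ :=
  PowerSeries.mk fun k => if k = 0 then 0 else (-b) ^ (k - 1)

open PowerSeries in
/-- The power series of `(a x + c) / (b x + 1)`. -/
noncomputable def mobiusSeries (a b c : ℝ) : PowerSeries ℝ :=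
  C c + C (a - b * c) * tailSeries b

theorem tailSeries_mul (b : ℝ) :
    (1 + PowerSeries.C b * PowerSeries.X) * tailSeries b = PowerSeries.X := by
  ext k
  rcases k with _ | _ | k
  · simp [tailSeries, add_mul, mul_assoc]
  · simp [tailSeries, add_mul, mul_assoc, PowerSeries.coeff_succ_X_mul]
  · simp [tailSeries, add_mul, mul_assoc, PowerSeries.coeff_succ_X_mul, PowerSeries.coeff_X]
    ring

theorem coeff_zero_tailSeries_mul (b : ℝ) (g : PowerSeries ℝ) :
    PowerSeries.coeff 0 (tailSeries b * g) = 0 := by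
  simp [tailSeries]

/-- The state recursion of the energy balance: the coefficients of tail · g are the states, those of
g the inputs. -/
theorem coeff_succ_tailSeries_mul (b : ℝ) (g : PowerSeries ℝ) (k : ℕ) :
    PowerSeries.coeff (k + 1) (tailSeries b * g) =
      PowerSeries.coeff k g - b * PowerSeries.coeff k (tailSeries b * g) := by
  have h := congrArg (fun u => PowerSeries.coeff (k + 1) (u * g)) (tailSeries_mul b)
  simp only [add_mul, one_mul, mul_assoc, map_add, PowerSeries.coeff_C_mul,
    PowerSeries.coeff_succ_X_mul] at h
  linarith

theorem coeff_tailSeries_pow (b : ℝ) (k l : ℕ) :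
    PowerSeries.coeff (k + 1) (tailSeries b ^ (l + 1)) = (k.choose l : ℝ) * (-b) ^ (k - l) := by
  induction k generalizing l with
  | zero =>
    rw [pow_succ', coeff_succ_tailSeries_mul, coeff_zero_tailSeries_mul]
    rcases l with _ | l
    · simp
    · rw [pow_succ', coeff_zero_tailSeries_mul]; simp
  | succ k ih =>
    rw [pow_succ', coeff_succ_tailSeries_mul, ← pow_succ', ih]
    rcases l with _ | l
    · simp [PowerSeries.coeff_one, pow_succ]; ring
    · rw [ih, Nat.choose_succ_succ]
      rcases le_or_gt (l + 1) k with h | h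
      · rw [show k - l = k - (l + 1) + 1 by lia, show k + 1 - (l + 1) = k - (l + 1) + 1 by lia]
        push_cast; ring
      · rw [Nat.choose_eq_zero_of_lt h]
        simp

theorem coeff_zero_tailSeries_pow (b : ℝ) (l : ℕ) :
    PowerSeries.coeff 0 (tailSeries b ^ (l + 1)) = 0 := by
  rw [pow_succ', coeff_zero_tailSeries_mul]

theorem mobiusSeries_pow (a b c : ℝ) (n : ℕ) :
    mobiusSeries a b c ^ n = ∑ l ∈ Finset.range (n + 1),
      PowerSeries.C ((n.choose l : ℝ) * c ^ (n - l) * (a - b * c) ^ l) * tailSeries b ^ l := by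
  rw [mobiusSeries, add_comm, add_pow]
  refine Finset.sum_congr rfl fun l _ => ?_
  have : (n.choose l : PowerSeries ℝ) = PowerSeries.C (n.choose l : ℝ) := by simp
  rw [this]
  simp only [mul_pow, map_mul, map_pow]
  ring

theorem coeff_zero_mobiusSeries_pow (a b c : ℝ) (n : ℕ) :
    PowerSeries.coeff 0 (mobiusSeries a b c ^ n) = c ^ n := by
  rw [mobiusSeries_pow, map_sum, Finset.sum_range_succ', Finset.sum_eq_zero]
  · simp
  · intro l _
    rw [PowerSeries.coeff_C_mul, coeff_zero_tailSeries_pow, mul_zero]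

/-- Expand (c + (a-bc) x/(1+bx))^n by the binomial theorem and each power of x/(1+bx) by the
negative binomial series. The term l = 0 contributes only to k = 0, and terms with l > k do not
reach degree k. -/
theorem coeff_succ_mobiusSeries_pow (a b c : ℝ) (n k : ℕ) (hk : k ≠ 0) :
    PowerSeries.coeff k (mobiusSeries a b c ^ n) = ∑ l ∈ Finset.Icc 1 (min k n),
      (n.choose l : ℝ) * ((k - 1).choose (l - 1) : ℝ) * c ^ (n - l) * (-b) ^ (k - l) *
        (a - b * c) ^ l := by
  obtain ⟨k, rfl⟩ := Nat.exists_eq_succ_of_ne_zero hk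
  rw [mobiusSeries_pow, map_sum]
  symm
  apply Finset.sum_subset_zero_on_sdiff
  · intro l hl
    simp only [Finset.mem_Icc, Finset.mem_range] at *
    lia
  · intro l hl
    simp only [Finset.mem_sdiff, Finset.mem_Icc, Finset.mem_range] at hl
    rw [PowerSeries.coeff_C_mul]
    rcases l with _ | l
    · simp [PowerSeries.coeff_one]
    · rw [Nat.succ_eq_add_one, coeff_tailSeries_pow,
        Nat.choose_eq_zero_of_lt (by lia : k < l)]
      simp
  · intro l hl
    simp only [Finset.mem_Icc] at hl
    obtain ⟨l, rfl⟩ : ∃ j, l = j + 1 := ⟨l - 1, by lia⟩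
    rw [PowerSeries.coeff_C_mul, Nat.succ_eq_add_one, coeff_tailSeries_pow]
    simp only [Nat.add_sub_cancel, Nat.add_sub_add_right]
    ring

/-- The coefficient of `x ^ k` in `((a x + c) / (b x + 1)) ^ n`. -/
noncomputable def powCoeff (a b c : ℝ) (n k : ℕ) : ℝ :=
  PowerSeries.coeff k (mobiusSeries a b c ^ n)

theorem powCoeff_zero (a b c : ℝ) (k : ℕ) : powCoeff a b c 0 k = if k = 0 then 1 else 0 := by
  simp [powCoeff, PowerSeries.coeff_one]

theorem powCoeff_succ_zero (a b c : ℝ) (n : ℕ) :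
    powCoeff a b c (n + 1) 0 = c * powCoeff a b c n 0 := by
  simp only [powCoeff, coeff_zero_mobiusSeries_pow]; ring

theorem powCoeff_succ (a b c : ℝ) (n k : ℕ) :
    powCoeff a b c (n + 1) k = c * powCoeff a b c n k +
      (a - b * c) * PowerSeries.coeff k (tailSeries b * mobiusSeries a b c ^ n) := by
  simp only [powCoeff, pow_succ' _ n]
  nth_rewrite 1 [mobiusSeries]
  rw [add_mul, map_add, mul_assoc, PowerSeries.coeff_C_mul, PowerSeries.coeff_C_mul]

/-- Compare coefficients in (bx+1) f^{n+1} = (ax+c) f^n. This recurrence replaces the binomial sums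
in the remainder estimate and in the program. -/
theorem powCoeff_succ_succ (a b c : ℝ) (n k : ℕ) :
    powCoeff a b c (n + 1) (k + 1) =
      c * powCoeff a b c n (k + 1) + a * powCoeff a b c n k - b * powCoeff a b c (n + 1) k := by
  rw [powCoeff_succ, powCoeff_succ a b c n k, coeff_succ_tailSeries_mul]
  simp only [powCoeff]
  ring

theorem sum_rate_pow_le {S : ℝ} (hS : 0 < S) (n : ℕ) :
    ∑ j ∈ Finset.range n, rate S ^ j ≤ growth S := by
  have h1 : 0 < 1 - rate S := by linarith [rate_lt_one hS]
  rw [growth_eq hS, ← div_one (1 - rate S)⁻¹, inv_eq_one_div, div_div, mul_one,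
    le_div_iff₀ h1, geom_sum_mul_neg]
  linarith [pow_pos (rate_pos S) n]

/-! ### Weighted ℓ² bounds and uniform Taylor remainders for the powers of a Möbius map -/

namespace ContractiveMobius

variable {a b c S : ℝ}

/-- This is `dissipation` for the rescaled map f(x/r)/r, whose coefficients are a/r², b/r, c/r. -/
theorem dissipation_scaled (h : ContractiveMobius a b c (1 - S)) (hS : 0 < S) (hS1 : S ≤ 1)
    (x g : ℝ) :
    ((a - b * c) * x + c * g) ^ 2 + |a - b * c| * (g - b * x) ^ 2 ≤
      rate S ^ 2 * g ^ 2 + rate S ^ 2 * |a - b * c| * x ^ 2 := by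
  set r := rate S with hr
  have hr0 : 0 < r := rate_pos S
  have hr1 : r < 1 := rate_lt_one hS
  have hk : 1 - S ≤ r ^ 2 := one_sub_le_rate_sq hS hS1
  have hk' : 1 - S ≤ r := one_sub_le_rate hS
  have hb : |b / r| ≤ 1 := by
    rw [abs_div, abs_of_pos hr0, div_le_one hr0]; exact h.abs_b.trans hk'
  have hc : |c / r| ≤ 1 := by
    rw [abs_div, abs_of_pos hr0, div_le_one hr0]; exact h.abs_c.trans hk'
  have edet : a / r ^ 2 - b / r * (c / r) = (a - b * c) / r ^ 2 := by field_simp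
  -- The two terms are scaled differently. For u ≥ 0 enlarge |v|/r to |v|/r² and use 1 - S ≤ r²; for
  -- u ≤ 0 enlarge u/r² to u/r and use 1 - S ≤ r.
  have aux : ∀ u v : ℝ, u + |v| ≤ 1 - S → u / r ^ 2 + |v / r| ≤ 1 := by
    intro u v huv
    rw [abs_div, abs_of_pos hr0]
    rcases le_total 0 u with hu | hu
    · have : |v| / r ≤ |v| / r ^ 2 := by
        apply div_le_div_of_nonneg_left (abs_nonneg v) (by positivity)
        nlinarith
      have h3 : u / r ^ 2 + |v| / r ^ 2 ≤ 1 := by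
        rw [← add_div, div_le_one (by positivity)]; linarith
      linarith
    · have : u / r ^ 2 ≤ u / r := by
        rw [div_le_div_iff₀ (by positivity) hr0]
        nlinarith [mul_nonneg (mul_nonneg hr0.le (sub_nonneg.2 hr1.le)) (neg_nonneg.2 hu)]
      have h3 : u / r + |v| / r ≤ 1 := by
        rw [← add_div, div_le_one (by positivity)]; linarith
      linarith
  have hr2 : 0 < r ^ 2 := by positivity
  have key := dissipation (a := a / r ^ 2) (b := b / r) (c := c / r) hb hc
    (by
      intro h0
      rw [edet] at h0
      have := aux _ _ (h.gap_pos (by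
        by_contra hcon
        exact absurd h0 (not_le.2 (div_neg_of_neg_of_pos (not_le.1 hcon) hr2))))
      rwa [← sub_div])
    (by
      intro h0
      rw [edet] at h0
      have := aux _ _ (h.gap_neg (by
        by_contra hcon
        exact absurd h0 (not_le.2 (div_pos (not_le.1 hcon) hr2))))
      rwa [← add_div, ← neg_div])
    (r * x) g
  rw [edet, abs_div, abs_of_pos hr2] at key
  have e1 : ((a - b * c) / r ^ 2 * (r * x) + c / r * g) = ((a - b * c) * x + c * g) / r := by
    field_simp
  have e2 : -(b / r) * (r * x) + g = g - b * x := by field_simp; ring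
  rw [e1, e2, div_pow, mul_pow] at key
  have := mul_le_mul_of_nonneg_left key hr2.le
  have e3 : r ^ 2 * (((a - b * c) * x + c * g) ^ 2 / r ^ 2 +
      |a - b * c| / r ^ 2 * (g - b * x) ^ 2) =
      ((a - b * c) * x + c * g) ^ 2 + |a - b * c| * (g - b * x) ^ 2 := by field_simp
  have e4 : r ^ 2 * (g ^ 2 + |a - b * c| / r ^ 2 * (r ^ 2 * x ^ 2)) =
      r ^ 2 * g ^ 2 + r ^ 2 * |a - b * c| * x ^ 2 := by field_simp
  rwa [e3, e4] at this

/-- Multiplication by the Möbius series is a contraction in a weighted `ℓ²` norm, also for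
partial sums. -/
theorem sum_powCoeff_succ_sq_le (h : ContractiveMobius a b c (1 - S)) (hS : 0 < S) (hS1 : S ≤ 1)
    (n K : ℕ) :
    ∑ k ∈ Finset.range K, (powCoeff a b c (n + 1) k / rate S ^ k) ^ 2 ≤
      rate S ^ 2 * ∑ k ∈ Finset.range K, (powCoeff a b c n k / rate S ^ k) ^ 2 := by
  set r := rate S with hr
  have hr0 : 0 < r := rate_pos S
  set u : ℕ → ℝ := fun k => PowerSeries.coeff k (tailSeries b * mobiusSeries a b c ^ n) with hu
  -- Keeping the stored energy on the left makes the partial sums inductive. It is 0 at the start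
  -- because the tail series has no constant term.
  suffices H : ∑ k ∈ Finset.range K, (powCoeff a b c (n + 1) k / r ^ k) ^ 2 +
      r ^ 2 * |a - b * c| * (u K / r ^ K) ^ 2 ≤
      r ^ 2 * ∑ k ∈ Finset.range K, (powCoeff a b c n k / r ^ k) ^ 2 by
    have : 0 ≤ r ^ 2 * |a - b * c| * (u K / r ^ K) ^ 2 := by positivity
    linarith
  induction K with
  | zero => simp [hu, coeff_zero_tailSeries_mul]
  | succ K ih =>
    rw [Finset.sum_range_succ, Finset.sum_range_succ]
    have key := h.dissipation_scaled hS hS1 (u K / r ^ K) (powCoeff a b c n K / r ^ K)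
    have e1 : powCoeff a b c (n + 1) K / r ^ K =
        (a - b * c) * (u K / r ^ K) + c * (powCoeff a b c n K / r ^ K) := by
      rw [powCoeff_succ]; simp only [hu]; ring
    have e2 : r ^ 2 * |a - b * c| * (u (K + 1) / r ^ (K + 1)) ^ 2 =
        |a - b * c| * (powCoeff a b c n K / r ^ K - b * (u K / r ^ K)) ^ 2 := by
      have : u (K + 1) = powCoeff a b c n K - b * u K := by
        simp only [hu]; rw [coeff_succ_tailSeries_mul]; rfl
      rw [this, pow_succ]
      field_simp
      ring
    rw [e1, e2]
    rw [← hr] at key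
    linarith

theorem sum_powCoeff_sq_le (h : ContractiveMobius a b c (1 - S)) (hS : 0 < S) (hS1 : S ≤ 1)
    (n K : ℕ) :
    ∑ k ∈ Finset.range K, (powCoeff a b c n k / rate S ^ k) ^ 2 ≤ (rate S ^ n) ^ 2 := by
  induction n with
  | zero =>
    rcases K with _ | K
    · simp
    · rw [Finset.sum_range_succ']
      simp [powCoeff_zero]
  | succ n ih =>
    refine (h.sum_powCoeff_succ_sq_le hS hS1 n K).trans ?_
    calc _ ≤ rate S ^ 2 * (rate S ^ n) ^ 2 := mul_le_mul_of_nonneg_left ih (by positivity)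
      _ = _ := by ring

/-- Cauchy-type estimate for the Taylor coefficients of the powers of the Möbius map. -/
theorem abs_powCoeff_le (h : ContractiveMobius a b c (1 - S)) (hS : 0 < S) (hS1 : S ≤ 1)
    (n k : ℕ) : |powCoeff a b c n k| ≤ rate S ^ n * rate S ^ k := by
  have h1 := h.sum_powCoeff_sq_le hS hS1 n (k + 1)
  rw [Finset.sum_range_succ] at h1
  have h2 : 0 ≤ ∑ k ∈ Finset.range k, (powCoeff a b c n k / rate S ^ k) ^ 2 :=
    Finset.sum_nonneg fun _ _ => sq_nonneg _
  have hr0 := rate_pos S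
  have h3 := abs_le_of_sq_le_sq (a := powCoeff a b c n k / rate S ^ k) (b := rate S ^ n)
    (by linarith) (by positivity)
  rw [abs_div, abs_of_pos (pow_pos hr0 k), div_le_iff₀ (pow_pos hr0 k)] at h3
  exact h3

/-- The Taylor polynomials of degree `< M` of the powers of the Möbius map. -/
theorem abs_pow_sub_le (h : ContractiveMobius a b c (1 - S)) (hS : 0 < S) (hS1 : S ≤ 1)
    {x : ℝ} (hx : |x| ≤ 1) (n M : ℕ) :
    |((a * x + c) / (b * x + 1)) ^ n - ∑ k ∈ Finset.range (M + 1), powCoeff a b c n k * x ^ k| ≤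
      growth S ^ 2 * rate S ^ M := by
  set r := rate S with hr
  have hr0 : 0 < r := rate_pos S
  have hr1 : r < 1 := rate_lt_one hS
  have hC := three_le_growth hS hS1
  have hCS := two_div_le_growth hS hS1
  set f := (a * x + c) / (b * x + 1) with hf
  have hf1 : |f| ≤ 1 := h.abs_apply_le hS hx
  have hden := h.denom_pos hS hx
  set D : ℕ → ℝ := fun n => f ^ n - ∑ k ∈ Finset.range (M + 1), powCoeff a b c n k * x ^ k with hD
  -- Cutting the recurrence off at degree M leaves a single uncancelled term, of degree M + 1, so
  -- the remainders of consecutive powers are linked by multiplication by f and that one term.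
  have id1 : ∀ n, D (n + 1) = f * D n +
      x ^ (M + 1) * (a * powCoeff a b c n M - b * powCoeff a b c (n + 1) M) / (b * x + 1) := by
    intro n
    have : ∀ M, (b * x + 1) * ∑ k ∈ Finset.range (M + 1), powCoeff a b c (n + 1) k * x ^ k =
        (a * x + c) * ∑ k ∈ Finset.range (M + 1), powCoeff a b c n k * x ^ k -
        x ^ (M + 1) * (a * powCoeff a b c n M - b * powCoeff a b c (n + 1) M) := by
      intro M
      induction M with
      | zero => simp [powCoeff_succ_zero]; ring
      | succ M ih =>
        rw [Finset.sum_range_succ, mul_add, ih, Finset.sum_range_succ _ (M + 1), mul_add,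
          powCoeff_succ_succ]
        ring
    have e := this M
    have e' : ∑ k ∈ Finset.range (M + 1), powCoeff a b c (n + 1) k * x ^ k =
        f * ∑ k ∈ Finset.range (M + 1), powCoeff a b c n k * x ^ k -
        x ^ (M + 1) * (a * powCoeff a b c n M - b * powCoeff a b c (n + 1) M) / (b * x + 1) := by
      rw [hf, eq_sub_iff_add_eq, div_mul_eq_mul_div, eq_div_iff hden.ne', add_mul,
        div_mul_cancel₀ _ hden.ne', mul_comm _ (b * x + 1), e, sub_add_cancel]
    simp only [hD]
    rw [e']; ring
  have bd : ∀ n, |x ^ (M + 1) * (a * powCoeff a b c n M - b * powCoeff a b c (n + 1) M) /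
      (b * x + 1)| ≤ growth S * r ^ M * r ^ n := by
    intro n
    have h1 : |a * powCoeff a b c n M - b * powCoeff a b c (n + 1) M| ≤ 2 * (r ^ n * r ^ M) := by
      have ha := h.abs_a
      have hb : |b| ≤ 1 := h.abs_b.trans (by linarith)
      have q1 := h.abs_powCoeff_le hS hS1 n M
      have q2 : |powCoeff a b c (n + 1) M| ≤ r ^ n * r ^ M := by
        refine (h.abs_powCoeff_le hS hS1 (n + 1) M).trans ?_
        rw [← hr, pow_succ]
        have : 0 ≤ r ^ n * r ^ M := by positivity
        nlinarith
      calc _ ≤ |a * powCoeff a b c n M| + |b * powCoeff a b c (n + 1) M| := abs_sub _ _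
        _ = |a| * |powCoeff a b c n M| + |b| * |powCoeff a b c (n + 1) M| := by
            rw [abs_mul, abs_mul]
        _ ≤ 1 * (r ^ n * r ^ M) + 1 * (r ^ n * r ^ M) := by gcongr
        _ = _ := by ring
    have hxM : |x ^ (M + 1)| ≤ 1 := by rw [abs_pow]; exact pow_le_one₀ (abs_nonneg x) hx
    rw [abs_div, abs_mul, abs_of_pos hden]
    calc _ ≤ 1 * (2 * (r ^ n * r ^ M)) / S := by
          have := h.denom_ge hx
          gcongr
          linarith
      _ = 2 / S * (r ^ M * r ^ n) := by ring
      _ ≤ growth S * (r ^ M * r ^ n) := by gcongr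
      _ = _ := by ring
  -- Since D 0 = 0 and |f| ≤ 1, only the boundary terms accumulate; they decay geometrically in n,
  -- so the bound is uniform in n.
  have ind : ∀ n, |D n| ≤ growth S * r ^ M * ∑ j ∈ Finset.range n, r ^ j := by
    intro n
    induction n with
    | zero =>
      simp [hD, powCoeff_zero]
    | succ n ih =>
      rw [id1, Finset.sum_range_succ, mul_add]
      refine (abs_add_le _ _).trans (add_le_add ?_ (bd n))
      rw [abs_mul]
      exact (mul_le_of_le_one_left (abs_nonneg _) hf1).trans ih
  refine (ind n).trans ?_
  have hsum : ∑ j ∈ Finset.range n, r ^ j ≤ growth S := by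
    exact sum_rate_pow_le hS n
  calc _ ≤ growth S * r ^ M * growth S := by gcongr
    _ = _ := by ring

end ContractiveMobius

/-! ### The transfer operator and its truncation -/

section Transfer

variable {m : ℕ}

/-- The transfer operator of the Möbius maps `x ↦ (a i x + c i) / (b i x + 1)`. -/
noncomputable def transfer (w a b c : Fin m → ℝ) (g : ℝ → ℝ) (x : ℝ) : ℝ :=
  ∑ i, w i * g ((a i * x + c i) / (b i * x + 1))

/-- The non-constant part of the observable whose mean is the Lyapunov exponent. -/
noncomputable def logPart (w b : Fin m → ℝ) (x : ℝ) : ℝ := ∑ i, w i * Real.log (1 + b i * x)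

/-- The Taylor coefficients of `logPart`. -/
noncomputable def logCoeff (w b : Fin m → ℝ) (n : ℕ) : ℝ := ∑ i, w i * -((-b i) ^ n / n)

/-- The transfer operator on Taylor coefficients, applied to a polynomial of degree `< M`. -/
noncomputable def coeffTransfer (w a b c : Fin m → ℝ) (M : ℕ) (g : ℕ → ℝ) (k : ℕ) : ℝ :=
  ∑ i, w i * ∑ n ∈ Finset.range M, g n * powCoeff (a i) (b i) (c i) n k

variable {w a b c : Fin m → ℝ} {S : ℝ}

theorem abs_weighted_sum_le (hw : ∀ i, 0 < w i) (hsum : ∑ i, w i = 1) {u : Fin m → ℝ} {K : ℝ}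
    (hu : ∀ i, |u i| ≤ K) : |∑ i, w i * u i| ≤ K := by
  calc |∑ i, w i * u i| ≤ ∑ i, |w i * u i| := Finset.abs_sum_le_sum_abs _ _
    _ ≤ ∑ i, w i * K := by
        refine Finset.sum_le_sum fun i _ => ?_
        rw [abs_mul, abs_of_pos (hw i)]
        exact mul_le_mul_of_nonneg_left (hu i) (hw i).le
    _ = K := by rw [← Finset.sum_mul, hsum, one_mul]

theorem osc_iterate_transfer (hw : ∀ i, 0 < w i) (hsum : ∑ i, w i = 1) (hS : 0 < S)
    (h : ∀ i, ContractiveMobius (a i) (b i) (c i) (1 - S)) {g : ℝ → ℝ} {K : ℝ} (hK : 0 ≤ K)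
    (hg : ∀ x y, |x| ≤ 1 → |y| ≤ 1 → |g x - g y| * (1 - x * y) ≤ K * |x - y|) (n : ℕ) {x y : ℝ}
    (hx : |x| ≤ 1) (hy : |y| ≤ 1) :
    |(transfer w a b c)^[n] g x - (transfer w a b c)^[n] g y| * (1 - x * y) ≤
      rate S ^ n * K * |x - y| := by
  induction n generalizing x y with
  | zero => simpa using hg x y hx hy
  | succ n ih =>
    rw [Function.iterate_succ_apply', transfer, transfer, ← Finset.sum_sub_distrib]
    have hxy : 0 ≤ 1 - x * y := by
      have : |x * y| ≤ 1 := by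
        rw [abs_mul]; exact mul_le_one₀ hx (abs_nonneg _) hy
      linarith [le_abs_self (x * y)]
    rw [← abs_of_nonneg hxy, ← abs_mul, Finset.sum_mul]
    have e : ∀ i ∈ Finset.univ, (w i * (transfer w a b c)^[n] g ((a i * x + c i) / (b i * x + 1)) -
        w i * (transfer w a b c)^[n] g ((a i * y + c i) / (b i * y + 1))) * (1 - x * y) =
        w i * (((transfer w a b c)^[n] g ((a i * x + c i) / (b i * x + 1)) -
        (transfer w a b c)^[n] g ((a i * y + c i) / (b i * y + 1))) * (1 - x * y)) := by
      intro i _; ring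
    rw [Finset.sum_congr rfl e]
    refine abs_weighted_sum_le hw hsum fun i => ?_
    rw [abs_mul, abs_of_nonneg hxy]
    have := (h i).osc_comp hS (g := (transfer w a b c)^[n] g) (K := rate S ^ n * K)
      (mul_nonneg (pow_nonneg (rate_pos S).le n) hK) (fun x y hx hy => ih hx hy) hx hy
    rw [pow_succ']
    linarith

/-- From 1 + b_i y ≥ S and |b_i| ≤ 1, each logarithm is Lipschitz with constant 1/S; moreover 1 - xy
≤ 2, and `growth S` dominates 2/S. -/
theorem logPart_osc (hw : ∀ i, 0 < w i) (hsum : ∑ i, w i = 1) (hS : 0 < S) (hS1 : S ≤ 1)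
    (h : ∀ i, ContractiveMobius (a i) (b i) (c i) (1 - S)) (x y : ℝ)
    (hx : |x| ≤ 1) (hy : |y| ≤ 1) :
    |logPart w b x - logPart w b y| * (1 - x * y) ≤ growth S * |x - y| := by
  have aux : ∀ i x y, |x| ≤ 1 → |y| ≤ 1 →
      Real.log (1 + b i * x) - Real.log (1 + b i * y) ≤ 1 / S * |x - y| := by
    intro i x y hx hy
    have px := (h i).denom_ge hx
    have py := (h i).denom_ge hy
    rw [← Real.log_div (by linarith) (by linarith)]
    have h0 : 0 < 1 + b i * y := by linarith
    refine (Real.log_le_sub_one_of_pos (div_pos (by linarith) h0)).trans ?_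
    rw [div_sub_one h0.ne', div_le_iff₀ h0]
    have h1 : 1 + b i * x - (1 + b i * y) ≤ |x - y| := by
      have : |b i * (x - y)| ≤ 1 * |x - y| := by
        rw [abs_mul]
        exact mul_le_mul_of_nonneg_right ((h i).abs_b.trans (by linarith)) (abs_nonneg _)
      linarith [le_abs_self (b i * (x - y))]
    refine h1.trans ?_
    calc |x - y| = 1 / S * |x - y| * S := by field_simp
      _ ≤ _ := mul_le_mul_of_nonneg_left py (by positivity)
  have h1 : |logPart w b x - logPart w b y| ≤ 1 / S * |x - y| := by
    unfold logPart
    rw [← Finset.sum_sub_distrib]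
    simp_rw [← mul_sub]
    refine abs_weighted_sum_le hw hsum fun i => abs_le.2 ⟨?_, aux i x y hx hy⟩
    have := aux i y x hy hx
    rw [abs_sub_comm] at this
    linarith
  have h2 : 1 - x * y ≤ 2 := by
    have : |x * y| ≤ 1 := by
      rw [abs_mul]; exact mul_le_one₀ hx (abs_nonneg _) hy
    linarith [neg_abs_le (x * y)]
  calc _ ≤ |logPart w b x - logPart w b y| * 2 :=
        mul_le_mul_of_nonneg_left h2 (abs_nonneg _)
    _ ≤ 1 / S * |x - y| * 2 := by gcongr
    _ = 2 / S * |x - y| := by ring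
    _ ≤ _ := mul_le_mul_of_nonneg_right (two_div_le_growth hS hS1) (abs_nonneg _)

/-- The i-th map sends 0 to c_i, so consecutive iterates at 0 differ by a mean of differences
between the points c_i and 0. With y = 0 the oscillation bound makes these geometric, and summing
costs a factor `growth S` = 1/(1-r). -/
theorem exists_limit_transfer (hw : ∀ i, 0 < w i) (hsum : ∑ i, w i = 1) (hS : 0 < S) (hS1 : S ≤ 1)
    (h : ∀ i, ContractiveMobius (a i) (b i) (c i) (1 - S)) :
    ∃ l : ℝ, Tendsto (fun n => (transfer w a b c)^[n] (logPart w b) 0) atTop (𝓝 l) ∧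
      ∀ n, |l - (transfer w a b c)^[n] (logPart w b) 0| ≤ growth S ^ 2 * rate S ^ n := by
  have hC := three_le_growth hS hS1
  have hd : ∀ n, dist ((transfer w a b c)^[n] (logPart w b) 0)
      ((transfer w a b c)^[n + 1] (logPart w b) 0) ≤ growth S * rate S ^ n := by
    intro n
    have e : (transfer w a b c)^[n + 1] (logPart w b) 0 -
        (transfer w a b c)^[n] (logPart w b) 0 =
        ∑ i, w i * ((transfer w a b c)^[n] (logPart w b) (c i) -
          (transfer w a b c)^[n] (logPart w b) 0) := by
      rw [Function.iterate_succ_apply', transfer]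
      simp only [mul_sub, Finset.sum_sub_distrib, ← Finset.sum_mul, hsum]
      simp
    rw [dist_comm, Real.dist_eq, e]
    refine abs_weighted_sum_le hw hsum fun i => ?_
    have hc : |c i| ≤ 1 := (h i).abs_c.trans (by linarith)
    have := osc_iterate_transfer hw hsum hS h (by linarith : 0 ≤ growth S)
      (logPart_osc hw hsum hS hS1 h) n hc (by simp : |(0 : ℝ)| ≤ 1)
    simp only [mul_zero, sub_zero, mul_one] at this
    refine this.trans ?_
    calc _ ≤ rate S ^ n * growth S * 1 := by
          have := rate_pos S
          gcongr
      _ = _ := by ring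
  have hr1 := rate_lt_one hS
  have hcau := cauchySeq_of_le_geometric _ _ hr1 hd
  obtain ⟨l, hl⟩ := cauchySeq_tendsto_of_complete hcau
  refine ⟨l, hl, fun n => ?_⟩
  have := dist_le_of_le_geometric_of_tendsto _ _ hr1 hd hl n
  rw [dist_comm, Real.dist_eq] at this
  refine this.trans (le_of_eq ?_)
  rw [div_eq_mul_inv, ← growth_eq hS]; ring

theorem logPart_sub_le (hw : ∀ i, 0 < w i) (hsum : ∑ i, w i = 1) (hS : 0 < S)
    (h : ∀ i, ContractiveMobius (a i) (b i) (c i) (1 - S)) {x : ℝ} (hx : |x| ≤ 1) (M : ℕ) :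
    |logPart w b x - ∑ k ∈ Finset.range (M + 1), logCoeff w b k * x ^ k| ≤
      growth S * rate S ^ M := by
  have e : logPart w b x - ∑ k ∈ Finset.range (M + 1), logCoeff w b k * x ^ k =
      ∑ i, w i * (Real.log (1 + b i * x) +
        ∑ k ∈ Finset.range M, (-(b i * x)) ^ (k + 1) / (k + 1)) := by
    unfold logPart logCoeff
    simp_rw [Finset.sum_mul]
    rw [Finset.sum_comm, ← Finset.sum_sub_distrib]
    refine Finset.sum_congr rfl fun i _ => ?_
    rw [mul_add, sub_eq_add_neg, Finset.sum_range_succ', Finset.mul_sum]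
    congr 1
    simp only [pow_zero, Nat.cast_zero, div_zero, neg_zero, mul_zero, zero_mul, add_zero]
    rw [← Finset.sum_neg_distrib]
    refine Finset.sum_congr rfl fun k _ => ?_
    push_cast
    rw [show -(b i * x) = -b i * x by ring, mul_pow]
    ring
  rw [e]
  refine abs_weighted_sum_le hw hsum fun i => ?_
  have hbx : |-(b i * x)| ≤ 1 - S := by
    rw [abs_neg, abs_mul]
    calc _ ≤ |b i| * 1 := mul_le_mul_of_nonneg_left hx (abs_nonneg _)
      _ ≤ _ := by rw [mul_one]; exact (h i).abs_b
  have hk := one_sub_le_rate hS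
  have hr1 := rate_lt_one hS
  have := Real.abs_log_sub_add_sum_range_le (x := -(b i * x)) (by linarith) M
  rw [sub_neg_eq_add, add_comm] at this
  refine this.trans ?_
  rw [div_eq_mul_inv, mul_comm]
  have hp := rate_pos S
  have h1 : (1 - |-(b i * x)|)⁻¹ ≤ growth S := by
    rw [growth_eq hS]
    apply inv_anti₀ <;> linarith
  refine mul_le_mul h1 ?_ (by positivity) ((inv_nonneg.2 (by linarith)).trans h1)
  calc |-(b i * x)| ^ (M + 1) ≤ rate S ^ (M + 1) :=
        pow_le_pow_left₀ (abs_nonneg _) (hbx.trans hk) _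
    _ ≤ rate S ^ M := pow_le_pow_of_le_one hp.le hr1.le (Nat.le_succ M)

/-- The coefficient bound r^{n+k} is weakened to r^k and summed over k. The resulting ℓ¹ growth per
step is harmless, because r^M can be made to compensate it. -/
theorem sum_abs_coeffTransfer_le (hw : ∀ i, 0 < w i) (hsum : ∑ i, w i = 1) (hS : 0 < S)
    (hS1 : S ≤ 1) (h : ∀ i, ContractiveMobius (a i) (b i) (c i) (1 - S)) (M : ℕ) (g : ℕ → ℝ) :
    ∑ k ∈ Finset.range M, |coeffTransfer w a b c M g k| ≤
      growth S * ∑ k ∈ Finset.range M, |g k| := by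
  have hp := rate_pos S
  have hk : ∀ k, |coeffTransfer w a b c M g k| ≤
      rate S ^ k * ∑ k ∈ Finset.range M, |g k| := by
    intro k
    refine abs_weighted_sum_le hw hsum fun i => ?_
    refine (Finset.abs_sum_le_sum_abs _ _).trans ?_
    rw [Finset.mul_sum]
    refine Finset.sum_le_sum fun n _ => ?_
    rw [abs_mul, mul_comm]
    refine mul_le_mul_of_nonneg_right (((h i).abs_powCoeff_le hS hS1 n k).trans ?_) (abs_nonneg _)
    exact mul_le_of_le_one_left (by positivity) (pow_le_one₀ hp.le (rate_lt_one hS).le)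
  calc _ ≤ ∑ k ∈ Finset.range M, rate S ^ k * ∑ k ∈ Finset.range M, |g k| :=
        Finset.sum_le_sum fun k _ => hk k
    _ ≤ _ := by
        rw [← Finset.sum_mul]
        exact mul_le_mul_of_nonneg_right (sum_rate_pow_le hS M)
          (Finset.sum_nonneg fun _ _ => abs_nonneg _)

theorem sum_abs_logCoeff_le (hw : ∀ i, 0 < w i) (hsum : ∑ i, w i = 1) (hS : 0 < S)
    (h : ∀ i, ContractiveMobius (a i) (b i) (c i) (1 - S)) (M : ℕ) :
    ∑ k ∈ Finset.range M, |logCoeff w b k| ≤ growth S := by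
  refine le_trans (Finset.sum_le_sum fun k _ => ?_) (sum_rate_pow_le hS M)
  refine abs_weighted_sum_le hw hsum fun i => ?_
  have hp := rate_pos S
  rw [abs_neg, abs_div, abs_pow, abs_neg]
  rcases Nat.eq_zero_or_pos k with rfl | hk
  · simp
  · have h1 : (1 : ℝ) ≤ |(k : ℝ)| := by rw [Nat.abs_cast]; exact_mod_cast hk
    refine (div_le_self (by positivity) h1).trans ?_
    exact pow_le_pow_left₀ (abs_nonneg _) ((h i).abs_b.trans (one_sub_le_rate hS)) _

theorem sum_abs_iterate_le (hw : ∀ i, 0 < w i) (hsum : ∑ i, w i = 1) (hS : 0 < S)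
    (hS1 : S ≤ 1) (h : ∀ i, ContractiveMobius (a i) (b i) (c i) (1 - S)) (M n : ℕ) :
    ∑ k ∈ Finset.range M, |(coeffTransfer w a b c M)^[n] (logCoeff w b) k| ≤
      growth S ^ (n + 1) := by
  induction n with
  | zero => simpa using sum_abs_logCoeff_le hw hsum hS h M
  | succ n ih =>
    rw [Function.iterate_succ_apply', pow_succ']
    refine (sum_abs_coeffTransfer_le hw hsum hS hS1 h M _).trans ?_
    have hC := three_le_growth hS hS1
    gcongr

/-- The truncation error after `N` steps. -/
theorem abs_transfer_sub_coeffTransfer_le (hw : ∀ i, 0 < w i) (hsum : ∑ i, w i = 1) (hS : 0 < S)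
    (hS1 : S ≤ 1) (h : ∀ i, ContractiveMobius (a i) (b i) (c i) (1 - S)) (M N : ℕ) {x : ℝ}
    (hx : |x| ≤ 1) :
    |(transfer w a b c)^[N] (logPart w b) x -
      ∑ k ∈ Finset.range (M + 1),
        (coeffTransfer w a b c (M + 1))^[N] (logCoeff w b) k * x ^ k| ≤
      growth S ^ (N + 3) * rate S ^ M := by
  have hC := three_le_growth hS hS1
  have hp := rate_pos S
  induction N generalizing x with
  | zero =>
    refine (logPart_sub_le hw hsum hS h hx M).trans ?_
    gcongr
    exact le_self_pow₀ (by linarith) (by norm_num)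
  | succ N ih =>
    set X := (coeffTransfer w a b c (M + 1))^[N] (logCoeff w b) with hX
    rw [Function.iterate_succ_apply', Function.iterate_succ_apply', ← hX]
    -- The new error is the old one at the image points, covered by the induction hypothesis since
    -- that is uniform on [-1, 1], plus the Taylor remainders of the powers weighted by the current
    -- coefficients.
    have e : transfer w a b c ((transfer w a b c)^[N] (logPart w b)) x -
        ∑ k ∈ Finset.range (M + 1), coeffTransfer w a b c (M + 1) X k * x ^ k =
        ∑ i, w i * (((transfer w a b c)^[N] (logPart w b) ((a i * x + c i) / (b i * x + 1)) -
          ∑ n ∈ Finset.range (M + 1), X n * ((a i * x + c i) / (b i * x + 1)) ^ n) +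
          ∑ n ∈ Finset.range (M + 1), X n * (((a i * x + c i) / (b i * x + 1)) ^ n -
            ∑ k ∈ Finset.range (M + 1), powCoeff (a i) (b i) (c i) n k * x ^ k)) := by
      rw [transfer]
      unfold coeffTransfer
      simp_rw [Finset.sum_mul]
      rw [Finset.sum_comm, ← Finset.sum_sub_distrib]
      refine Finset.sum_congr rfl fun i _ => ?_
      simp_rw [mul_sub, Finset.sum_sub_distrib]
      have : ∑ k ∈ Finset.range (M + 1), w i * (∑ n ∈ Finset.range (M + 1),
          X n * powCoeff (a i) (b i) (c i) n k) * x ^ k =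
          w i * ∑ n ∈ Finset.range (M + 1), X n * ∑ k ∈ Finset.range (M + 1),
            powCoeff (a i) (b i) (c i) n k * x ^ k := by
        simp_rw [Finset.mul_sum, Finset.sum_mul]
        rw [Finset.sum_comm]
        refine Finset.sum_congr rfl fun n _ => Finset.sum_congr rfl fun k _ => ?_
        ring
      rw [this]
      ring
    rw [e]
    refine abs_weighted_sum_le hw hsum fun i => ?_
    refine (abs_add_le _ _).trans ?_
    have h1 := ih ((h i).abs_apply_le hS hx)
    have h2 : |∑ n ∈ Finset.range (M + 1), X n * (((a i * x + c i) / (b i * x + 1)) ^ n -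
            ∑ k ∈ Finset.range (M + 1), powCoeff (a i) (b i) (c i) n k * x ^ k)| ≤
        growth S ^ (N + 3) * rate S ^ M := by
      refine (Finset.abs_sum_le_sum_abs _ _).trans ?_
      calc _ ≤ ∑ n ∈ Finset.range (M + 1), |X n| * (growth S ^ 2 * rate S ^ M) := by
            refine Finset.sum_le_sum fun n _ => ?_
            rw [abs_mul]
            exact mul_le_mul_of_nonneg_left ((h i).abs_pow_sub_le hS hS1 hx n M) (abs_nonneg _)
        _ ≤ growth S ^ (N + 1) * (growth S ^ 2 * rate S ^ M) := by
            rw [← Finset.sum_mul]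
            have := sum_abs_iterate_le hw hsum hS hS1 h (M + 1) N
            gcongr
        _ = _ := by ring
    have h3 : 0 ≤ growth S ^ (N + 3) * rate S ^ M := by positivity
    -- The two equal contributions are absorbed by one more factor `growth S` ≥ 3.
    calc _ ≤ growth S ^ (N + 3) * rate S ^ M + growth S ^ (N + 3) * rate S ^ M :=
          add_le_add h1 h2
      _ ≤ growth S * (growth S ^ (N + 3) * rate S ^ M) := by nlinarith
      _ = _ := by ring

theorem abs_transfer_zero_sub_le (hw : ∀ i, 0 < w i) (hsum : ∑ i, w i = 1) (hS : 0 < S)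
    (hS1 : S ≤ 1) (h : ∀ i, ContractiveMobius (a i) (b i) (c i) (1 - S)) (M N : ℕ) :
    |(transfer w a b c)^[N] (logPart w b) 0 -
        (coeffTransfer w a b c (M + 1))^[N] (logCoeff w b) 0| ≤
      growth S ^ (N + 3) * rate S ^ M := by
  have := abs_transfer_sub_coeffTransfer_le hw hsum hS hS1 h M N (x := 0) (by simp)
  rwa [Finset.sum_range_succ', Finset.sum_eq_zero (fun k _ => by simp), zero_add, pow_zero,
    mul_one] at this

end Transfer

/-! ### The Möbius coefficients of a positive matrix -/

/-- Half the sum of the entries. -/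
noncomputable def halfSum (A : Matrix (Fin 2) (Fin 2) ℝ) : ℝ :=
  1 / 2 * (A 0 0 + A 0 1 + A 1 0 + A 1 1)

/-- The coefficient of `x` in the numerator of the normalized Möbius map. -/
noncomputable def coefA (A : Matrix (Fin 2) (Fin 2) ℝ) : ℝ :=
  1 / 2 * (A 0 0 - A 0 1 - A 1 0 + A 1 1) / halfSum A

/-- The coefficient of `x` in the denominator of the normalized transposed Möbius map. -/
noncomputable def coefB (A : Matrix (Fin 2) (Fin 2) ℝ) : ℝ :=
  1 / 2 * (A 0 0 + A 0 1 - A 1 0 - A 1 1) / halfSum A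

/-- The constant coefficient of the normalized transposed Möbius map. -/
noncomputable def coefC (A : Matrix (Fin 2) (Fin 2) ℝ) : ℝ :=
  1 / 2 * (A 0 0 - A 0 1 + A 1 0 - A 1 1) / halfSum A

/-- A lower bound for the distances of the normalized entries and of the half sum from their
degenerate values. -/
noncomputable def matGap (A : Matrix (Fin 2) (Fin 2) ℝ) : ℝ :=
  A 0 0 * A 0 1 * A 1 0 * A 1 1 * halfSum A /
    ((2 * halfSum A) * (2 * halfSum A) * (2 * halfSum A) * (2 * halfSum A) *
      ((1 + halfSum A) * (1 + halfSum A)))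

/-- The product of the gaps of the matrices. -/
noncomputable def familyGap {m : ℕ} (A : Fin m → Matrix (Fin 2) (Fin 2) ℝ) : ℝ := ∏ i, matGap (A i)

/-- Every condition is linear in the entries: 1 - a ∓ (b-c) equals 4r, 4q, and 1 + a ∓ (b+c) equals
4s, 4p, while 1 ± b and 1 ± c are twice the row and column sums. -/
theorem contractiveMobius_of_simplex {p q r s S : ℝ} (hS : 0 < S) (hsum : p + q + r + s = 1)
    (hp : S ≤ p) (hq : S ≤ q) (hr : S ≤ r) (hs : S ≤ s) :
    ContractiveMobius (p - q - r + s) (p + q - r - s) (p - q + r - s) (1 - S) where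
  abs_b := abs_le.2 ⟨by linarith, by linarith⟩
  abs_c := abs_le.2 ⟨by linarith, by linarith⟩
  right := abs_le.2 ⟨by linarith, by linarith⟩
  left := abs_le.2 ⟨by linarith, by linarith⟩
  gap_pos _ := by
    have : |p + q - r - s - (p - q + r - s)| ≤ 1 - S - (p - q - r + s) :=
      abs_le.2 ⟨by linarith, by linarith⟩
    linarith
  gap_neg _ := by
    have : |p + q - r - s + (p - q + r - s)| ≤ 1 - S + (p - q - r + s) :=
      abs_le.2 ⟨by linarith, by linarith⟩
    linarith

theorem halfSum_pos {A : Matrix (Fin 2) (Fin 2) ℝ} (hA : ∀ a b, 0 < A a b) : 0 < halfSum A := by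
  have := hA 0 0; have := hA 0 1; have := hA 1 0; have := hA 1 1
  unfold halfSum; linarith

theorem matGap_eq {A : Matrix (Fin 2) (Fin 2) ℝ} (hA : ∀ a b, 0 < A a b) :
    matGap A = (A 0 0 / (2 * halfSum A)) * (A 0 1 / (2 * halfSum A)) * (A 1 0 / (2 * halfSum A)) *
      (A 1 1 / (2 * halfSum A)) * (halfSum A / (1 + halfSum A) ^ 2) := by
  have := halfSum_pos hA
  unfold matGap; field_simp

theorem matGap_pos {A : Matrix (Fin 2) (Fin 2) ℝ} (hA : ∀ a b, 0 < A a b) : 0 < matGap A := by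
  have := halfSum_pos hA
  have := hA 0 0; have := hA 0 1; have := hA 1 0; have := hA 1 1
  unfold matGap; positivity

/-- All five factors lie in (0, 1], so the product lies below each of them. It plays the part of a
minimum, but is computed by field operations alone. The factor h/(1+h)² serves the series for log h.
-/
theorem matGap_le {A : Matrix (Fin 2) (Fin 2) ℝ} (hA : ∀ a b, 0 < A a b) :
    matGap A ≤ A 0 0 / (2 * halfSum A) ∧ matGap A ≤ A 0 1 / (2 * halfSum A) ∧
      matGap A ≤ A 1 0 / (2 * halfSum A) ∧ matGap A ≤ A 1 1 / (2 * halfSum A) ∧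
      matGap A ≤ halfSum A / (1 + halfSum A) ^ 2 ∧ matGap A ≤ 1 := by
  rw [matGap_eq hA]
  have hh := halfSum_pos hA
  have h1 := hA 0 0; have h2 := hA 0 1; have h3 := hA 1 0; have h4 := hA 1 1
  have hs : 2 * halfSum A = A 0 0 + A 0 1 + A 1 0 + A 1 1 := by unfold halfSum; ring
  have key : ∀ p q r s t : ℝ, 0 < p → 0 < q → 0 < r → 0 < s → 0 < t → p ≤ 1 → q ≤ 1 → r ≤ 1 →
      s ≤ 1 → t ≤ 1 → p * q * r * s * t ≤ p ∧ p * q * r * s * t ≤ q ∧ p * q * r * s * t ≤ r ∧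
      p * q * r * s * t ≤ s ∧ p * q * r * s * t ≤ t ∧ p * q * r * s * t ≤ 1 := by
    intro p q r s t hp hq hr hs ht hp1 hq1 hr1 hs1 ht1
    have a1 : p * q ≤ p := mul_le_of_le_one_right hp.le hq1
    have a2 : p * q ≤ q := mul_le_of_le_one_left hq.le hp1
    have b1 : p * q * r ≤ p * q := mul_le_of_le_one_right (by positivity) hr1
    have b2 : p * q * r ≤ r := mul_le_of_le_one_left hr.le (a1.trans hp1)
    have c1 : p * q * r * s ≤ p * q * r := mul_le_of_le_one_right (by positivity) hs1
    have c2 : p * q * r * s ≤ s := mul_le_of_le_one_left hs.le (b2.trans hr1)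
    have d1 : p * q * r * s * t ≤ p * q * r * s := mul_le_of_le_one_right (by positivity) ht1
    have d2 : p * q * r * s * t ≤ t := mul_le_of_le_one_left ht.le (c2.trans hs1)
    refine ⟨?_, ?_, ?_, ?_, ?_, ?_⟩ <;> linarith
  refine key _ _ _ _ _ (by positivity) (by positivity) (by positivity) (by positivity)
    (by positivity) ?_ ?_ ?_ ?_ ?_
  · rw [div_le_one (by positivity)]; linarith
  · rw [div_le_one (by positivity)]; linarith
  · rw [div_le_one (by positivity)]; linarith
  · rw [div_le_one (by positivity)]; linarith
  · rw [div_le_one (by positivity)]; nlinarith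

theorem contractiveMobius_coef {A : Matrix (Fin 2) (Fin 2) ℝ} (hA : ∀ a b, 0 < A a b) {S : ℝ}
    (hS : 0 < S) (hSA : S ≤ matGap A) :
    ContractiveMobius (coefA A) (coefB A) (coefC A) (1 - S) := by
  obtain ⟨h1, h2, h3, h4, -, -⟩ := matGap_le hA
  have hh := halfSum_pos hA
  have := contractiveMobius_of_simplex hS (p := A 0 0 / (2 * halfSum A))
    (q := A 0 1 / (2 * halfSum A)) (r := A 1 0 / (2 * halfSum A)) (s := A 1 1 / (2 * halfSum A))
    (by
      rw [← add_div, ← add_div, ← add_div, div_eq_one_iff_eq (by positivity)]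
      unfold halfSum; ring)
    (hSA.trans h1) (hSA.trans h2) (hSA.trans h3) (hSA.trans h4)
  convert! this using 1 <;> simp only [coefA, coefB, coefC] <;> field_simp

namespace PositiveFamily

variable {m : ℕ} {A : Fin m → Matrix (Fin 2) (Fin 2) ℝ} {w : Fin m → ℝ}

theorem familyGap_pos (h : PositiveFamily A w) : 0 < familyGap A :=
  Finset.prod_pos fun i _ => matGap_pos (h.entry_pos i)

theorem familyGap_le (h : PositiveFamily A w) (i : Fin m) : familyGap A ≤ matGap (A i) := by
  unfold familyGap
  rw [← Finset.mul_prod_erase _ _ (Finset.mem_univ i)]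
  refine mul_le_of_le_one_right (matGap_pos (h.entry_pos i)).le ?_
  exact Finset.prod_le_one (fun j _ => (matGap_pos (h.entry_pos j)).le)
    fun j _ => (matGap_le (h.entry_pos j)).2.2.2.2.2

theorem familyGap_le_one (h : PositiveFamily A w) : familyGap A ≤ 1 :=
  Finset.prod_le_one (fun j _ => (matGap_pos (h.entry_pos j)).le)
    fun j _ => (matGap_le (h.entry_pos j)).2.2.2.2.2

theorem contractive (h : PositiveFamily A w) (i : Fin m) :
    ContractiveMobius (coefA (A i)) (coefB (A i)) (coefC (A i)) (1 - familyGap A) :=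
  contractiveMobius_coef (h.entry_pos i) h.familyGap_pos (h.familyGap_le i)

end PositiveFamily

/-! ### The truncated kernel matrix -/

theorem projMap_zero (A : Matrix (Fin 2) (Fin 2) ℝ) : projMap A 0 = coefB A := by
  simp [projMap, mobius, projMatrix, coefB, halfSum]

theorem projMapT_zero (A : Matrix (Fin 2) (Fin 2) ℝ) : projMapT A 0 = coefC A := by
  simp [projMapT, mobius, projMatrix, coefC, halfSum]

theorem deriv_projMap {A : Matrix (Fin 2) (Fin 2) ℝ} (hA : 0 < halfSum A) :
    deriv (projMap A) 0 = (projMatrix A).det / halfSum A ^ 2 := by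
  set B := projMatrix A with hB
  have hB11 : B 1 1 = halfSum A := by simp [hB, projMatrix, halfSum]
  have h1 : HasDerivAt (fun x => B 0 0 * x + B 0 1) (B 0 0) 0 := by
    simpa using ((hasDerivAt_id (0 : ℝ)).const_mul (B 0 0)).add_const (B 0 1)
  have h2 : HasDerivAt (fun x => B 1 0 * x + B 1 1) (B 1 0) 0 := by
    simpa using ((hasDerivAt_id (0 : ℝ)).const_mul (B 1 0)).add_const (B 1 1)
  have h3 := h1.fun_div h2 (by simp [hB11]; exact hA.ne')
  have : projMap A = fun x => (B 0 0 * x + B 0 1) / (B 1 0 * x + B 1 1) := rfl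
  rw [this, h3.deriv, Matrix.det_fin_two, hB11]
  simp

theorem deriv_projMap_eq {A : Matrix (Fin 2) (Fin 2) ℝ} (hA : 0 < halfSum A) :
    deriv (projMap A) 0 = coefA A - coefB A * coefC A := by
  rw [deriv_projMap hA, Matrix.det_fin_two]
  have h11 : projMatrix A 1 1 = halfSum A := by simp [projMatrix, halfSum]
  rw [h11]
  unfold coefA coefB coefC
  simp only [projMatrix, Matrix.smul_apply, Matrix.of_apply, Matrix.cons_val', Matrix.cons_val_zero,
    Matrix.cons_val_one, smul_eq_mul, Matrix.cons_val_fin_one]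
  field_simp

theorem det_projMatrix (A : Matrix (Fin 2) (Fin 2) ℝ) : (projMatrix A).det = A.det := by
  simp [projMatrix, Matrix.det_fin_two]; ring

/-- Since f'(0) = det F / h², the quotient is h². The cancellation needs an invertible matrix. -/
theorem half_log_det_div {A : Matrix (Fin 2) (Fin 2) ℝ} (hA : 0 < halfSum A) (hdet : A.det ≠ 0) :
    1 / 2 * Real.log ((projMatrix A).det / deriv (projMap A) 0) = Real.log (halfSum A) := by
  rw [deriv_projMap hA]
  have : (projMatrix A).det ≠ 0 := by rwa [det_projMatrix]
  rw [div_div_cancel₀ this, Real.log_pow]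
  push_cast; ring

/-- The mean of the logarithms of the half sums. -/
noncomputable def logMean {m : ℕ} (A : Fin m → Matrix (Fin 2) (Fin 2) ℝ) (w : Fin m → ℝ) : ℝ :=
  ∑ i, w i * Real.log (halfSum (A i))

/-- The iterates of the truncated transfer operator on the Taylor coefficients of the
observable. -/
noncomputable def coeffIterate {m : ℕ} (A : Fin m → Matrix (Fin 2) (Fin 2) ℝ) (w : Fin m → ℝ)
    (M N : ℕ) : ℕ → ℝ :=
  (coeffTransfer w (fun i => coefA (A i)) (fun i => coefB (A i)) (fun i => coefC (A i)) M)^[N]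
    (logCoeff w fun i => coefB (A i))

namespace PositiveFamily

variable {m : ℕ} {A : Fin m → Matrix (Fin 2) (Fin 2) ℝ} {w : Fin m → ℝ}

theorem kernelVec_eq (h : PositiveFamily A w) (n : ℕ) :
    kernelVec A w n = (if n = 0 then logMean A w else 0) +
      logCoeff w (fun i => coefB (A i)) n := by
  unfold kernelVec logCoeff logMean
  rcases Nat.eq_zero_or_pos n with rfl | hn
  · simp only [baseVec, if_true]
    simp only [pow_zero, Nat.cast_zero, div_zero, neg_zero, mul_zero, Finset.sum_const_zero,
      add_zero]
    exact Finset.sum_congr rfl fun i _ => by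
      rw [half_log_det_div (halfSum_pos (h.entry_pos i)) (h.det_ne_zero i)]
  · simp [baseVec, hn.ne', projMap_zero]

theorem kernelEntry_eq (h : PositiveFamily A w) (k n : ℕ) :
    kernelEntry A w k n = if n = 0 then 0 else
      ∑ i, w i * powCoeff (coefA (A i)) (coefB (A i)) (coefC (A i)) n k := by
  unfold kernelEntry
  split_ifs with hn hk
  · rfl
  · simp [hk, powCoeff, coeff_zero_mobiusSeries_pow, projMapT_zero]
  · refine Finset.sum_congr rfl fun i _ => ?_
    rw [powCoeff, coeff_succ_mobiusSeries_pow _ _ _ _ _ hk, projMap_zero, projMapT_zero,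
      deriv_projMap_eq (halfSum_pos (h.entry_pos i))]

/-- The truncated transfer operator fixes the constant 1, so its column 0 is the first unit vector,
whereas column 0 of T is zero. The difference is the subtracted constant term. -/
theorem truncMatrix_mulVec (h : PositiveFamily A w) (M : ℕ) (g : ℕ → ℝ) (k : Fin (M + 1)) :
    (truncMatrix A w (M + 1)).mulVec (fun n => g n) k =
      coeffTransfer w (fun i => coefA (A i)) (fun i => coefB (A i)) (fun i => coefC (A i)) (M + 1)
        g k - if (k : ℕ) = 0 then g 0 else 0 := by
  have h1 : coeffTransfer w (fun i => coefA (A i)) (fun i => coefB (A i)) (fun i => coefC (A i))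
      (M + 1) g k = ∑ n ∈ Finset.range (M + 1),
        (∑ i, w i * powCoeff (coefA (A i)) (coefB (A i)) (coefC (A i)) n k) * g n := by
    unfold coeffTransfer
    simp_rw [Finset.mul_sum, Finset.sum_mul]
    rw [Finset.sum_comm]
    refine Finset.sum_congr rfl fun n _ => Finset.sum_congr rfl fun i _ => by ring
  rw [h1, Matrix.mulVec, dotProduct, Finset.sum_range_succ']
  simp only [truncMatrix, Matrix.of_apply, h.kernelEntry_eq]
  rw [Fin.sum_univ_succ]
  simp only [Fin.val_zero, if_true, zero_mul, zero_add, Fin.val_succ, Nat.add_eq_zero_iff,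
    one_ne_zero, and_false, if_false, powCoeff_zero]
  rw [← Fin.sum_univ_eq_sum_range (fun n => (∑ i, w i * powCoeff (coefA (A i)) (coefB (A i))
    (coefC (A i)) (n + 1) k) * g (n + 1))]
  rw [add_sub_assoc]
  split_ifs <;> simp [h.weight_sum]

/-- A constant added to the argument is kept by the transfer operator and removed again by the
subtraction of the constant term. Hence `logMean` is visible only for n = 0, and later only the
preceding iterate at 0 is subtracted. -/
theorem truncMatrix_pow_mulVec (h : PositiveFamily A w) (M n : ℕ) (k : Fin (M + 1)) :
    ((truncMatrix A w (M + 1)) ^ n).mulVec (truncVec A w (M + 1)) k =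
      coeffIterate A w (M + 1) n k +
        if (k : ℕ) = 0 then (if n = 0 then logMean A w else
          -coeffIterate A w (M + 1) (n - 1) 0) else 0 := by
  induction n generalizing k with
  | zero =>
    simp [truncVec, h.kernelVec_eq, coeffIterate, add_comm]
  | succ n ih =>
    rw [pow_succ', ← Matrix.mulVec_mulVec, funext ih]
    have := h.truncMatrix_mulVec M (fun k => coeffIterate A w (M + 1) n k +
        if k = 0 then (if n = 0 then logMean A w else
          -coeffIterate A w (M + 1) (n - 1) 0) else 0) k
    rw [this]
    set t := (if n = 0 then logMean A w else -coeffIterate A w (M + 1) (n - 1) 0) with ht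
    have hadd : ∀ k, coeffTransfer w (fun i => coefA (A i)) (fun i => coefB (A i))
        (fun i => coefC (A i)) (M + 1) (fun k => coeffIterate A w (M + 1) n k +
          if k = 0 then t else 0) k = coeffIterate A w (M + 1) (n + 1) k +
            if k = 0 then t else 0 := by
      intro k
      have e1 : coeffIterate A w (M + 1) (n + 1) = coeffTransfer w (fun i => coefA (A i))
        (fun i => coefB (A i)) (fun i => coefC (A i)) (M + 1) (coeffIterate A w (M + 1) n) := by
        unfold coeffIterate; rw [Function.iterate_succ_apply']
      rw [e1]
      unfold coeffTransfer
      simp_rw [add_mul, Finset.sum_add_distrib, mul_add, Finset.sum_add_distrib]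
      congr 1
      simp only [ite_mul, zero_mul]
      simp only [Finset.sum_ite_eq', Finset.mem_range, Nat.succ_pos, if_true, powCoeff_zero]
      split_ifs <;> simp [← Finset.sum_mul, h.weight_sum]
    rw [hadd]
    split_ifs <;> simp_all [sub_eq_add_neg]

/-- The sum of the truncated series telescopes. -/
theorem truncSum_eq (h : PositiveFamily A w) (M N : ℕ) :
    truncSum A w (N + 1) (M + 1) = logMean A w + coeffIterate A w (M + 1) N 0 := by
  unfold truncSum
  induction N with
  | zero =>
    rw [Finset.sum_range_one, h.truncMatrix_pow_mulVec]
    simp [add_comm]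
  | succ N ih =>
    rw [Finset.sum_range_succ, ih, h.truncMatrix_pow_mulVec]
    simp only [Fin.val_zero, if_true, Nat.add_eq_zero_iff, one_ne_zero, and_false, if_false,
      Nat.add_sub_cancel]
    ring

end PositiveFamily

/-! ### Sums over words and the Bernoulli measure -/

/-- The product of the matrices along a finite word. -/
def wordProd {m : ℕ} (A : Fin m → Matrix (Fin 2) (Fin 2) ℝ) :
    (n : ℕ) → (Fin n → Fin m) → Matrix (Fin 2) (Fin 2) ℝ
  | 0, _ => 1
  | n + 1, u => A (u (Fin.last n)) * wordProd A n (Fin.init u)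

theorem matProd_eq_wordProd {m : ℕ} (A : Fin m → Matrix (Fin 2) (Fin 2) ℝ) (ω : ℕ → Fin m)
    (n : ℕ) : matProd A ω n = wordProd A n fun i => ω i := by
  induction n with
  | zero => rfl
  | succ n ih => rw [matProd, wordProd, ih]; rfl

theorem matProd_add {m : ℕ} (A : Fin m → Matrix (Fin 2) (Fin 2) ℝ) (ω : ℕ → Fin m) (n k : ℕ) :
    matProd A ω (n + k) = matProd A (fun j => ω (n + j)) k * matProd A ω n := by
  induction k with
  | zero => simp [matProd]
  | succ k ih => rw [← add_assoc, matProd, ih, matProd, mul_assoc]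

/-- The weight of a finite word. -/
def wordWeight {m : ℕ} (w : Fin m → ℝ) {n : ℕ} (u : Fin n → Fin m) : ℝ := ∏ i, w (u i)

/-- The letter split off is the last one, which belongs to the leftmost matrix. -/
theorem sum_word_succ {m : ℕ} (w : Fin m → ℝ) {n : ℕ} (G : (Fin (n + 1) → Fin m) → ℝ) :
    ∑ u, wordWeight w u * G u =
      ∑ i, w i * ∑ u : Fin n → Fin m, wordWeight w u * G (Fin.snoc u i) := by
  rw [← (Fin.snocEquiv fun _ => Fin m).sum_comp, Fintype.sum_prod_type]
  refine Finset.sum_congr rfl fun i _ => ?_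
  rw [Finset.mul_sum]
  refine Finset.sum_congr rfl fun u _ => ?_
  have : wordWeight w (Fin.snocEquiv (fun _ => Fin m) (i, u)) = w i * wordWeight w u := by
    unfold wordWeight
    rw [Fin.prod_univ_castSucc, mul_comm]
    simp [Fin.snocEquiv]
  rw [this, mul_assoc]
  rfl

theorem sum_wordWeight {m : ℕ} {w : Fin m → ℝ} (hsum : ∑ i, w i = 1) (n : ℕ) :
    ∑ u : Fin n → Fin m, wordWeight w u = 1 := by
  unfold wordWeight
  rw [← Fintype.sum_pow, hsum, one_pow]

theorem sum_wordWeight_mul_add {m : ℕ} {w : Fin m → ℝ} (hsum : ∑ i, w i = 1) {n : ℕ} (c : ℝ)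
    (G : (Fin n → Fin m) → ℝ) :
    ∑ u, wordWeight w u * (c + G u) = c + ∑ u, wordWeight w u * G u := by
  simp_rw [mul_add, Finset.sum_add_distrib, ← Finset.sum_mul, sum_wordWeight hsum, one_mul]

/-! ### The law of large numbers for blocks of the Bernoulli sequence -/

section Measure

variable {m : ℕ} {w : Fin m → ℝ}

theorem weightMeasure_singleton (w : Fin m → ℝ) (i : Fin m) :
    weightMeasure w {i} = ENNReal.ofReal (w i) := by
  simp only [weightMeasure, Measure.coe_finsetSum, Measure.coe_smul, Finset.sum_apply,
    Pi.smul_apply, smul_eq_mul]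
  rw [Finset.sum_eq_single i]
  · simp
  · intro j _ hj; simp [hj]
  · simp

theorem isProbabilityMeasure_weightMeasure (hw : ∀ i, 0 < w i) (hsum : ∑ i, w i = 1) :
    IsProbabilityMeasure (weightMeasure w) := by
  constructor
  simp only [weightMeasure, Measure.coe_finsetSum, Measure.coe_smul, Finset.sum_apply,
    Pi.smul_apply, smul_eq_mul, measure_univ, mul_one]
  rw [← ENNReal.ofReal_sum_of_nonneg fun i _ => (hw i).le, hsum, ENNReal.ofReal_one]

theorem isProbabilityMeasure_bernoulliMeasure (hw : ∀ i, 0 < w i) (hsum : ∑ i, w i = 1) :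
    IsProbabilityMeasure (bernoulliMeasure w) := by
  have := isProbabilityMeasure_weightMeasure hw hsum
  unfold bernoulliMeasure
  infer_instance

/-- The strong law of large numbers for functions of successive blocks. -/
theorem ae_tendsto_block_average (hw : ∀ i, 0 < w i) (hsum : ∑ i, w i = 1) (b : ℕ)
    (G : (Fin b → Fin m) → ℝ) :
    ∀ᵐ ω ∂(bernoulliMeasure w),
      Tendsto (fun q : ℕ => (∑ j ∈ Finset.range q, G fun i => ω (j * b + i)) / q) atTop
        (𝓝 (∑ u, wordWeight w u * G u)) := by
  have hP := isProbabilityMeasure_weightMeasure hw hsum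
  have hB := isProbabilityMeasure_bernoulliMeasure hw hsum
  set μ := bernoulliMeasure w with hμ
  set X : ℕ → (ℕ → Fin m) → ℝ := fun j ω => G fun i => ω (j * b + i) with hX
  have hG : Measurable G := Measurable.of_discrete
  have hblock : ∀ j, Measurable fun (ω : ℕ → Fin m) (i : Fin b) => ω (j * b + i) := by
    intro j; fun_prop
  have hlaw : ∀ j, μ.map (fun (ω : ℕ → Fin m) (i : Fin b) => ω (j * b + i)) =
      Measure.infinitePi fun _ : Fin b => weightMeasure w := by
    intro j
    exact Measure.map_infinitePi_infinitePi_of_inj (P := fun _ : ℕ => weightMeasure w)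
      (f := fun i : Fin b => j * b + i) (fun i i' h => by
        apply Fin.ext; simpa using h)
  have hint : Integrable (X 0) μ := by
    refine Integrable.of_bound (C := ∑ u, |G u|) (hG.comp (hblock 0)).aestronglyMeasurable ?_
    refine Eventually.of_forall fun ω => ?_
    exact Finset.single_le_sum (f := fun u => |G u|) (fun u _ => abs_nonneg _) (Finset.mem_univ _)
  have hindep : Pairwise (Function.onFun (ProbabilityTheory.IndepFun · · μ) X) := by
    intro j j' hj
    have h0 : ProbabilityTheory.iIndepFun (fun (i : ℕ) (ω : ℕ → Fin m) => ω i) μ :=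
      ProbabilityTheory.iIndepFun_infinitePi (P := fun _ : ℕ => weightMeasure w)
        (X := fun _ x => x) (fun _ => measurable_id)
    -- Different blocks read disjoint sets of coordinates, whence their independence.
    have hdisj : Disjoint (Finset.Ico (j * b) (j * b + b)) (Finset.Ico (j' * b) (j' * b + b)) := by
      rw [Finset.disjoint_left]
      intro x hx hx'
      simp only [Finset.mem_Ico] at hx hx'
      apply hj
      have h1 : j * b < (j' + 1) * b := by rw [add_mul, one_mul]; lia
      have h2 : j' * b < (j + 1) * b := by rw [add_mul, one_mul]; lia
      have h3 := Nat.lt_of_mul_lt_mul_right h1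
      have h4 := Nat.lt_of_mul_lt_mul_right h2
      lia
    have h1 := h0.indepFun_finset _ _ hdisj (fun i => measurable_pi_apply i)
    have hc : ∀ j : ℕ, Measurable fun v : (Finset.Ico (j * b) (j * b + b)) → Fin m =>
        G fun i : Fin b => v ⟨j * b + i, by simp⟩ := by
      intro j
      exact hG.comp (by fun_prop)
    exact h1.comp (hc j) (hc j')
  have hident : ∀ j, ProbabilityTheory.IdentDistrib (X j) (X 0) μ μ := by
    intro j
    have : ProbabilityTheory.IdentDistrib (fun (ω : ℕ → Fin m) (i : Fin b) => ω (j * b + i))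
        (fun (ω : ℕ → Fin m) (i : Fin b) => ω (0 * b + i)) μ μ :=
      ⟨(hblock j).aemeasurable, (hblock 0).aemeasurable, by rw [hlaw, hlaw]⟩
    exact this.comp hG
  have hmean : ∫ ω, X 0 ω ∂μ = ∑ u, wordWeight w u * G u := by
    have h1 : ∫ ω, X 0 ω ∂μ =
        ∫ u, G u ∂(μ.map fun (ω : ℕ → Fin m) (i : Fin b) => ω (0 * b + i)) := by
      rw [integral_map (hblock 0).aemeasurable hG.aestronglyMeasurable]
    rw [h1, hlaw, integral_fintype (Integrable.of_finite)]
    refine Finset.sum_congr rfl fun u _ => ?_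
    rw [smul_eq_mul, Measure.real, Measure.infinitePi_singleton_of_fintype, ENNReal.toReal_prod]
    congr 1
    refine Finset.prod_congr rfl fun i _ => ?_
    rw [weightMeasure_singleton, ENNReal.toReal_ofReal (hw _).le]
  rw [← hmean]
  exact ProbabilityTheory.strong_law_ae_real X hint hindep hident

end Measure

/-! ### The mean logarithmic growth -/

/-- The sum of the entries of the product `yᵀ P` with `y` the point of the simplex with
coordinate `x`. -/
noncomputable def simplexSum (x : ℝ) (P : Matrix (Fin 2) (Fin 2) ℝ) : ℝ :=
  (1 + x) / 2 * (P 0 0 + P 0 1) + (1 - x) / 2 * (P 1 0 + P 1 1)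

/-- Multiplying a simplex row vector by A gives total mass h(1+bx), and normalizing it gives the
point with coordinate fᵀ(x). This is where the transposed maps come from. -/
theorem simplexSum_mul {A : Matrix (Fin 2) (Fin 2) ℝ} (hA : 0 < halfSum A) (P) {x : ℝ}
    (hx : coefB A * x + 1 ≠ 0) :
    simplexSum x (A * P) = halfSum A * (1 + coefB A * x) *
      simplexSum ((coefA A * x + coefC A) / (coefB A * x + 1)) P := by
  have h1 : 1 + coefB A * x ≠ 0 := by rwa [add_comm]
  have e1 : (1 + coefB A * x) * ((coefA A * x + coefC A) / (coefB A * x + 1)) =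
      coefA A * x + coefC A := by
    rw [add_comm 1]; field_simp
  have e2 : halfSum A * coefA A = 1 / 2 * (A 0 0 - A 0 1 - A 1 0 + A 1 1) := by
    unfold coefA; field_simp
  have e3 : halfSum A * coefB A = 1 / 2 * (A 0 0 + A 0 1 - A 1 0 - A 1 1) := by
    unfold coefB; field_simp
  have e4 : halfSum A * coefC A = 1 / 2 * (A 0 0 - A 0 1 + A 1 0 - A 1 1) := by
    unfold coefC; field_simp
  have e5 : halfSum A = 1 / 2 * (A 0 0 + A 0 1 + A 1 0 + A 1 1) := rfl
  have e6 : halfSum A * (1 + coefB A * x) *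
      simplexSum ((coefA A * x + coefC A) / (coefB A * x + 1)) P =
      ((halfSum A + halfSum A * coefB A * x) + (halfSum A * coefA A * x + halfSum A * coefC A)) / 2
        * (P 0 0 + P 0 1) +
      ((halfSum A + halfSum A * coefB A * x) - (halfSum A * coefA A * x + halfSum A * coefC A)) / 2
        * (P 1 0 + P 1 1) := by
    unfold simplexSum
    linear_combination (halfSum A / 2 * (P 0 0 + P 0 1) - halfSum A / 2 * (P 1 0 + P 1 1)) * e1
  rw [e6, e2, e3, e4, e5]
  unfold simplexSum
  simp only [Matrix.mul_apply, Fin.sum_univ_two]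
  ring

section Growth

variable {m : ℕ} {A : Fin m → Matrix (Fin 2) (Fin 2) ℝ} {w : Fin m → ℝ}

theorem wordProd_nonneg (hA : ∀ i a b, 0 < A i a b) (n : ℕ) (u : Fin n → Fin m) (a b : Fin 2) :
    0 ≤ wordProd A n u a b := by
  induction n generalizing a b with
  | zero => simp only [wordProd, Matrix.one_apply]; split_ifs <;> norm_num
  | succ n ih =>
    rw [wordProd, Matrix.mul_apply]
    exact Finset.sum_nonneg fun c _ => mul_nonneg (hA _ _ _).le (ih _ _ _)

theorem wordProd_row_pos (hA : ∀ i a b, 0 < A i a b) (n : ℕ) (u : Fin n → Fin m) (a : Fin 2) :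
    0 < wordProd A n u a 0 + wordProd A n u a 1 := by
  induction n generalizing a with
  | zero =>
    revert a
    rw [Fin.forall_fin_two]
    simp [wordProd]
  | succ n ih =>
    rw [wordProd]
    simp only [Matrix.mul_apply, Fin.sum_univ_two]
    have h0 := ih (Fin.init u) 0
    have h1 := ih (Fin.init u) 1
    have p0 := mul_pos (hA (u (Fin.last n)) a 0) h0
    have p1 := mul_pos (hA (u (Fin.last n)) a 1) h1
    linarith

theorem simplexSum_wordProd_pos (hA : ∀ i a b, 0 < A i a b) (n : ℕ) (u : Fin n → Fin m) {x : ℝ}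
    (hx : |x| ≤ 1) : 0 < simplexSum x (wordProd A n u) := by
  have h0 := wordProd_row_pos hA n u 0
  have h1 := wordProd_row_pos hA n u 1
  obtain ⟨x1, x2⟩ := abs_le.1 hx
  unfold simplexSum
  rcases le_total 0 x with h | h
  · have := mul_pos (by linarith : 0 < (1 + x) / 2) h0
    have := mul_nonneg (by linarith : 0 ≤ (1 - x) / 2) h1.le
    linarith
  · have := mul_nonneg (by linarith : 0 ≤ (1 + x) / 2) h0.le
    have := mul_pos (by linarith : 0 < (1 - x) / 2) h1
    linarith

/-- The transfer operator of a family of matrices. -/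
noncomputable def famTransfer (A : Fin m → Matrix (Fin 2) (Fin 2) ℝ) (w : Fin m → ℝ) :
    (ℝ → ℝ) → ℝ → ℝ :=
  transfer w (fun i => coefA (A i)) (fun i => coefB (A i)) (fun i => coefC (A i))

/-- The observable of a family of matrices. -/
noncomputable def famLog (A : Fin m → Matrix (Fin 2) (Fin 2) ℝ) (w : Fin m → ℝ) : ℝ → ℝ :=
  logPart w fun i => coefB (A i)

/-- Peeling off the leftmost matrix yields log h_i + log(1 + b_i x) and moves x to its image.
Averaging over i gives `logMean` plus the observable, and one application of the transfer operator
to the rest, which shifts the sum over k by one. -/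
theorem PositiveFamily.sum_log_simplexSum (h : PositiveFamily A w) (n : ℕ) {x : ℝ}
    (hx : |x| ≤ 1) :
    ∑ u, wordWeight w u * Real.log (simplexSum x (wordProd A n u)) =
      n * logMean A w + ∑ k ∈ Finset.range n, (famTransfer A w)^[k] (famLog A w) x := by
  induction n generalizing x with
  | zero =>
    have : simplexSum x (1 : Matrix (Fin 2) (Fin 2) ℝ) = 1 := by
      simp [simplexSum]; ring
    simp [wordProd, this]
  | succ n ih =>
    rw [sum_word_succ]
    have key : ∀ i, ∑ u : Fin n → Fin m, wordWeight w u *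
        Real.log (simplexSum x (wordProd A (n + 1) (Fin.snoc u i : Fin (n + 1) → Fin m))) =
        Real.log (halfSum (A i)) + Real.log (1 + coefB (A i) * x) +
          (n * logMean A w + ∑ k ∈ Finset.range n, (famTransfer A w)^[k] (famLog A w)
            ((coefA (A i) * x + coefC (A i)) / (coefB (A i) * x + 1))) := by
      intro i
      have hc := h.contractive i
      have hy := hc.abs_apply_le h.familyGap_pos hx
      have hd := hc.denom_pos h.familyGap_pos hx
      have hh := halfSum_pos (h.entry_pos i)
      rw [← ih hy, ← sum_wordWeight_mul_add h.weight_sum]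
      refine Finset.sum_congr rfl fun u _ => ?_
      rw [wordProd]
      simp only [Fin.snoc_last, Fin.init_snoc]
      have hs := simplexSum_wordProd_pos h.entry_pos n u hy
      rw [simplexSum_mul hh _ hd.ne', Real.log_mul (by rw [add_comm] at hd; positivity) hs.ne',
        Real.log_mul hh.ne' (by rw [add_comm]; exact hd.ne')]
    simp_rw [key, mul_add, Finset.sum_add_distrib, ← Finset.sum_mul, h.weight_sum]
    rw [Finset.sum_range_succ']
    simp_rw [Finset.mul_sum]
    rw [Finset.sum_comm]
    simp only [Function.iterate_succ_apply']
    simp only [famTransfer, transfer, famLog, logMean, logPart, Function.iterate_zero, id]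
    push_cast
    ring

theorem entryNorm_eq (hA : ∀ i a b, 0 < A i a b) (n : ℕ) (u : Fin n → Fin m) :
    entryNorm (wordProd A n u) = 2 * simplexSum 0 (wordProd A n u) := by
  simp only [entryNorm, Fin.sum_univ_two, abs_of_nonneg (wordProd_nonneg hA n u _ _), simplexSum]
  ring

theorem entryNorm_wordProd_pos (hA : ∀ i a b, 0 < A i a b) (n : ℕ) (u : Fin n → Fin m) :
    0 < entryNorm (wordProd A n u) := by
  rw [entryNorm_eq hA]
  have := simplexSum_wordProd_pos hA n u (x := 0) (by simp)
  linarith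

theorem PositiveFamily.sum_log_entryNorm (h : PositiveFamily A w) (n : ℕ) :
    ∑ u, wordWeight w u * Real.log (entryNorm (wordProd A n u)) =
      Real.log 2 + (n * logMean A w +
        ∑ k ∈ Finset.range n, (famTransfer A w)^[k] (famLog A w) 0) := by
  rw [← h.sum_log_simplexSum n (by simp), ← sum_wordWeight_mul_add h.weight_sum]
  refine Finset.sum_congr rfl fun u _ => ?_
  have := simplexSum_wordProd_pos h.entry_pos n u (x := 0) (by simp)
  rw [entryNorm_eq h.entry_pos, Real.log_mul two_ne_zero this.ne']

/-- The mean is log 2 / n plus `logMean` plus a Cesàro average of a convergent sequence. -/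
theorem PositiveFamily.tendsto_mean (h : PositiveFamily A w) {l : ℝ}
    (hl : Tendsto (fun n => (famTransfer A w)^[n] (famLog A w) 0) atTop (𝓝 l)) :
    Tendsto (fun n : ℕ => (∑ u, wordWeight w u * Real.log (entryNorm (wordProd A n u))) / n)
      atTop (𝓝 (logMean A w + l)) := by
  have h1 := hl.cesaro
  have h2 : Tendsto (fun n : ℕ => Real.log 2 / (n : ℝ)) atTop (𝓝 0) :=
    tendsto_const_nhds.div_atTop tendsto_natCast_atTop_atTop
  have h3 := (h2.add (tendsto_const_nhds (x := logMean A w))).add h1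
  rw [zero_add] at h3
  refine h3.congr' ?_
  filter_upwards [eventually_gt_atTop 0] with n hn
  rw [h.sum_log_entryNorm]
  have : (n : ℝ) ≠ 0 := by positivity
  field_simp
  ring

/-! ### Almost additivity -/

theorem entryNorm_eq_sum (P : Matrix (Fin 2) (Fin 2) ℝ) (hP : ∀ a b, 0 ≤ P a b) :
    entryNorm P = P 0 0 + P 0 1 + (P 1 0 + P 1 1) := by
  simp only [entryNorm, Fin.sum_univ_two, abs_of_nonneg (hP _ _)]

/-- Each entry of the leftmost factor is at least `familyGap A` times its entry sum, so no row of
the product is negligible. The factor 1/2 accommodates the empty word, where a row sum is 1 and the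
norm 2. -/
theorem PositiveFamily.row_ge (h : PositiveFamily A w) (n : ℕ) (u : Fin n → Fin m) (a : Fin 2) :
    familyGap A / 2 * entryNorm (wordProd A n u) ≤ wordProd A n u a 0 + wordProd A n u a 1 := by
  have hg1 := h.familyGap_le_one
  have hg0 := h.familyGap_pos
  rw [entryNorm_eq_sum _ (wordProd_nonneg h.entry_pos n u)]
  cases n with
  | zero =>
    revert a
    rw [Fin.forall_fin_two]
    simp only [wordProd, Matrix.one_apply]
    constructor <;> norm_num <;> linarith
  | succ n =>
    rw [wordProd]
    simp only [Matrix.mul_apply, Fin.sum_univ_two]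
    set B := A (u (Fin.last n)) with hB
    have hBp := h.entry_pos (u (Fin.last n))
    have h0 := wordProd_row_pos h.entry_pos n (Fin.init u) 0
    have h1 := wordProd_row_pos h.entry_pos n (Fin.init u) 1
    obtain ⟨g1, g2, g3, g4, -, -⟩ := matGap_le hBp
    have hle := h.familyGap_le (u (Fin.last n))
    rw [← hB] at *
    have hh : 0 < 2 * halfSum B := by linarith [halfSum_pos hBp]
    have hs : 2 * halfSum B = B 0 0 + B 0 1 + B 1 0 + B 1 1 := by unfold halfSum; ring
    have q1 : familyGap A * (2 * halfSum B) ≤ B 0 0 := (le_div_iff₀ hh).1 (hle.trans g1)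
    have q2 : familyGap A * (2 * halfSum B) ≤ B 0 1 := (le_div_iff₀ hh).1 (hle.trans g2)
    have q3 : familyGap A * (2 * halfSum B) ≤ B 1 0 := (le_div_iff₀ hh).1 (hle.trans g3)
    have q4 : familyGap A * (2 * halfSum B) ≤ B 1 1 := (le_div_iff₀ hh).1 (hle.trans g4)
    set Q := wordProd A n (Fin.init u)
    have b1 := hBp 0 0
    have b2 := hBp 0 1
    have b3 := hBp 1 0
    have b4 := hBp 1 1
    have r0 : familyGap A * (B 0 0 + B 1 0) ≤ familyGap A * (2 * halfSum B) :=
      mul_le_mul_of_nonneg_left (by linarith) hg0.le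
    have r1 : familyGap A * (B 0 1 + B 1 1) ≤ familyGap A * (2 * halfSum B) :=
      mul_le_mul_of_nonneg_left (by linarith) hg0.le
    have n0 : 0 ≤ familyGap A * (B 0 0 + B 1 0) := by positivity
    have n1 : 0 ≤ familyGap A * (B 0 1 + B 1 1) := by positivity
    have row : ∀ s t : ℝ, familyGap A * (2 * halfSum B) ≤ s → familyGap A * (2 * halfSum B) ≤ t →
        familyGap A / 2 * ((B 0 0 + B 1 0) * (Q 0 0 + Q 0 1) + (B 0 1 + B 1 1) * (Q 1 0 + Q 1 1)) ≤
        s * (Q 0 0 + Q 0 1) + t * (Q 1 0 + Q 1 1) := by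
      intro s t hs ht
      have i0 := mul_le_mul_of_nonneg_right
        (by linarith : familyGap A / 2 * (B 0 0 + B 1 0) ≤ s) h0.le
      have i1 := mul_le_mul_of_nonneg_right
        (by linarith : familyGap A / 2 * (B 0 1 + B 1 1) ≤ t) h1.le
      linarith
    have hr : familyGap A / 2 * ((B 0 0 + B 1 0) * (Q 0 0 + Q 0 1) +
        (B 0 1 + B 1 1) * (Q 1 0 + Q 1 1)) ≤
        B a 0 * (Q 0 0 + Q 0 1) + B a 1 * (Q 1 0 + Q 1 1) := by
      fin_cases a
      · exact row _ _ q1 q2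
      · exact row _ _ q3 q4
    linarith

/-- For nonnegative matrices the entry sum is submultiplicative; conversely, by `row_ge` for the
right factor, at most a factor `familyGap A` / 2 is lost. -/
theorem PositiveFamily.exists_almost_additive (h : PositiveFamily A w) :
    ∃ C, 0 ≤ C ∧ ∀ (ω : ℕ → Fin m) (n k : ℕ),
      |Real.log (entryNorm (matProd A ω (n + k))) - (Real.log (entryNorm (matProd A ω n)) +
        Real.log (entryNorm (matProd A (fun j => ω (n + j)) k)))| ≤ C := by
  have hg1 := h.familyGap_le_one
  have hg0 := h.familyGap_pos
  refine ⟨-Real.log (familyGap A / 2), ?_, fun ω n k => ?_⟩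
  · rw [neg_nonneg]
    exact Real.log_nonpos (by linarith) (by linarith)
  rw [matProd_add, matProd_eq_wordProd A ω n, matProd_eq_wordProd A _ k]
  set P := wordProd A k fun i => ω (n + i) with hP
  set Q := wordProd A n fun i => ω i with hQ
  have hPn := wordProd_nonneg h.entry_pos k fun i => ω (n + i)
  have hQn := wordProd_nonneg h.entry_pos n fun i => ω i
  have hP0 := entryNorm_wordProd_pos h.entry_pos k fun i => ω (n + i)
  have hQ0 := entryNorm_wordProd_pos h.entry_pos n fun i => ω i
  have r0 := h.row_ge n (fun i => ω i) 0
  have r1 := h.row_ge n (fun i => ω i) 1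
  rw [← hP] at hPn hP0
  rw [← hQ] at hQn hQ0 r0 r1
  have hPe := entryNorm_eq_sum P hPn
  have hQe := entryNorm_eq_sum Q hQn
  have hPQe := entryNorm_eq_sum (P * Q) (fun a b => by
    rw [Matrix.mul_apply]; exact Finset.sum_nonneg fun c _ => mul_nonneg (hPn _ _) (hQn _ _))
  have hPQ : entryNorm (P * Q) = (P 0 0 + P 1 0) * (Q 0 0 + Q 0 1) +
      (P 0 1 + P 1 1) * (Q 1 0 + Q 1 1) := by
    rw [hPQe]; simp only [Matrix.mul_apply, Fin.sum_univ_two]; ring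
  have p00 := hPn 0 0
  have p01 := hPn 0 1
  have p10 := hPn 1 0
  have p11 := hPn 1 1
  have q00 := hQn 0 0
  have q01 := hQn 0 1
  have q10 := hQn 1 0
  have q11 := hQn 1 1
  have lower : familyGap A / 2 * (entryNorm Q * entryNorm P) ≤ entryNorm (P * Q) := by
    rw [hPQ]
    have i0 := mul_le_mul_of_nonneg_left r0 (by linarith : 0 ≤ P 0 0 + P 1 0)
    have i1 := mul_le_mul_of_nonneg_left r1 (by linarith : 0 ≤ P 0 1 + P 1 1)
    calc _ = (P 0 0 + P 1 0) * (familyGap A / 2 * entryNorm Q) +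
          (P 0 1 + P 1 1) * (familyGap A / 2 * entryNorm Q) := by rw [hPe]; ring
      _ ≤ _ := add_le_add i0 i1
  have upper : entryNorm (P * Q) ≤ entryNorm Q * entryNorm P := by
    rw [hPQ, hPe, hQe]
    have := mul_nonneg (by linarith : 0 ≤ P 0 0 + P 1 0) (by linarith : 0 ≤ Q 1 0 + Q 1 1)
    have := mul_nonneg (by linarith : 0 ≤ P 0 1 + P 1 1) (by linarith : 0 ≤ Q 0 0 + Q 0 1)
    linarith
  have hpos : 0 < familyGap A / 2 * (entryNorm Q * entryNorm P) := by positivity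
  rw [← Real.log_mul hQ0.ne' hP0.ne']
  have l1 := Real.log_le_log hpos lower
  rw [Real.log_mul (by positivity) (by positivity)] at l1
  have l2 := Real.log_le_log (hpos.trans_le lower) upper
  have l3 : Real.log (familyGap A / 2) ≤ 0 := Real.log_nonpos (by linarith) (by linarith)
  rw [abs_le]
  constructor <;> linarith

/-- A quasi-additive sequence follows its block averages. -/
theorem tendsto_div_of_almost_additive {W : ℕ → ℝ} {Y : ℕ → ℕ → ℝ} {mean : ℕ → ℝ}
    {C D l : ℝ} (hD : 0 ≤ D)
    (hadd : ∀ b q, |W ((q + 1) * b) - (W (q * b) + Y b q)| ≤ C)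
    (hstep : ∀ n, |W (n + 1) - W n| ≤ D)
    (havg : ∀ b, Tendsto (fun q : ℕ => (∑ j ∈ Finset.range q, Y b j) / q) atTop (𝓝 (mean b)))
    (hmean : Tendsto (fun b : ℕ => mean b / b) atTop (𝓝 l)) :
    Tendsto (fun n : ℕ => W n / n) atTop (𝓝 l) := by
  rw [Metric.tendsto_atTop]
  intro e he
  set η := e / 5 with hη
  have hη0 : 0 < η := by positivity
  -- The defect C per block, together with the error η of the block average, amounts to at most η
  -- per letter.
  obtain ⟨b, hb1, hbC, hbm⟩ : ∃ b : ℕ, 0 < b ∧ C + η ≤ b * η ∧ |mean b / b - l| ≤ η := by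
    have h1 : ∀ᶠ b : ℕ in atTop, C + η ≤ b * η := by
      filter_upwards [eventually_ge_atTop ⌈(C + η) / η⌉₊] with b hb
      rw [← div_le_iff₀ hη0]
      exact (Nat.le_ceil _).trans (by exact_mod_cast hb)
    have h2 : ∀ᶠ b : ℕ in atTop, |mean b / b - l| ≤ η := by
      filter_upwards [hmean.eventually (Metric.closedBall_mem_nhds l hη0)] with b hb
      simpa [Real.dist_eq] using hb
    obtain ⟨b, hb⟩ := (h1.and (h2.and (eventually_gt_atTop 0))).exists
    exact ⟨b, hb.2.2, hb.1, hb.2.1⟩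
  have hb0 : (0 : ℝ) < b := by exact_mod_cast hb1
  have hblock : ∀ q : ℕ, |W (q * b) - (W 0 + ∑ j ∈ Finset.range q, Y b j)| ≤ q * C := by
    intro q
    induction q with
    | zero => simp
    | succ q ih =>
      rw [Finset.sum_range_succ]
      have := abs_add_le (W ((q + 1) * b) - (W (q * b) + Y b q))
        (W (q * b) - (W 0 + ∑ j ∈ Finset.range q, Y b j))
      have e1 : W ((q + 1) * b) - (W 0 + (∑ j ∈ Finset.range q, Y b j + Y b q)) =
        W ((q + 1) * b) - (W (q * b) + Y b q) +
          (W (q * b) - (W 0 + ∑ j ∈ Finset.range q, Y b j)) := by ring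
      rw [e1]
      push_cast
      linarith [hadd b q]
  have hsteps : ∀ n r : ℕ, |W (n + r) - W n| ≤ r * D := by
    intro n r
    induction r with
    | zero => simp
    | succ r ih =>
      have := abs_add_le (W (n + r + 1) - W (n + r)) (W (n + r) - W n)
      rw [sub_add_sub_cancel] at this
      rw [← add_assoc]
      push_cast
      linarith [hstep (n + r)]
  obtain ⟨q0, hq0⟩ := (eventually_atTop.1
    ((havg b).eventually (Metric.closedBall_mem_nhds (mean b) hη0)))
  -- The errors that do not grow with n: the initial value, the incomplete last block, and the
  -- replacement of q b by n.
  set K := |W 0| + b * D + b * |l| with hK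
  refine ⟨max (q0 * b + b) (max 1 ⌈K / η⌉₊), fun n hn => ?_⟩
  have hn1 : q0 * b + b ≤ n := (le_max_left _ _).trans hn
  have hn2 : 1 ≤ n := (le_max_left _ _).trans ((le_max_right _ _).trans hn)
  have hn3 : K / η ≤ n :=
    (Nat.le_ceil _).trans (by exact_mod_cast (le_max_right _ _).trans ((le_max_right _ _).trans hn))
  set q := n / b with hq
  set r := n % b with hr
  have hqr : q * b + r = n := by rw [mul_comm]; exact Nat.div_add_mod n b
  have hrb : r < b := Nat.mod_lt _ hb1
  have hqq0 : q0 ≤ q := by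
    rw [hq, Nat.le_div_iff_mul_le hb1]; lia
  have hqpos : 0 < q := by
    rw [hq]; exact Nat.div_pos (by lia) hb1
  have hq' : (0 : ℝ) < q := by exact_mod_cast hqpos
  have hn' : (0 : ℝ) < n := by exact_mod_cast hn2
  have hqrR : (q : ℝ) * b + r = n := by exact_mod_cast hqr
  have hr0 : (0 : ℝ) ≤ r := Nat.cast_nonneg r
  have hrbR : (r : ℝ) ≤ b := by exact_mod_cast hrb.le
  have h1 : |W n - W (q * b)| ≤ b * D := by
    rw [← hqr]
    exact (hsteps _ _).trans (mul_le_mul_of_nonneg_right hrbR hD)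
  have h2 := hblock q
  have h3 : |∑ j ∈ Finset.range q, Y b j - q * mean b| ≤ q * η := by
    have := hq0 q hqq0
    rw [Real.dist_eq] at this
    calc _ = |q * ((∑ j ∈ Finset.range q, Y b j) / q - mean b)| := by
          congr 1; field_simp
      _ = q * |(∑ j ∈ Finset.range q, Y b j) / q - mean b| := by rw [abs_mul, abs_of_pos hq']
      _ ≤ _ := mul_le_mul_of_nonneg_left this hq'.le
  have h4 : |q * mean b - q * b * l| ≤ q * b * η := by
    calc _ = |q * b * (mean b / b - l)| := by congr 1; field_simp
      _ = q * b * |mean b / b - l| := by rw [abs_mul, abs_of_pos (by positivity)]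
      _ ≤ _ := mul_le_mul_of_nonneg_left hbm (by positivity)
  have h5 : |q * b * l - n * l| ≤ b * |l| := by
    rw [← hqrR, ← sub_mul, abs_mul]
    refine mul_le_mul_of_nonneg_right ?_ (abs_nonneg _)
    rw [abs_le]; constructor <;> linarith
  have h6 : |W n - n * l| ≤ K + 2 * n * η := by
    have e1 : W n - n * l = (W n - W (q * b)) + (W (q * b) - (W 0 + ∑ j ∈ Finset.range q, Y b j)) +
      W 0 + (∑ j ∈ Finset.range q, Y b j - q * mean b) + (q * mean b - q * b * l) +
      (q * b * l - n * l) := by ring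
    have e2 : q * C + q * η ≤ q * b * η := by nlinarith
    have e3 : q * b * η ≤ n * η := mul_le_mul_of_nonneg_right (by linarith) hη0.le
    rw [e1]
    refine (abs_add_le _ _).trans ?_
    refine (add_le_add_left (abs_add_le _ _) _).trans ?_
    refine (add_le_add_left (add_le_add_left (abs_add_le _ _) _) _).trans ?_
    refine (add_le_add_left (add_le_add_left (add_le_add_left (abs_add_le _ _) _) _) _).trans ?_
    refine (add_le_add_left (add_le_add_left (add_le_add_left (add_le_add_left
      (abs_add_le _ _) _) _) _) _).trans ?_
    linarith
  have h7 : K ≤ n * η := (div_le_iff₀ hη0).1 hn3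
  rw [Real.dist_eq]
  have e1 : W n / n - l = (W n - n * l) / n := by field_simp
  rw [e1, abs_div, abs_of_pos hn', div_lt_iff₀ hn']
  have : (n : ℝ) * η * 3 < e * n := by rw [hη]; nlinarith
  linarith

/-- The bounded additivity defect makes the law of large numbers for blocks sufficient, without a
subadditive ergodic theorem. The block lengths are countably many, so one null set serves them all.
-/
theorem PositiveFamily.isTopLyapunovExponent (h : PositiveFamily A w) {l : ℝ}
    (hl : Tendsto (fun n => (famTransfer A w)^[n] (famLog A w) 0) atTop (𝓝 l)) :
    IsTopLyapunovExponent A w (logMean A w + l) := by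
  obtain ⟨C, hC, hadd⟩ := h.exists_almost_additive
  have hae : ∀ᵐ ω ∂(bernoulliMeasure w), ∀ b : ℕ,
      Tendsto (fun q : ℕ => (∑ j ∈ Finset.range q,
        Real.log (entryNorm (wordProd A b fun i => ω (j * b + i)))) / q) atTop
        (𝓝 (∑ u, wordWeight w u * Real.log (entryNorm (wordProd A b u)))) :=
    ae_all_iff.2 fun b => ae_tendsto_block_average h.weight_pos h.weight_sum b
      fun u => Real.log (entryNorm (wordProd A b u))
  unfold IsTopLyapunovExponent
  filter_upwards [hae] with ω hω
  have hD : 0 ≤ ∑ i, |Real.log (entryNorm (A i))| := Finset.sum_nonneg fun _ _ => abs_nonneg _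
  have := tendsto_div_of_almost_additive (W := fun n => Real.log (entryNorm (matProd A ω n)))
    (Y := fun b j => Real.log (entryNorm (wordProd A b fun i => ω (j * b + i))))
    (C := C) (D := C + ∑ i, |Real.log (entryNorm (A i))|) (by linarith)
    (fun b q => ?_) (fun n => ?_) hω (h.tendsto_mean hl)
  · simpa [div_eq_inv_mul] using this
  · have := hadd ω (q * b) b
    rw [matProd_eq_wordProd A (fun j => ω (q * b + j)) b] at this
    rwa [add_mul, one_mul]
  · have h1 := hadd ω n 1
    have h2 : |Real.log (entryNorm (matProd A (fun j => ω (n + j)) 1))| ≤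
        ∑ i, |Real.log (entryNorm (A i))| := by
      simp only [matProd, mul_one]
      exact Finset.single_le_sum (f := fun i => |Real.log (entryNorm (A i))|)
        (fun _ _ => abs_nonneg _) (Finset.mem_univ _)
    rw [abs_le] at *
    constructor <;> linarith

theorem IsTopLyapunovExponent.unique (h : PositiveFamily A w) {l l' : ℝ}
    (hl : IsTopLyapunovExponent A w l) (hl' : IsTopLyapunovExponent A w l') : l = l' := by
  have := isProbabilityMeasure_bernoulliMeasure h.weight_pos h.weight_sum
  obtain ⟨ω, h1, h2⟩ := (hl.and hl').exists
  exact tendsto_nhds_unique h1 h2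

/-- The Lyapunov exponent, with the rate of convergence of the truncated iteration. -/
theorem PositiveFamily.exists_exponent (h : PositiveFamily A w) :
    ∃ lam, IsTopLyapunovExponent A w lam ∧ ∀ N M,
      |lam - (logMean A w + coeffIterate A w (M + 1) N 0)| ≤
        growth (familyGap A) ^ 2 * rate (familyGap A) ^ N +
          growth (familyGap A) ^ (N + 3) * rate (familyGap A) ^ M := by
  obtain ⟨l, hl, hrate⟩ := exists_limit_transfer h.weight_pos h.weight_sum h.familyGap_pos
    h.familyGap_le_one h.contractive
  refine ⟨logMean A w + l, h.isTopLyapunovExponent hl, fun N M => ?_⟩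
  have h1 := hrate N
  have h2 := abs_transfer_zero_sub_le h.weight_pos h.weight_sum h.familyGap_pos
    h.familyGap_le_one h.contractive M N
  rw [add_sub_add_left_eq_sub]
  exact (abs_sub_le _ _ _).trans (add_le_add h1 h2)

end Growth

/-! ### Total correctness of programs -/

@[simp] theorem Memory.setIdx_cell (s : Memory) (d j : ℕ) : (s.setIdx d j).cell = s.cell := rfl

@[simp] theorem Memory.setIdx_idx (s : Memory) (d j r : ℕ) :
    (s.setIdx d j).idx r = if r = d then j else s.idx r := by
  simp [Memory.setIdx, Function.update_apply]

@[simp] theorem Ref.write_idx (x : Ref) (s : Memory) (c : ℝ) : (x.write s c).idx = s.idx := rfl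

@[simp] theorem Ref.write_cell (x : Ref) (s : Memory) (c : ℝ) (b j : ℕ) :
    (x.write s c).cell b j = if b = x.bank then
      if j = s.idx x.reg then c else s.cell b j else s.cell b j := by
  unfold Ref.write
  by_cases hb : b = x.bank
  · subst hb; simp [Function.update_apply]
  · simp [hb]

/-- Whether an instruction may change the index register `r`. -/
def Instr.writesIdx : Instr → ℕ → Bool
  | .idxConst d _, r => r == d
  | .idxAdd d _ _, r => r == d
  | .idxSub d _ _, r => r == d
  | _, _ => false

/-- Whether an instruction may change the bank `b`. -/
def Instr.writesBank : Instr → ℕ → Bool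
  | .const d _, b => b == d.bank
  | .copy d _, b => b == d.bank
  | .add d _ _, b => b == d.bank
  | .sub d _ _, b => b == d.bank
  | .mul d _ _, b => b == d.bank
  | .div d _ _, b => b == d.bank
  | _, _ => false

/-- Whether a program may change the index register `r`. -/
def Program.writesIdx : Program → ℕ → Bool
  | .instr i, r => i.writesIdx r
  | .seq p q, r => p.writesIdx r || q.writesIdx r
  | .ite _ p q, r => p.writesIdx r || q.writesIdx r
  | .while _ p, r => p.writesIdx r

/-- Whether a program may change the bank `b`. -/
def Program.writesBank : Program → ℕ → Bool
  | .instr i, b => i.writesBank b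
  | .seq p q, b => p.writesBank b || q.writesBank b
  | .ite _ p q, b => p.writesBank b || q.writesBank b
  | .while _ p, b => p.writesBank b

/-- The memories `s` and `s'` agree on everything that `p` cannot change. -/
structure Frame (p : Program) (s s' : Memory) : Prop where
  idx : ∀ r, p.writesIdx r = false → s'.idx r = s.idx r
  cell : ∀ b, p.writesBank b = false → s'.cell b = s.cell b

theorem Frame.refl (p : Program) (s : Memory) : Frame p s s := ⟨fun _ _ => rfl, fun _ _ => rfl⟩

theorem Frame.trans {p : Program} {s s' s'' : Memory} (h : Frame p s s') (h' : Frame p s' s'') :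
    Frame p s s'' :=
  ⟨fun r hr => (h'.idx r hr).trans (h.idx r hr), fun b hb => (h'.cell b hb).trans (h.cell b hb)⟩

theorem Frame.of_instr (i : Instr) (s : Memory) : Frame (.instr i) s (i.apply s) := by
  constructor
  · intro r hr
    cases i <;> simp_all [Program.writesIdx, Instr.writesIdx, Instr.apply]
  · intro b hb
    cases i <;> ext j <;> simp_all [Program.writesBank, Instr.writesBank, Instr.apply]

theorem Frame.mono {p q : Program} {s s' : Memory} (h : Frame p s s')
    (hi : ∀ r, q.writesIdx r = false → p.writesIdx r = false)
    (hb : ∀ b, q.writesBank b = false → p.writesBank b = false) : Frame q s s' :=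
  ⟨fun r hr => h.idx r (hi r hr), fun b hb' => h.cell b (hb b hb')⟩

/-- The write sets are syntactic and Boolean, so for a concrete program an untouched register or
bank is recognized by `rfl`. -/
theorem Runs.frame {p : Program} {s s' : Memory} {t : ℕ} (h : Runs p s t s') : Frame p s s' := by
  induction h with
  | instr i s _ => exact Frame.of_instr i s
  | seq _ _ h1 h2 =>
    exact (h1.mono (by simp_all [Program.writesIdx]) (by simp_all [Program.writesBank])).trans
      (h2.mono (by simp_all [Program.writesIdx]) (by simp_all [Program.writesBank]))
  | iteTrue _ _ h1 =>
    exact h1.mono (by simp_all [Program.writesIdx]) (by simp_all [Program.writesBank])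
  | iteFalse _ _ h1 =>
    exact h1.mono (by simp_all [Program.writesIdx]) (by simp_all [Program.writesBank])
  | whileTrue _ _ _ h1 h2 =>
    exact (h1.mono (by simp_all [Program.writesIdx]) (by simp_all [Program.writesBank])).trans h2
  | whileFalse _ => exact Frame.refl _ _

/-- The program `p`, started in `s`, halts within `B` steps in a memory that satisfies `Q`. -/
def Total (p : Program) (s : Memory) (B : ℕ) (Q : Memory → Prop) : Prop :=
  ∃ t s', Runs p s t s' ∧ t ≤ B ∧ Q s'

theorem Total.mono {p : Program} {s : Memory} {B B' : ℕ} {Q Q' : Memory → Prop}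
    (h : Total p s B Q) (hB : B ≤ B') (hQ : ∀ s', Frame p s s' → Q s' → Q' s') :
    Total p s B' Q' := by
  obtain ⟨t, s', hr, ht, hq⟩ := h
  exact ⟨t, s', hr, ht.trans hB, hQ s' hr.frame hq⟩

theorem Total.seq {p q : Program} {s : Memory} {B B' : ℕ} {R Q : Memory → Prop}
    (h : Total p s B R) (h' : ∀ s', Frame p s s' → R s' → Total q s' B' Q) :
    Total (.seq p q) s (B + B') Q := by
  obtain ⟨t, s', hr, ht, hq⟩ := h
  obtain ⟨t', s'', hr', ht', hq'⟩ := h' s' hr.frame hq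
  exact ⟨t + t', s'', .seq hr hr', by lia, hq'⟩

theorem Total.instr {i : Instr} {s : Memory} {Q : Memory → Prop} (hd : i.Defined s)
    (hQ : Q (i.apply s)) : Total (.instr i) s 1 Q :=
  ⟨1, _, .instr i s hd, le_rfl, hQ⟩

/-- A sequence of instructions. -/
def Program.block : Instr → List Instr → Program
  | i, [] => .instr i
  | i, j :: l => .seq (.instr i) (.block j l)

/-- The effect of a sequence of instructions. -/
noncomputable def applyAll : List Instr → Memory → Memory
  | [], s => s
  | i :: l, s => applyAll l (i.apply s)

/-- All instructions of a sequence can be executed in turn. -/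
def AllDefined : List Instr → Memory → Prop
  | [], _ => True
  | i :: l, s => i.Defined s ∧ AllDefined l (i.apply s)

theorem Total.block {i : Instr} {l : List Instr} {s : Memory} {Q : Memory → Prop}
    (hd : AllDefined (i :: l) s) (hQ : Q (applyAll (i :: l) s)) :
    Total (.block i l) s (l.length + 1) Q := by
  induction l generalizing i s with
  | nil => exact Total.instr hd.1 hQ
  | cons j l ih =>
    have := Total.seq (Total.instr (Q := fun s' => s' = i.apply s) hd.1 rfl)
      (q := .block j l) (B' := l.length + 1) (Q := Q) (by
        rintro s' - rfl
        exact ih hd.2 hQ)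
    exact this.mono (by simp; lia) fun _ _ h => h

/-- The invariant is indexed by the number of passes, which makes the count exact: each pass costs
its body and one test, and a last test fails. -/
theorem Total.while {b : Test} {p : Program} {s : Memory} {B : ℕ} (Inv : ℕ → Memory → Prop)
    (K j₀ : ℕ) (hK : j₀ ≤ K) (h₀ : Inv j₀ s)
    (hstep : ∀ j s', j₀ ≤ j → j < K → Frame p s s' → Inv j s' →
      b.Holds s' ∧ Total p s' B (Inv (j + 1)))
    (hend : ∀ s', Frame p s s' → Inv K s' → ¬ b.Holds s') :
    Total (.while b p) s ((K - j₀) * (B + 1) + 1) (Inv K) := by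
  obtain ⟨d, rfl⟩ := Nat.exists_eq_add_of_le hK
  clear hK
  induction d generalizing j₀ s with
  | zero => exact ⟨1, s, .whileFalse (hend s (Frame.refl _ _) h₀), by lia, h₀⟩
  | succ d ih =>
    obtain ⟨hb, t, s', hr, ht, hi⟩ := hstep j₀ s le_rfl (by lia) (Frame.refl _ _) h₀
    have e : j₀ + (d + 1) = j₀ + 1 + d := by lia
    rw [e] at hstep hend ⊢
    obtain ⟨t', s'', hr', ht', hi'⟩ := ih (s := s') (j₀ + 1) hi
      (fun j u hj hjK hf hu => hstep j u (by lia) hjK (hr.frame.trans hf) hu)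
      (fun u hf hu => hend u (hr.frame.trans hf) hu)
    refine ⟨t + 1 + t', s'', .whileTrue hb hr hr', ?_, hi'⟩
    have e1 : j₀ + 1 + d - (j₀ + 1) = d := by lia
    have e2 : j₀ + 1 + d - j₀ = d + 1 := by lia
    rw [e1] at ht'
    rw [e2, add_mul]
    lia

/-- The loop that runs `p` while the index register `r` is below the index register `n`; the
index register `1` has to contain the increment. -/
def Program.forLoop (r n : ℕ) (p : Program) : Program :=
  .while (.idxLt r n) (.seq p (.instr (.idxAdd r r 1)))

/-- The extra 2 per pass are the test and the increment; the invariant is therefore demanded after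
the counter has been advanced. -/
theorem Total.forLoop {r n : ℕ} {p : Program} {s : Memory} {B K : ℕ} (Inv : ℕ → Memory → Prop)
    (j₀ : ℕ) (hr : p.writesIdx r = false) (hn : p.writesIdx n = false)
    (h1 : p.writesIdx 1 = false) (hrn : n ≠ r) (hr1 : 1 ≠ r)
    (hs1 : s.idx 1 = 1) (hsr : s.idx r = j₀) (hsn : s.idx n = K) (hK : j₀ ≤ K)
    (h₀ : Inv j₀ s)
    (hstep : ∀ j s', j < K → Frame (.forLoop r n p) s s' → s'.idx r = j →
      Inv j s' → Total p s' B fun s'' => Inv (j + 1) (s''.setIdx r (j + 1))) :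
    Total (.forLoop r n p) s ((K - j₀) * (B + 2) + 1) (Inv K) := by
  have hwn : (Program.seq p (.instr (.idxAdd r r 1))).writesIdx n = false := by
    simp [Program.writesIdx, Instr.writesIdx, hn, hrn]
  have hw1 : (Program.seq p (.instr (.idxAdd r r 1))).writesIdx 1 = false := by
    simp [Program.writesIdx, Instr.writesIdx, h1, hr1]
  refine (Total.while (b := .idxLt r n) (B := B + 1) (fun j s' => Inv j s' ∧ s'.idx r = j) K j₀ hK
    ⟨h₀, hsr⟩ ?_ ?_).mono le_rfl fun s' _ h => h.1
  · rintro j s' - hj hf ⟨hi, hidx⟩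
    have hn' : s'.idx n = K := (hf.idx n hwn).trans hsn
    refine ⟨by simp only [Test.Holds]; rw [hidx, hn']; exact hj, ?_⟩
    refine (hstep j s' hj (hf.mono (fun _ h => h) fun _ h => h) hidx hi).seq fun s'' hf' hi' => ?_
    refine Total.instr trivial ?_
    have e : s''.idx r + s''.idx 1 = j + 1 := by
      rw [hf'.idx r hr, hf'.idx 1 h1, hidx, hf.idx 1 hw1, hs1]
    simp only [Instr.apply]
    rw [e]
    exact ⟨hi', by simp⟩
  · rintro s' hf ⟨-, hidx⟩
    simp only [Test.Holds]
    rw [hidx, (hf.idx n hwn).trans hsn]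
    exact lt_irrefl K

/-! ### The program -/

/-- The first cell of a bank, provided that index register `2` contains `0`. -/
def scalar (b : ℕ) : Ref := ⟨b, 2⟩

/-- One step of the multiplication of a truncated power series by the Möbius series, with
accumulation of a multiple of the series. -/
def columnStep : Program :=
  .block (.mul (scalar 28) (scalar 35) ⟨42, 8⟩)
    [.add ⟨41, 8⟩ ⟨41, 8⟩ (scalar 28),
     .mul (scalar 38) ⟨13, 6⟩ ⟨42, 8⟩,
     .mul (scalar 28) ⟨11, 6⟩ (scalar 36),
     .add (scalar 38) (scalar 38) (scalar 28),
     .mul (scalar 28) ⟨12, 6⟩ (scalar 37),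
     .sub (scalar 38) (scalar 38) (scalar 28),
     .copy (scalar 36) ⟨42, 8⟩,
     .copy ⟨42, 8⟩ (scalar 38),
     .copy (scalar 37) (scalar 38)]

/-- The preceding term of a sequence, `0` at the start. -/
def prevTerm (f : ℕ → ℝ) (k : ℕ) : ℝ := if k = 0 then 0 else f (k - 1)

theorem powCoeff_succ_eq (a b c : ℝ) (n k : ℕ) :
    powCoeff a b c (n + 1) k = c * powCoeff a b c n k + a * prevTerm (powCoeff a b c n) k -
      b * prevTerm (powCoeff a b c (n + 1)) k := by
  cases k with
  | zero => simp [prevTerm, powCoeff_succ_zero]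
  | succ k => simp [prevTerm, powCoeff_succ_succ]

/-- The power in bank 42 is updated in place. Cells 36 and 37 carry the old and the new coefficient
at k - 1, as the recurrence requires, while x times the old power is added to bank 41. Ten
instructions, a test and an increment make 12 steps per coefficient. -/
theorem total_columnLoop {s : Memory} {M i n : ℕ} {x a b c : ℝ} {N₀ : ℕ → ℝ}
    (h1 : s.idx 1 = 1) (h2 : s.idx 2 = 0) (h4 : s.idx 4 = M) (h6 : s.idx 6 = i)
    (h8 : s.idx 8 = 0) (ha : s.cell 11 i = a) (hb : s.cell 12 i = b) (hc : s.cell 13 i = c)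
    (hx : s.cell 35 0 = x) (h36 : s.cell 36 0 = 0) (h37 : s.cell 37 0 = 0)
    (hP : ∀ j < M, s.cell 42 j = powCoeff a b c n j) (hN : ∀ j < M, s.cell 41 j = N₀ j) :
    Total (.forLoop 8 4 columnStep) s (12 * M + 1) fun s' =>
      (∀ j < M, s'.cell 42 j = powCoeff a b c (n + 1) j) ∧
      (∀ j < M, s'.cell 41 j = N₀ j + x * powCoeff a b c n j) := by
  refine (Total.forLoop (K := M) (B := 10) (fun k s' =>
    (∀ j < M, s'.cell 42 j = if j < k then powCoeff a b c (n + 1) j else powCoeff a b c n j) ∧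
    (∀ j < M, s'.cell 41 j = N₀ j + if j < k then x * powCoeff a b c n j else 0) ∧
    s'.cell 36 0 = prevTerm (powCoeff a b c n) k ∧
    s'.cell 37 0 = prevTerm (powCoeff a b c (n + 1)) k) 0 rfl rfl rfl (by decide) (by decide)
    h1 h8 h4 (Nat.zero_le _) ?_ ?_).mono (by lia) ?_
  · simp only [Nat.not_lt_zero, if_false, add_zero]
    exact ⟨hP, hN, by simpa [prevTerm] using h36, by simpa [prevTerm] using h37⟩
  · rintro k s' hk hf h8' ⟨iP, iN, i36, i37⟩
    have g2 : s'.idx 2 = 0 := (hf.idx 2 rfl).trans h2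
    have g6 : s'.idx 6 = i := (hf.idx 6 rfl).trans h6
    have ga : s'.cell 11 i = a := by rw [hf.cell 11 rfl, ha]
    have gb : s'.cell 12 i = b := by rw [hf.cell 12 rfl, hb]
    have gc : s'.cell 13 i = c := by rw [hf.cell 13 rfl, hc]
    have gx : s'.cell 35 0 = x := by rw [hf.cell 35 rfl, hx]
    have gP : s'.cell 42 k = powCoeff a b c n k := by simpa using iP k hk
    have gN : s'.cell 41 k = N₀ k := by simpa using iN k hk
    refine (Total.block ?_ ?_).mono (B' := 10) (by simp) (fun _ _ h => h)
    · simp [AllDefined, Instr.Defined]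
    · simp only [applyAll, Instr.apply, scalar, Ref.read, Ref.write_idx, Ref.write_cell,
        Memory.setIdx_cell, g2, g6, h8', ga, gb, gc, gx, gP, gN, i36, i37, if_true,
        Nat.reduceEqDiff, if_false, Nat.succ_ne_self]
      refine ⟨fun j hj => ?_, fun j hj => ?_, ?_, ?_⟩
      · rcases lt_trichotomy j k with h | h | h
        · simp [h.ne, iP j hj, h, h.trans (Nat.lt_succ_self k)]
        · simp [h, powCoeff_succ_eq a b c n k]
        · simp [h.ne', iP j hj, not_lt.2 h.le, not_le.2 h]
      · rcases lt_trichotomy j k with h | h | h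
        · simp [h.ne, iN j hj, h, h.trans (Nat.lt_succ_self k)]
        · simp [h]
        · simp [h.ne', iN j hj, not_lt.2 h.le, not_le.2 h]
      · simp [prevTerm]
      · simp [prevTerm, powCoeff_succ_eq a b c n k]
  · rintro s' - ⟨iP, iN, -, -⟩
    refine ⟨fun j hj => ?_, fun j hj => ?_⟩
    · simpa [hj] using iP j hj
    · simpa [hj] using iN j hj

/-- Accumulation of the contribution of one power of the Möbius series. -/
def powerStep : Program :=
  .seq (.block (.mul (scalar 35) ⟨1, 6⟩ ⟨40, 7⟩)
      [.const (scalar 36) 0, .const (scalar 37) 0, .idxConst 8 0])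
    (.forLoop 8 4 columnStep)

/-- Bank 42 runs through the powers n = 0, 1, ..., so only one column of Taylor coefficients is
stored at a time and the matrix is never formed. -/
theorem total_powerLoop {s : Memory} {M i : ℕ} {w a b c : ℝ} {g N₀ : ℕ → ℝ}
    (h1 : s.idx 1 = 1) (h2 : s.idx 2 = 0) (h4 : s.idx 4 = M) (h6 : s.idx 6 = i)
    (h7 : s.idx 7 = 0) (hw : s.cell 1 i = w)
    (ha : s.cell 11 i = a) (hb : s.cell 12 i = b) (hc : s.cell 13 i = c)
    (hg : ∀ j < M, s.cell 40 j = g j)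
    (hP : ∀ j < M, s.cell 42 j = powCoeff a b c 0 j) (hN : ∀ j < M, s.cell 41 j = N₀ j) :
    Total (.forLoop 7 4 powerStep) s (M * (12 * M + 7) + 1) fun s' =>
      ∀ j < M, s'.cell 41 j = N₀ j + w * ∑ n ∈ Finset.range M, g n * powCoeff a b c n j := by
  refine (Total.forLoop (K := M) (B := 4 + (12 * M + 1)) (fun n s' =>
    (∀ j < M, s'.cell 42 j = powCoeff a b c n j) ∧
    (∀ j < M, s'.cell 41 j = N₀ j + w * ∑ n ∈ Finset.range n, g n * powCoeff a b c n j))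
    0 rfl rfl rfl (by decide) (by decide) h1 h7 h4 (Nat.zero_le _) ?_ ?_).mono ?_ ?_
  · exact ⟨hP, by simpa using hN⟩
  · rintro n s' hn hf h7' ⟨iP, iN⟩
    have g1 : s'.idx 1 = 1 := (hf.idx 1 rfl).trans h1
    have g2 : s'.idx 2 = 0 := (hf.idx 2 rfl).trans h2
    have g4 : s'.idx 4 = M := (hf.idx 4 rfl).trans h4
    have g6 : s'.idx 6 = i := (hf.idx 6 rfl).trans h6
    have gw : s'.cell 1 i = w := by rw [hf.cell 1 rfl, hw]
    have ga : s'.cell 11 i = a := by rw [hf.cell 11 rfl, ha]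
    have gb : s'.cell 12 i = b := by rw [hf.cell 12 rfl, hb]
    have gc : s'.cell 13 i = c := by rw [hf.cell 13 rfl, hc]
    have gg : s'.cell 40 n = g n := by rw [hf.cell 40 rfl, hg n hn]
    refine Total.seq (R := fun u => u.cell 35 0 = w * g n ∧ u.cell 36 0 = 0 ∧ u.cell 37 0 = 0 ∧
      u.idx 8 = 0 ∧ u.cell 42 = s'.cell 42 ∧ u.cell 41 = s'.cell 41) (Total.block ?_ ?_) ?_
    · simp [AllDefined, Instr.Defined]
    · refine ⟨?_, ?_, ?_, ?_, funext fun j => ?_, funext fun j => ?_⟩ <;>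
        simp [applyAll, Instr.apply, scalar, Ref.read, g2, g6, h7', gw, gg]
    · rintro u hu ⟨u35, u36, u37, u8, u42, u41⟩
      refine (total_columnLoop (M := M) (i := i) (n := n) (x := w * g n) (a := a) (b := b) (c := c)
        (N₀ := fun j => N₀ j + w * ∑ n ∈ Finset.range n, g n * powCoeff a b c n j)
        ((hu.idx 1 rfl).trans g1) ((hu.idx 2 rfl).trans g2) ((hu.idx 4 rfl).trans g4)
        ((hu.idx 6 rfl).trans g6) u8 (by rw [hu.cell 11 rfl, ga]) (by rw [hu.cell 12 rfl, gb])
        (by rw [hu.cell 13 rfl, gc]) u35 u36 u37 (by rw [u42]; exact iP)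
        (by rw [u41]; exact iN)).mono le_rfl ?_
      rintro v - ⟨vP, vN⟩
      refine ⟨vP, fun j hj => ?_⟩
      rw [Memory.setIdx_cell, vN j hj, Finset.sum_range_succ]
      ring
  · exact Nat.le_of_eq (by rw [Nat.sub_zero]; ring)
  · rintro v - ⟨-, vN⟩
    exact vN

/-- Accumulation of the contribution of one matrix. -/
def matrixStep : Program :=
  .seq (.instr (.idxConst 8 0))
    (.seq (.forLoop 8 4 (.instr (.const ⟨42, 8⟩ 0)))
      (.seq (.block (.const (scalar 42) 1) [.idxConst 7 0]) (.forLoop 7 4 powerStep)))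

theorem total_clearLoop {s : Memory} {M : ℕ} (h1 : s.idx 1 = 1) (h4 : s.idx 4 = M)
    (h8 : s.idx 8 = 0) :
    Total (.forLoop 8 4 (.instr (.const ⟨42, 8⟩ 0))) s (3 * M + 1) fun s' =>
      ∀ j < M, s'.cell 42 j = 0 := by
  refine (Total.forLoop (K := M) (B := 1) (fun k s' => ∀ j < k, s'.cell 42 j = 0)
    0 rfl rfl rfl (by decide) (by decide) h1 h8 h4 (Nat.zero_le _) ?_ ?_).mono (by lia) ?_
  · intro j hj
    exact absurd hj (Nat.not_lt_zero j)
  · intro k s' hk hf h8' hi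
    refine Total.instr trivial fun j hj => ?_
    simp only [Instr.apply, Memory.setIdx_cell, Ref.write_cell, h8', if_true]
    split_ifs with h
    · simp
    · exact hi j (by lia)
  · exact fun _ _ h => h

theorem total_matrixLoop {s : Memory} {M m : ℕ} {w a b c g : ℕ → ℝ}
    (h0 : s.idx 0 = m) (h1 : s.idx 1 = 1) (h2 : s.idx 2 = 0) (h4 : s.idx 4 = M)
    (h6 : s.idx 6 = 0) (hw : ∀ i < m, s.cell 1 i = w i) (ha : ∀ i < m, s.cell 11 i = a i)
    (hb : ∀ i < m, s.cell 12 i = b i) (hc : ∀ i < m, s.cell 13 i = c i)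
    (hg : ∀ j < M, s.cell 40 j = g j) (hN : ∀ j < M, s.cell 41 j = 0) :
    Total (.forLoop 6 0 matrixStep) s (m * (M * (12 * M + 10) + 7) + 1) fun s' =>
      ∀ j < M, s'.cell 41 j = ∑ i ∈ Finset.range m, w i * ∑ n ∈ Finset.range M,
        g n * powCoeff (a i) (b i) (c i) n j := by
  refine (Total.forLoop (K := m) (B := 1 + (3 * M + 1 + (2 + (M * (12 * M + 7) + 1))))
    (fun i s' => ∀ j < M, s'.cell 41 j = ∑ i ∈ Finset.range i, w i * ∑ n ∈ Finset.range M,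
        g n * powCoeff (a i) (b i) (c i) n j)
    0 rfl rfl rfl (by decide) (by decide) h1 h6 h0 (Nat.zero_le _) ?_ ?_).mono ?_ ?_
  · simpa using hN
  · intro i s' hi hf h6' hinv
    have g1 : s'.idx 1 = 1 := (hf.idx 1 rfl).trans h1
    have g2 : s'.idx 2 = 0 := (hf.idx 2 rfl).trans h2
    have g4 : s'.idx 4 = M := (hf.idx 4 rfl).trans h4
    refine Total.seq (R := fun u => u.idx 8 = 0) (Total.instr trivial (by simp [Instr.apply])) ?_
    intro u hu u8
    refine Total.seq (total_clearLoop ((hu.idx 1 rfl).trans g1) ((hu.idx 4 rfl).trans g4) u8) ?_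
    intro v hv v42
    -- For each matrix, bank 42 restarts with the zeroth power, the constant series 1.
    refine Total.seq (R := fun x => (∀ j < M, x.cell 42 j =
      powCoeff (a i) (b i) (c i) 0 j) ∧ x.idx 7 = 0) (Total.block ?_ ?_) ?_
    · simp [AllDefined, Instr.Defined]
    · have v2 : v.idx 2 = 0 := (hv.idx 2 rfl).trans ((hu.idx 2 rfl).trans g2)
      refine ⟨fun j hj => ?_, by simp [applyAll, Instr.apply]⟩
      simp only [applyAll, Instr.apply, scalar, Memory.setIdx_cell, Ref.write_cell, v2, if_true,
        v42 j hj, powCoeff_zero, Rat.cast_one]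
    · rintro x hx ⟨x42, x7⟩
      have fr : ∀ r, r ≠ 8 → r ≠ 7 → x.idx r = s'.idx r := by
        intro r hr8 hr7
        rw [hx.idx r (by simp [Program.block, Program.writesIdx, Instr.writesIdx, hr7]),
          hv.idx r (by simp [Program.forLoop, Program.writesIdx, Instr.writesIdx, hr8]),
          hu.idx r (by simp [Program.writesIdx, Instr.writesIdx, hr8])]
      have fc : ∀ b, b ≠ 42 → x.cell b = s'.cell b := by
        intro b hb
        rw [hx.cell b (by simp [Program.block, Program.writesBank, Instr.writesBank, scalar, hb]),
          hv.cell b (by simp [Program.forLoop, Program.writesBank, Instr.writesBank, hb]),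
          hu.cell b (by simp [Program.writesBank, Instr.writesBank])]
      refine (total_powerLoop (M := M) (i := i) (w := w i) (a := a i) (b := b i) (c := c i) (g := g)
        (N₀ := fun j => ∑ i ∈ Finset.range i, w i * ∑ n ∈ Finset.range M,
        g n * powCoeff (a i) (b i) (c i) n j)
        (by rw [fr 1 (by decide) (by decide), g1]) (by rw [fr 2 (by decide) (by decide), g2])
        (by rw [fr 4 (by decide) (by decide), g4]) (by rw [fr 6 (by decide) (by decide), h6']) x7
        (by rw [fc 1 (by decide), hf.cell 1 rfl, hw i hi])
        (by rw [fc 11 (by decide), hf.cell 11 rfl, ha i hi])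
        (by rw [fc 12 (by decide), hf.cell 12 rfl, hb i hi])
        (by rw [fc 13 (by decide), hf.cell 13 rfl, hc i hi])
        (by rw [fc 40 (by decide), hf.cell 40 rfl]; exact hg) x42
        (by rw [fc 41 (by decide)]; exact hinv)).mono le_rfl ?_
      intro y _ hy j hj
      rw [Memory.setIdx_cell, hy j hj, Finset.sum_range_succ]
  · exact Nat.le_of_eq (by rw [Nat.sub_zero]; ring)
  · exact fun _ _ h => h

/-- One application of the truncated transfer operator. -/
def iterStep : Program :=
  .seq (.instr (.idxConst 6 0))
    (.seq (.forLoop 6 0 matrixStep)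
      (.seq (.instr (.idxConst 8 0))
        (.forLoop 8 4 (.block (.copy ⟨40, 8⟩ ⟨41, 8⟩) [.const ⟨41, 8⟩ 0]))))

theorem total_moveLoop {s : Memory} {M : ℕ} {g : ℕ → ℝ} (h1 : s.idx 1 = 1) (h4 : s.idx 4 = M)
    (h8 : s.idx 8 = 0) (hg : ∀ j < M, s.cell 41 j = g j) :
    Total (.forLoop 8 4 (.block (.copy ⟨40, 8⟩ ⟨41, 8⟩) [.const ⟨41, 8⟩ 0])) s (4 * M + 1) fun s' =>
      (∀ j < M, s'.cell 40 j = g j) ∧ ∀ j < M, s'.cell 41 j = 0 := by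
  refine (Total.forLoop (K := M) (B := 2) (fun k s' => (∀ j < k, s'.cell 40 j = g j) ∧
    (∀ j < k, s'.cell 41 j = 0) ∧ ∀ j < M, k ≤ j → s'.cell 41 j = g j)
    0 rfl rfl rfl (by decide) (by decide) h1 h8 h4 (Nat.zero_le _) ?_ ?_).mono (by lia) ?_
  · exact ⟨fun j hj => absurd hj (Nat.not_lt_zero j), fun j hj => absurd hj (Nat.not_lt_zero j),
      fun j hj _ => hg j hj⟩
  · rintro k s' hk hf h8' ⟨i1, i2, i3⟩
    refine Total.block (by simp [AllDefined, Instr.Defined]) ?_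
    simp only [applyAll, Instr.apply, Memory.setIdx_cell, Ref.write_cell, Ref.write_idx, h8',
      if_true, Ref.read, Nat.reduceEqDiff, if_false]
    refine ⟨fun j hj => ?_, fun j hj => ?_, fun j hj hkj => ?_⟩
    · split_ifs with h
      · rw [h]; exact i3 k hk le_rfl
      · exact i1 j (by lia)
    · split_ifs with h
      · simp
      · exact i2 j (by lia)
    · rw [if_neg (by lia)]
      exact i3 j hj (by lia)
  · exact fun _ _ h => ⟨h.1, h.2.1⟩

/-- The operator on sequences that is computed by `iterStep`. -/
noncomputable def seqTransfer (w a b c : ℕ → ℝ) (m M : ℕ) (g : ℕ → ℝ) (j : ℕ) : ℝ :=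
  ∑ i ∈ Finset.range m, w i * ∑ n ∈ Finset.range M, g n * powCoeff (a i) (b i) (c i) n j

theorem total_iterLoop {s : Memory} {M m N : ℕ} {w a b c g : ℕ → ℝ}
    (h0 : s.idx 0 = m) (h1 : s.idx 1 = 1) (h2 : s.idx 2 = 0) (h3 : s.idx 3 = N) (h4 : s.idx 4 = M)
    (h5 : s.idx 5 = 0) (hw : ∀ i < m, s.cell 1 i = w i) (ha : ∀ i < m, s.cell 11 i = a i)
    (hb : ∀ i < m, s.cell 12 i = b i) (hc : ∀ i < m, s.cell 13 i = c i)
    (hg : ∀ j < M, s.cell 40 j = g j) (hN : ∀ j < M, s.cell 41 j = 0) :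
    Total (.forLoop 5 3 iterStep) s (N * (m * (M * (12 * M + 10) + 7) + 4 * M + 6) + 1)
      fun s' => ∀ j < M, s'.cell 40 j = (seqTransfer w a b c m M)^[N] g j := by
  refine (Total.forLoop (K := N) (B := 1 + (m * (M * (12 * M + 10) + 7) + 1 + (1 + (4 * M + 1))))
    (fun t s' => (∀ j < M, s'.cell 40 j = (seqTransfer w a b c m M)^[t] g j) ∧
      ∀ j < M, s'.cell 41 j = 0)
    0 rfl rfl rfl (by decide) (by decide) h1 h5 h3 (Nat.zero_le _) ?_ ?_).mono ?_ ?_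
  · exact ⟨hg, hN⟩
  · rintro t s' ht hf h5' ⟨i40, i41⟩
    have g0 : s'.idx 0 = m := (hf.idx 0 rfl).trans h0
    have g1 : s'.idx 1 = 1 := (hf.idx 1 rfl).trans h1
    have g2 : s'.idx 2 = 0 := (hf.idx 2 rfl).trans h2
    have g4 : s'.idx 4 = M := (hf.idx 4 rfl).trans h4
    refine Total.seq (R := fun u => u.idx 6 = 0) (Total.instr trivial (by simp [Instr.apply])) ?_
    intro u hu u6
    refine Total.seq (total_matrixLoop (g := (seqTransfer w a b c m M)^[t] g)
      ((hu.idx 0 rfl).trans g0) ((hu.idx 1 rfl).trans g1) ((hu.idx 2 rfl).trans g2)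
      ((hu.idx 4 rfl).trans g4) u6 (by rw [hu.cell 1 rfl, hf.cell 1 rfl]; exact hw)
      (by rw [hu.cell 11 rfl, hf.cell 11 rfl]; exact ha)
      (by rw [hu.cell 12 rfl, hf.cell 12 rfl]; exact hb)
      (by rw [hu.cell 13 rfl, hf.cell 13 rfl]; exact hc)
      (by rw [hu.cell 40 rfl]; exact i40) (by rw [hu.cell 41 rfl]; exact i41)) ?_
    intro v hv v41
    refine Total.seq (R := fun x => x.idx 8 = 0) (Total.instr trivial (by simp [Instr.apply])) ?_
    intro x hx x8
    refine (total_moveLoop (M := M) (g := seqTransfer w a b c m M ((seqTransfer w a b c m M)^[t] g))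
      ?_ ?_ x8 (by rw [hx.cell 41 rfl]; exact v41)).mono le_rfl ?_
    · rw [hx.idx 1 rfl, hv.idx 1 rfl, hu.idx 1 rfl, g1]
    · rw [hx.idx 4 rfl, hv.idx 4 rfl, hu.idx 4 rfl, g4]
    · rintro y - ⟨y1, y2⟩
      rw [Function.iterate_succ_apply']
      exact ⟨y1, y2⟩
  · exact Nat.le_of_eq (by rw [Nat.sub_zero]; ring)
  · exact fun _ _ h => h.1

/-- Computation of the half sum, the Möbius coefficients and the gap of one matrix. -/
def coefStep : Program :=
  .block (.add (scalar 28) ⟨2, 6⟩ ⟨3, 6⟩)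
    [.add (scalar 28) (scalar 28) ⟨4, 6⟩,
     .add (scalar 28) (scalar 28) ⟨5, 6⟩,
     .mul ⟨10, 6⟩ (scalar 21) (scalar 28),
     .sub (scalar 28) ⟨2, 6⟩ ⟨3, 6⟩,
     .sub (scalar 28) (scalar 28) ⟨4, 6⟩,
     .add (scalar 28) (scalar 28) ⟨5, 6⟩,
     .mul (scalar 28) (scalar 21) (scalar 28),
     .div ⟨11, 6⟩ (scalar 28) ⟨10, 6⟩,
     .add (scalar 28) ⟨2, 6⟩ ⟨3, 6⟩,
     .sub (scalar 28) (scalar 28) ⟨4, 6⟩,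
     .sub (scalar 28) (scalar 28) ⟨5, 6⟩,
     .mul (scalar 28) (scalar 21) (scalar 28),
     .div ⟨12, 6⟩ (scalar 28) ⟨10, 6⟩,
     .sub (scalar 28) ⟨2, 6⟩ ⟨3, 6⟩,
     .add (scalar 28) (scalar 28) ⟨4, 6⟩,
     .sub (scalar 28) (scalar 28) ⟨5, 6⟩,
     .mul (scalar 28) (scalar 21) (scalar 28),
     .div ⟨13, 6⟩ (scalar 28) ⟨10, 6⟩,
     .mul (scalar 28) ⟨2, 6⟩ ⟨3, 6⟩,
     .mul (scalar 28) (scalar 28) ⟨4, 6⟩,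
     .mul (scalar 28) (scalar 28) ⟨5, 6⟩,
     .mul (scalar 28) (scalar 28) ⟨10, 6⟩,
     .add (scalar 29) ⟨10, 6⟩ ⟨10, 6⟩,
     .mul (scalar 38) (scalar 29) (scalar 29),
     .mul (scalar 38) (scalar 38) (scalar 29),
     .mul (scalar 38) (scalar 38) (scalar 29),
     .add (scalar 29) (scalar 20) ⟨10, 6⟩,
     .mul (scalar 29) (scalar 29) (scalar 29),
     .mul (scalar 38) (scalar 38) (scalar 29),
     .div (scalar 28) (scalar 28) (scalar 38),
     .mul (scalar 22) (scalar 22) (scalar 28)]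

theorem total_coefLoop {s : Memory} {m : ℕ} {A : ℕ → Matrix (Fin 2) (Fin 2) ℝ}
    (hA : ∀ i < m, ∀ a b, 0 < A i a b)
    (h0 : s.idx 0 = m) (h1 : s.idx 1 = 1) (h2 : s.idx 2 = 0) (h6 : s.idx 6 = 0)
    (h00 : ∀ i < m, s.cell 2 i = A i 0 0) (h01 : ∀ i < m, s.cell 3 i = A i 0 1)
    (h10 : ∀ i < m, s.cell 4 i = A i 1 0) (h11 : ∀ i < m, s.cell 5 i = A i 1 1)
    (h20 : s.cell 20 0 = 1) (h21 : s.cell 21 0 = 1 / 2) (h22 : s.cell 22 0 = 1) :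
    Total (.forLoop 6 0 coefStep) s (m * 34 + 1) fun s' =>
      (∀ i < m, s'.cell 10 i = halfSum (A i)) ∧ (∀ i < m, s'.cell 11 i = coefA (A i)) ∧
      (∀ i < m, s'.cell 12 i = coefB (A i)) ∧ (∀ i < m, s'.cell 13 i = coefC (A i)) ∧
      s'.cell 22 0 = ∏ i ∈ Finset.range m, matGap (A i) := by
  refine (Total.forLoop (K := m) (B := 32) (fun k s' =>
    (∀ i < k, s'.cell 10 i = halfSum (A i)) ∧ (∀ i < k, s'.cell 11 i = coefA (A i)) ∧
      (∀ i < k, s'.cell 12 i = coefB (A i)) ∧ (∀ i < k, s'.cell 13 i = coefC (A i)) ∧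
      s'.cell 22 0 = ∏ i ∈ Finset.range k, matGap (A i))
    0 rfl rfl rfl (by decide) (by decide) h1 h6 h0 (Nat.zero_le _) ?_ ?_).mono (by simp)
    (fun _ _ h => h)
  · simpa using h22
  · rintro k s' hk hf h6' ⟨i10, i11, i12, i13, i22⟩
    have g2 : s'.idx 2 = 0 := (hf.idx 2 rfl).trans h2
    have g00 : s'.cell 2 k = A k 0 0 := by rw [hf.cell 2 rfl, h00 k hk]
    have g01 : s'.cell 3 k = A k 0 1 := by rw [hf.cell 3 rfl, h01 k hk]
    have g10 : s'.cell 4 k = A k 1 0 := by rw [hf.cell 4 rfl, h10 k hk]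
    have g11 : s'.cell 5 k = A k 1 1 := by rw [hf.cell 5 rfl, h11 k hk]
    have g20 : s'.cell 20 0 = 1 := by rw [hf.cell 20 rfl, h20]
    have g21 : s'.cell 21 0 = 1 / 2 := by rw [hf.cell 21 rfl, h21]
    have hh := halfSum_pos (hA k hk)
    have e : 1 / 2 * (A k 0 0 + A k 0 1 + A k 1 0 + A k 1 1) = halfSum (A k) := rfl
    refine Total.block ?_ ?_
    · simp only [AllDefined, Instr.Defined, Instr.apply, scalar, Ref.read, Ref.write_idx,
        Ref.write_cell, g2, h6', g00, g01, g10, g11, g20, g21, if_true, Nat.reduceEqDiff,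
        if_false, e, true_and, and_true]
      exact ⟨hh.ne', hh.ne', hh.ne', by positivity⟩
    · simp only [applyAll, Instr.apply, scalar, Ref.read, Ref.write_idx,
        Ref.write_cell, Memory.setIdx_cell, g2, h6', g00, g01, g10, g11, g20, g21, i22, if_true,
        Nat.reduceEqDiff, if_false, e]
      refine ⟨fun i hi => ?_, fun i hi => ?_, fun i hi => ?_, fun i hi => ?_, ?_⟩
      · split_ifs with h
        · rw [h]
        · exact i10 i (by lia)
      · split_ifs with h
        · rw [h, coefA]
        · exact i11 i (by lia)
      · split_ifs with h
        · rw [h, coefB]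
        · exact i12 i (by lia)
      · split_ifs with h
        · rw [h, coefC]
        · exact i13 i (by lia)
      · rw [Finset.prod_range_succ, matGap]
        congr 2
        ring

/-- The least exponent at which a geometric sequence is at most `E`. -/
noncomputable def firstBelow (p r E : ℝ) : ℕ := sInf {n | p * r ^ n ≤ E}

theorem firstBelow_spec {p r E : ℝ} (hp : 0 < p) (hr1 : r < 1) (hE : 0 < E) :
    p * r ^ firstBelow p r E ≤ E := by
  have hne : {n | p * r ^ n ≤ E}.Nonempty := by
    obtain ⟨n, hn⟩ := exists_pow_lt_of_lt_one (div_pos hE hp) hr1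
    refine ⟨n, ?_⟩
    rw [lt_div_iff₀ hp, mul_comm] at hn
    exact hn.le
  exact Nat.sInf_mem hne

theorem lt_of_lt_firstBelow {p r E : ℝ} {n : ℕ} (hn : n < firstBelow p r E) : E < p * r ^ n :=
  not_le.1 (Nat.notMem_of_lt_sInf hn)

/-- Computation of the contraction rate and of the growth bound. -/
def boundSetup : Program :=
  .block (.mul (scalar 28) (scalar 22) (scalar 22))
    [.add (scalar 29) (scalar 20) (scalar 20),
     .div (scalar 28) (scalar 29) (scalar 28),
     .add (scalar 23) (scalar 20) (scalar 28),
     .div (scalar 28) (scalar 20) (scalar 23),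
     .sub (scalar 24) (scalar 20) (scalar 28),
     .const (scalar 28) (1 / 8),
     .mul (scalar 27) (scalar 0) (scalar 28),
     .mul (scalar 25) (scalar 23) (scalar 23),
     .mul (scalar 26) (scalar 25) (scalar 23),
     .idxConst 4 1,
     .idxConst 6 0]

/-- Cells 25 and 26 receive the initial values of the two searches. The threshold e/8 leaves room
for four errors: iteration, truncation and two logarithmic series. Register 4 starts at 1 because a
vector has one more entry than its degree bound. -/
theorem total_boundSetup {s : Memory} {S e : ℝ} (hS : 0 < S) (h2 : s.idx 2 = 0)
    (h20 : s.cell 20 0 = 1) (h22 : s.cell 22 0 = S) (he : s.cell 0 0 = e) :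
    Total boundSetup s 12 fun s' => s'.cell 23 0 = growth S ∧ s'.cell 24 0 = rate S ∧
      s'.cell 27 0 = e / 8 ∧ s'.cell 25 0 = growth S ^ 2 ∧ s'.cell 26 0 = growth S ^ 3 ∧
      s'.idx 4 = 1 ∧ s'.idx 6 = 0 := by
  have hg : 1 + (1 + 1) / (S * S) = growth S := by unfold growth; ring
  have hg0 : 0 < growth S := by unfold growth; positivity
  refine Total.block ?_ ?_
  · simp only [AllDefined, Instr.Defined, Instr.apply, scalar, Ref.read, Ref.write_idx,
      Ref.write_cell, h2, h20, h22, if_true, Nat.reduceEqDiff, if_false, hg, true_and, and_true]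
    exact ⟨by positivity, hg0.ne'⟩
  · simp only [applyAll, Instr.apply, scalar, Ref.read, Ref.write_idx,
      Ref.write_cell, Memory.setIdx_cell, Memory.setIdx_idx, h2, h20, h22, he, if_true,
      Nat.reduceEqDiff, if_false, hg, OfNat.zero_ne_ofNat]
    refine ⟨trivial, (rate_eq hS).symm, ?_, by ring, by ring, ?_, trivial⟩
    · push_cast; ring
    · simp

/-- The search for the number of iterations. -/
def countLoop : Program :=
  .while (.realLt (scalar 27) (scalar 25))
    (.block (.mul (scalar 25) (scalar 25) (scalar 24))
      [.mul (scalar 26) (scalar 26) (scalar 23), .idxAdd 3 3 1])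

/-- The exponent is found by repeated multiplication, without logarithms. Cell 26 gains a factor C
per pass, so it ends with the prefactor of the truncation error, where the next search begins. -/
theorem total_countLoop {s : Memory} {p q r C E : ℝ} (hp : 0 < p) (hr1 : r < 1)
    (hE : 0 < E) (h1 : s.idx 1 = 1) (h2 : s.idx 2 = 0) (h3 : s.idx 3 = 0)
    (h23 : s.cell 23 0 = C) (h24 : s.cell 24 0 = r) (h25 : s.cell 25 0 = p)
    (h26 : s.cell 26 0 = q) (h27 : s.cell 27 0 = E) :
    Total countLoop s (firstBelow p r E * 4 + 1) fun s' =>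
      s'.idx 3 = firstBelow p r E ∧ s'.cell 26 0 = q * C ^ firstBelow p r E := by
  refine (Total.while (B := 3) (fun j s' => s'.idx 3 = j ∧ s'.cell 25 0 = p * r ^ j ∧
    s'.cell 26 0 = q * C ^ j) (firstBelow p r E) 0 (Nat.zero_le _) ?_ ?_ ?_).mono (by lia) ?_
  · simp [h3, h25, h26]
  · rintro j s' - hj hf ⟨i3, i25, i26⟩
    have g2 : s'.idx 2 = 0 := (hf.idx 2 rfl).trans h2
    have g1 : s'.idx 1 = 1 := (hf.idx 1 rfl).trans h1
    have g23 : s'.cell 23 0 = C := by rw [hf.cell 23 rfl, h23]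
    have g24 : s'.cell 24 0 = r := by rw [hf.cell 24 rfl, h24]
    have g27 : s'.cell 27 0 = E := by rw [hf.cell 27 rfl, h27]
    refine ⟨?_, Total.block (by simp [AllDefined, Instr.Defined]) ?_⟩
    · simp only [Test.Holds, scalar, Ref.read, g2, g27, i25]
      exact lt_of_lt_firstBelow hj
    · simp [applyAll, Instr.apply, scalar, Ref.read, g1, g2, g23, g24, i3, i25, i26, pow_succ,
        mul_assoc]
  · rintro s' hf ⟨-, i25, -⟩
    have g2 : s'.idx 2 = 0 := (hf.idx 2 rfl).trans h2
    have g27 : s'.cell 27 0 = E := by rw [hf.cell 27 rfl, h27]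
    simp only [Test.Holds, scalar, Ref.read, g2, g27, i25, not_lt]
    exact firstBelow_spec hp hr1 hE
  · exact fun _ _ h => ⟨h.1, h.2.2⟩

/-- The search for the truncation order. -/
def orderLoop : Program :=
  .while (.realLt (scalar 27) (scalar 26))
    (.block (.mul (scalar 26) (scalar 26) (scalar 24)) [.idxAdd 4 4 1])

theorem total_orderLoop {s : Memory} {q r E : ℝ} (hq : 0 < q) (hr1 : r < 1)
    (hE : 0 < E) (h1 : s.idx 1 = 1) (h2 : s.idx 2 = 0) (h4 : s.idx 4 = 1)
    (h24 : s.cell 24 0 = r) (h26 : s.cell 26 0 = q) (h27 : s.cell 27 0 = E) :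
    Total orderLoop s (firstBelow q r E * 3 + 1) fun s' => s'.idx 4 = firstBelow q r E + 1 := by
  refine (Total.while (B := 2) (fun j s' => s'.idx 4 = j + 1 ∧ s'.cell 26 0 = q * r ^ j)
    (firstBelow q r E) 0 (Nat.zero_le _) ?_ ?_ ?_).mono (by lia) ?_
  · simp [h4, h26]
  · rintro j s' - hj hf ⟨i4, i26⟩
    have g2 : s'.idx 2 = 0 := (hf.idx 2 rfl).trans h2
    have g1 : s'.idx 1 = 1 := (hf.idx 1 rfl).trans h1
    have g24 : s'.cell 24 0 = r := by rw [hf.cell 24 rfl, h24]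
    have g27 : s'.cell 27 0 = E := by rw [hf.cell 27 rfl, h27]
    refine ⟨?_, Total.block (by simp [AllDefined, Instr.Defined]) ?_⟩
    · simp only [Test.Holds, scalar, Ref.read, g2, g27, i26]
      exact lt_of_lt_firstBelow hj
    · simp [applyAll, Instr.apply, scalar, Ref.read, g1, g2, g24, i4, i26, pow_succ, mul_assoc]
  · rintro s' hf ⟨-, i26⟩
    have g2 : s'.idx 2 = 0 := (hf.idx 2 rfl).trans h2
    have g27 : s'.cell 27 0 = E := by rw [hf.cell 27 rfl, h27]
    simp only [Test.Holds, scalar, Ref.read, g2, g27, i26, not_lt]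
    exact firstBelow_spec hq hr1 hE
  · exact fun _ _ h => h.1

/-- One term of the two logarithmic series. -/
def logTermStep : Program :=
  .block (.mul (scalar 32) (scalar 32) (scalar 44))
    [.div (scalar 28) (scalar 32) (scalar 31),
     .mul (scalar 28) ⟨1, 6⟩ (scalar 28),
     .sub ⟨40, 7⟩ ⟨40, 7⟩ (scalar 28),
     .mul (scalar 33) (scalar 33) (scalar 39),
     .mul (scalar 34) (scalar 34) (scalar 43),
     .sub (scalar 28) (scalar 33) (scalar 34),
     .div (scalar 28) (scalar 28) (scalar 31),
     .mul (scalar 28) ⟨1, 6⟩ (scalar 28),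
     .add (scalar 30) (scalar 30) (scalar 28),
     .add (scalar 31) (scalar 31) (scalar 20)]

/-- The partial sums of `log ((1 + z) / (1 - z))`. -/
noncomputable def logSum (z : ℝ) (M : ℕ) : ℝ := ∑ j ∈ Finset.range M, (z ^ j - (-z) ^ j) / j

/-- The counter starts at 1, so nothing is divided by 0; the terms of index 0 in the formulas vanish
by the convention x / 0 = 0. Before pass n the power cells hold exponent n - 1. -/
theorem total_logTermLoop {s : Memory} {M i : ℕ} {w b z v : ℝ} {g₀ : ℕ → ℝ} (hM : 1 ≤ M)
    (h1 : s.idx 1 = 1) (h2 : s.idx 2 = 0) (h4 : s.idx 4 = M) (h6 : s.idx 6 = i)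
    (h7 : s.idx 7 = 1) (hw : s.cell 1 i = w) (h20 : s.cell 20 0 = 1) (h30 : s.cell 30 0 = v)
    (h31 : s.cell 31 0 = 1) (h32 : s.cell 32 0 = 1) (h33 : s.cell 33 0 = 1)
    (h34 : s.cell 34 0 = 1) (h39 : s.cell 39 0 = z) (h43 : s.cell 43 0 = -z)
    (h44 : s.cell 44 0 = -b) (hg : ∀ j < M, s.cell 40 j = g₀ j) :
    Total (.forLoop 7 4 logTermStep) s (M * 13 + 1) fun s' =>
      s'.cell 30 0 = v + w * logSum z M ∧
      ∀ j < M, s'.cell 40 j = g₀ j + w * -((-b) ^ j / j) := by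
  refine (Total.forLoop (K := M) (B := 11) (fun n s' => 1 ≤ n ∧
    (∀ j < M, s'.cell 40 j = g₀ j + if j < n then w * -((-b) ^ j / j) else 0) ∧
    s'.cell 30 0 = v + w * logSum z n ∧ s'.cell 31 0 = n ∧
    s'.cell 32 0 = (-b) ^ (n - 1) ∧ s'.cell 33 0 = z ^ (n - 1) ∧ s'.cell 34 0 = (-z) ^ (n - 1))
    1 rfl rfl rfl (by decide) (by decide) h1 h7 h4 hM ?_ ?_).mono ?_ ?_
  · refine ⟨le_rfl, fun j hj => ?_, by simp [h30, logSum], by simp [h31], by simp [h32],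
      by simp [h33], by simp [h34]⟩
    rw [hg j hj]
    split_ifs with h
    · have : j = 0 := by lia
      simp [this]
    · simp
  · rintro n s' hn hf h7' ⟨hn1, iG, i30, i31, i32, i33, i34⟩
    obtain ⟨n, rfl⟩ : ∃ k, n = k + 1 := ⟨n - 1, by lia⟩
    have g1 : s'.idx 1 = 1 := (hf.idx 1 rfl).trans h1
    have g2 : s'.idx 2 = 0 := (hf.idx 2 rfl).trans h2
    have g6 : s'.idx 6 = i := (hf.idx 6 rfl).trans h6
    have gw : s'.cell 1 i = w := by rw [hf.cell 1 rfl, hw]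
    have g20 : s'.cell 20 0 = 1 := by rw [hf.cell 20 rfl, h20]
    have g39 : s'.cell 39 0 = z := by rw [hf.cell 39 rfl, h39]
    have g43 : s'.cell 43 0 = -z := by rw [hf.cell 43 rfl, h43]
    have g44 : s'.cell 44 0 = -b := by rw [hf.cell 44 rfl, h44]
    have gg : s'.cell 40 (n + 1) = g₀ (n + 1) := by simpa using iG (n + 1) hn
    have hn0 : ((n + 1 : ℕ) : ℝ) ≠ 0 := by positivity
    refine Total.block ?_ ?_
    · simp only [AllDefined, Instr.Defined, Instr.apply, scalar, Ref.read, Ref.write_idx,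
        Ref.write_cell, g2, g6, h7', gw, g39, g43, g44, gg, i31, i32, i33, i34, if_true,
        Nat.reduceEqDiff, if_false, true_and, and_true]
      exact ⟨hn0, hn0⟩
    · simp only [applyAll, Instr.apply, scalar, Ref.read, Ref.write_idx,
        Ref.write_cell, Memory.setIdx_cell, g2, g6, h7', gw, g20, g39, g43, g44, gg, i30, i31, i32,
        i33, i34, if_true, Nat.reduceEqDiff, if_false, Nat.add_sub_cancel, ← pow_succ]
      refine ⟨by lia, fun j hj => ?_, ?_, by push_cast; ring, trivial, trivial, trivial⟩
      · rcases lt_trichotomy j (n + 1) with h | h | h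
        · rw [if_neg h.ne, iG j hj, if_pos h, if_pos (by lia)]
        · rw [if_pos h, h, if_pos (by lia)]; ring
        · rw [if_neg h.ne', iG j hj, if_neg (by lia), if_neg (by lia)]
      · unfold logSum
        rw [Finset.sum_range_succ _ (n + 1)]
        ring
  · exact Nat.add_le_add_right (Nat.mul_le_mul_right _ (Nat.sub_le _ _)) _
  · rintro s' - ⟨-, iG, i30, -⟩
    refine ⟨i30, fun j hj => ?_⟩
    simpa [hj] using iG j hj

/-- The contribution of one matrix to the vector of the observable. -/
def logStep : Program :=
  .seq
    (.block (.sub (scalar 28) ⟨10, 6⟩ (scalar 20))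
      [.add (scalar 29) ⟨10, 6⟩ (scalar 20),
       .div (scalar 39) (scalar 28) (scalar 29),
       .const (scalar 29) 0,
       .sub (scalar 43) (scalar 29) (scalar 39),
       .sub (scalar 44) (scalar 29) ⟨12, 6⟩,
       .copy (scalar 31) (scalar 20),
       .copy (scalar 32) (scalar 20),
       .copy (scalar 33) (scalar 20),
       .copy (scalar 34) (scalar 20),
       .idxConst 7 1])
    (.forLoop 7 4 logTermStep)

/-- With z = (δ-1)/(δ+1) one has δ = (1+z)/(1-z), so log δ is approximated by `logSum`, using
rational operations only. -/
theorem total_logLoop {s : Memory} {M m : ℕ} {w δ b : ℕ → ℝ} (hM : 1 ≤ M)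
    (hδ : ∀ i < m, 0 < δ i)
    (h0 : s.idx 0 = m) (h1 : s.idx 1 = 1) (h2 : s.idx 2 = 0) (h4 : s.idx 4 = M)
    (h6 : s.idx 6 = 0) (hw : ∀ i < m, s.cell 1 i = w i) (hd : ∀ i < m, s.cell 10 i = δ i)
    (hb : ∀ i < m, s.cell 12 i = b i) (h20 : s.cell 20 0 = 1) (h30 : s.cell 30 0 = 0)
    (hg : ∀ j < M, s.cell 40 j = 0) :
    Total (.forLoop 6 0 logStep) s (m * (M * 13 + 14) + 1) fun s' =>
      s'.cell 30 0 = ∑ i ∈ Finset.range m, w i * logSum ((δ i - 1) / (δ i + 1)) M ∧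
      ∀ j < M, s'.cell 40 j = ∑ i ∈ Finset.range m, w i * -((-b i) ^ j / j) := by
  refine (Total.forLoop (K := m) (B := 11 + (M * 13 + 1)) (fun k s' =>
    s'.cell 30 0 = ∑ i ∈ Finset.range k, w i * logSum ((δ i - 1) / (δ i + 1)) M ∧
      ∀ j < M, s'.cell 40 j = ∑ i ∈ Finset.range k, w i * -((-b i) ^ j / j))
    0 rfl rfl rfl (by decide) (by decide) h1 h6 h0 (Nat.zero_le _) ?_ ?_).mono ?_
    (fun _ _ h => h)
  · exact ⟨by simpa using h30, by simpa using hg⟩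
  · rintro k s' hk hf h6' ⟨i30, i40⟩
    have g1 : s'.idx 1 = 1 := (hf.idx 1 rfl).trans h1
    have g2 : s'.idx 2 = 0 := (hf.idx 2 rfl).trans h2
    have g4 : s'.idx 4 = M := (hf.idx 4 rfl).trans h4
    have gw : s'.cell 1 k = w k := by rw [hf.cell 1 rfl, hw k hk]
    have gd : s'.cell 10 k = δ k := by rw [hf.cell 10 rfl, hd k hk]
    have gb : s'.cell 12 k = b k := by rw [hf.cell 12 rfl, hb k hk]
    have g20 : s'.cell 20 0 = 1 := by rw [hf.cell 20 rfl, h20]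
    have hδk := hδ k hk
    refine Total.seq (R := fun u => u.cell 39 0 = (δ k - 1) / (δ k + 1) ∧
      u.cell 43 0 = -((δ k - 1) / (δ k + 1)) ∧ u.cell 44 0 = -b k ∧ u.cell 31 0 = 1 ∧
      u.cell 32 0 = 1 ∧ u.cell 33 0 = 1 ∧ u.cell 34 0 = 1 ∧ u.idx 7 = 1)
      (Total.block ?_ ?_) ?_
    · simp only [AllDefined, Instr.Defined, Instr.apply, scalar, Ref.read, Ref.write_idx,
        Ref.write_cell, g2, h6', gd, g20, if_true, Nat.reduceEqDiff, if_false, true_and,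
        and_true]
      positivity
    · simp [applyAll, Instr.apply, scalar, Ref.read, g2, h6', gd, gb, g20]
    · rintro u hu ⟨u39, u43, u44, u31, u32, u33, u34, u7⟩
      refine (total_logTermLoop hM (i := k) (w := w k) (b := b k) ((hu.idx 1 rfl).trans g1)
        ((hu.idx 2 rfl).trans g2) ((hu.idx 4 rfl).trans g4) ((hu.idx 6 rfl).trans h6') u7
        (by rw [hu.cell 1 rfl, gw]) (by rw [hu.cell 20 rfl, g20])
        ((congrFun (hu.cell 30 rfl) 0).trans i30)
        u31 u32 u33 u34 u39 u43 u44
        (fun j hj => (congrFun (hu.cell 40 rfl) j).trans (i40 j hj))).mono le_rfl ?_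
      rintro x - ⟨x30, x40⟩
      refine ⟨by rw [Memory.setIdx_cell, x30, Finset.sum_range_succ], fun j hj => ?_⟩
      rw [Memory.setIdx_cell, x40 j hj, Finset.sum_range_succ]
  · exact Nat.le_of_eq (by rw [Nat.sub_zero]; ring)

/-- The program that approximates the top Lyapunov exponent. -/
def exponentProgram : Program :=
  .seq (.block (.idxConst 1 1)
      [.const (scalar 20) 1, .const (scalar 21) (1 / 2), .const (scalar 22) 1])
    (.seq (.forLoop 6 0 coefStep)
      (.seq boundSetup
        (.seq countLoop
          (.seq orderLoop
            (.seq (.forLoop 6 0 logStep)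
              (.seq (.forLoop 5 3 iterStep)
                (.instr (.add (scalar 0) (scalar 30) (scalar 40)))))))))

/-! ### Correctness of the program -/

/-- Extension of a finite family by `0`. -/
def natExtend {α : Type*} [Zero α] {m : ℕ} (f : Fin m → α) (i : ℕ) : α :=
  if h : i < m then f ⟨i, h⟩ else 0

theorem natExtend_of_lt {α : Type*} [Zero α] {m : ℕ} (f : Fin m → α) {i : ℕ} (h : i < m) :
    natExtend f i = f ⟨i, h⟩ := dif_pos h

@[simp] theorem natExtend_val {α : Type*} [Zero α] {m : ℕ} (f : Fin m → α) (i : Fin m) :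
    natExtend f i = f i := natExtend_of_lt f i.isLt

section Correctness

variable {m : ℕ} {A : Fin m → Matrix (Fin 2) (Fin 2) ℝ} {w : Fin m → ℝ}

theorem seqTransfer_natExtend (A : Fin m → Matrix (Fin 2) (Fin 2) ℝ) (w : Fin m → ℝ) (M : ℕ) :
    seqTransfer (natExtend w) (fun i => coefA (natExtend A i)) (fun i => coefB (natExtend A i))
      (fun i => coefC (natExtend A i)) m M = coeffTransfer w (fun i => coefA (A i))
      (fun i => coefB (A i)) (fun i => coefC (A i)) M := by
  funext g j
  unfold seqTransfer coeffTransfer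
  rw [← Fin.sum_univ_eq_sum_range (fun i => natExtend w i * ∑ n ∈ Finset.range M, g n *
    powCoeff (coefA (natExtend A i)) (coefB (natExtend A i)) (coefC (natExtend A i)) n j)]
  simp

/-- The value that the program computes with `N` iterations of vectors of length `M`. -/
noncomputable def exponentApprox (A : Fin m → Matrix (Fin 2) (Fin 2) ℝ) (w : Fin m → ℝ)
    (N M : ℕ) : ℝ :=
  ∑ i, w i * logSum ((halfSum (A i) - 1) / (halfSum (A i) + 1)) M + coeffIterate A w M N 0

/-- The number of iterations for the tolerance `e`. -/
noncomputable def iterCount (S e : ℝ) : ℕ := firstBelow (growth S ^ 2) (rate S) (e / 8)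

/-- One less than the truncation order for the tolerance `e`. -/
noncomputable def truncOrder (S e : ℝ) : ℕ :=
  firstBelow (growth S ^ 3 * growth S ^ iterCount S e) (rate S) (e / 8)

theorem step_count_le (m N M : ℕ) :
    4 + ((m * 34 + 1) + (12 + ((N * 4 + 1) + ((M * 3 + 1) +
      ((m * ((M + 1) * 13 + 14) + 1) + ((N * (m * ((M + 1) * (12 * (M + 1) + 10) + 7) +
        4 * (M + 1) + 6) + 1) + 1)))))) ≤ 200 * ((m + 1) * (N + 1) * (M + 1) ^ 2) := by
  have h1 := Nat.zero_le (m * N * M ^ 2)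
  have h2 := Nat.zero_le (m * N * M)
  have h3 := Nat.zero_le (m * N)
  have h4 := Nat.zero_le (m * M ^ 2)
  have h5 := Nat.zero_le (m * M)
  have h6 := Nat.zero_le (N * M ^ 2)
  have h7 := Nat.zero_le (N * M)
  have h8 := Nat.zero_le (M ^ 2)
  ring_nf at *
  lia

theorem PositiveFamily.total_exponentProgram (h : PositiveFamily A w) {e : ℝ} (he : 0 < e) :
    Total exponentProgram (inputMemory A w e)
      (200 * ((m + 1) * (iterCount (familyGap A) e + 1) * (truncOrder (familyGap A) e + 1) ^ 2))
      fun s => s.output = exponentApprox A w (iterCount (familyGap A) e)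
        (truncOrder (familyGap A) e + 1) := by
  set S := familyGap A with hS
  have hS0 : 0 < S := h.familyGap_pos
  have hS1 : S ≤ 1 := h.familyGap_le_one
  set N := iterCount S e with hN
  set M := truncOrder S e with hM
  have hC : 0 < growth S := by have := three_le_growth hS0 hS1; linarith
  have hr1 := rate_lt_one hS0
  have he8 : 0 < e / 8 := by positivity
  set s₀ := inputMemory A w e with hs₀
  have z : ∀ b, b ≠ 0 → b ≠ 1 → b ≠ 2 → b ≠ 3 → b ≠ 4 → b ≠ 5 → ∀ j, s₀.cell b j = 0 := by
    intro b b0 b1 b2 b3 b4 b5 j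
    simp only [hs₀, inputMemory, b0, if_false]
    split_ifs <;> rfl
  have c1 : ∀ i < m, s₀.cell 1 i = natExtend w i := by
    intro i hi; simp [hs₀, inputMemory, hi, natExtend]
  have c2 : ∀ i < m, s₀.cell 2 i = natExtend A i 0 0 := by
    intro i hi; simp [hs₀, inputMemory, hi, natExtend]
  have c3 : ∀ i < m, s₀.cell 3 i = natExtend A i 0 1 := by
    intro i hi; simp [hs₀, inputMemory, hi, natExtend]
  have c4 : ∀ i < m, s₀.cell 4 i = natExtend A i 1 0 := by
    intro i hi; simp [hs₀, inputMemory, hi, natExtend]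
  have c5 : ∀ i < m, s₀.cell 5 i = natExtend A i 1 1 := by
    intro i hi; simp [hs₀, inputMemory, hi, natExtend]
  have hA : ∀ i < m, ∀ a b, 0 < natExtend A i a b := by
    intro i hi a b; rw [natExtend_of_lt A hi]; exact h.entry_pos _ a b
  have hprod : ∏ i ∈ Finset.range m, matGap (natExtend A i) = S := by
    rw [← Fin.prod_univ_eq_prod_range (fun i => matGap (natExtend A i))]
    simp [hS, familyGap]
  refine Total.mono (B := 4 + ((m * 34 + 1) + (12 + ((N * 4 + 1) + ((M * 3 + 1) +
    ((m * ((M + 1) * 13 + 14) + 1) + ((N * (m * ((M + 1) * (12 * (M + 1) + 10) + 7) +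
      4 * (M + 1) + 6) + 1) + 1))))))) ?_ ?_ (fun _ _ h => h)
  · refine Total.seq (R := fun s => s.idx 1 = 1 ∧ s.cell 20 0 = 1 ∧ s.cell 21 0 = 1 / 2 ∧
      s.cell 22 0 = 1) (Total.block (by simp [AllDefined, Instr.Defined]) ?_) ?_
    · simp [applyAll, Instr.apply, scalar, hs₀, inputMemory]
    rintro s1 f1 ⟨p1, p20, p21, p22⟩
    have q0 : s1.idx 0 = m := f1.idx 0 rfl
    have q2 : s1.idx 2 = 0 := f1.idx 2 rfl
    have q3 : s1.idx 3 = 0 := f1.idx 3 rfl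
    have q5 : s1.idx 5 = 0 := f1.idx 5 rfl
    have q6 : s1.idx 6 = 0 := f1.idx 6 rfl
    refine Total.seq (total_coefLoop hA q0 p1 q2 q6 (by rw [f1.cell 2 rfl]; exact c2)
      (by rw [f1.cell 3 rfl]; exact c3) (by rw [f1.cell 4 rfl]; exact c4)
      (by rw [f1.cell 5 rfl]; exact c5) p20 p21 p22) ?_
    rintro s2 f2 ⟨k10, k11, k12, k13, k22⟩
    rw [hprod] at k22
    have r1 : s2.idx 1 = 1 := (f2.idx 1 rfl).trans p1
    have r2 : s2.idx 2 = 0 := (f2.idx 2 rfl).trans q2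
    have r20 : s2.cell 20 0 = 1 := (congrFun (f2.cell 20 rfl) 0).trans p20
    have re : s2.cell 0 0 = e := by
      rw [f2.cell 0 rfl, f1.cell 0 rfl]; simp [hs₀, inputMemory]
    refine Total.seq (total_boundSetup hS0 r2 r20 k22 re) ?_
    rintro s3 f3 ⟨b23, b24, b27, b25, b26, b4, b6⟩
    have t1 : s3.idx 1 = 1 := (f3.idx 1 rfl).trans r1
    have t2 : s3.idx 2 = 0 := (f3.idx 2 rfl).trans r2
    have t3 : s3.idx 3 = 0 := by rw [f3.idx 3 rfl, f2.idx 3 rfl, q3]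
    refine Total.seq (total_countLoop (pow_pos hC 2) hr1 he8 t1 t2 t3 b23 b24 b25 b26 b27) ?_
    rintro s4 f4 ⟨n3, n26⟩
    have u1 : s4.idx 1 = 1 := (f4.idx 1 rfl).trans t1
    have u2 : s4.idx 2 = 0 := (f4.idx 2 rfl).trans t2
    refine Total.seq (total_orderLoop (mul_pos (pow_pos hC 3) (pow_pos hC _)) hr1 he8 u1 u2
      ((f4.idx 4 rfl).trans b4) ((congrFun (f4.cell 24 rfl) 0).trans b24) n26
      ((congrFun (f4.cell 27 rfl) 0).trans b27)) ?_
    rintro s5 f5 m4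
    change s5.idx 4 = M + 1 at m4
    have v0 : s5.idx 0 = m := by
      rw [f5.idx 0 rfl, f4.idx 0 rfl, f3.idx 0 rfl, f2.idx 0 rfl, q0]
    have v1 : s5.idx 1 = 1 := (f5.idx 1 rfl).trans u1
    have v2 : s5.idx 2 = 0 := (f5.idx 2 rfl).trans u2
    have v3 : s5.idx 3 = N := (f5.idx 3 rfl).trans n3
    have v5 : s5.idx 5 = 0 := by
      rw [f5.idx 5 rfl, f4.idx 5 rfl, f3.idx 5 rfl, f2.idx 5 rfl, q5]
    have v6 : s5.idx 6 = 0 := by rw [f5.idx 6 rfl, f4.idx 6 rfl, b6]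
    have e1 : s5.cell 1 = s₀.cell 1 := by
      rw [f5.cell 1 rfl, f4.cell 1 rfl, f3.cell 1 rfl, f2.cell 1 rfl, f1.cell 1 rfl]
    have e10 : s5.cell 10 = s2.cell 10 := by
      rw [f5.cell 10 rfl, f4.cell 10 rfl, f3.cell 10 rfl]
    have e11 : s5.cell 11 = s2.cell 11 := by
      rw [f5.cell 11 rfl, f4.cell 11 rfl, f3.cell 11 rfl]
    have e12 : s5.cell 12 = s2.cell 12 := by
      rw [f5.cell 12 rfl, f4.cell 12 rfl, f3.cell 12 rfl]
    have e13 : s5.cell 13 = s2.cell 13 := by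
      rw [f5.cell 13 rfl, f4.cell 13 rfl, f3.cell 13 rfl]
    have e20 : s5.cell 20 0 = 1 := by
      rw [f5.cell 20 rfl, f4.cell 20 rfl, f3.cell 20 rfl, r20]
    have e30 : s5.cell 30 0 = 0 := by
      rw [f5.cell 30 rfl, f4.cell 30 rfl, f3.cell 30 rfl, f2.cell 30 rfl, f1.cell 30 rfl]
      exact z 30 (by decide) (by decide) (by decide) (by decide) (by decide) (by decide) 0
    have e40 : ∀ j, s5.cell 40 j = 0 := by
      rw [f5.cell 40 rfl, f4.cell 40 rfl, f3.cell 40 rfl, f2.cell 40 rfl, f1.cell 40 rfl]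
      exact z 40 (by decide) (by decide) (by decide) (by decide) (by decide) (by decide)
    have e41 : ∀ j, s5.cell 41 j = 0 := by
      rw [f5.cell 41 rfl, f4.cell 41 rfl, f3.cell 41 rfl, f2.cell 41 rfl, f1.cell 41 rfl]
      exact z 41 (by decide) (by decide) (by decide) (by decide) (by decide) (by decide)
    refine Total.seq (total_logLoop (M := M + 1) (δ := fun i => halfSum (natExtend A i))
      (b := fun i => coefB (natExtend A i)) (w := natExtend w) (by lia)
      (fun i hi => halfSum_pos (hA i hi)) v0 v1 v2 m4 v6 (by rw [e1]; exact c1)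
      (by rw [e10]; exact k10) (by rw [e12]; exact k12) e20 e30 (fun j _ => e40 j)) ?_
    rintro s6 f6 ⟨l30, l40⟩
    refine Total.seq (total_iterLoop (M := M + 1) (m := m) (N := N) (w := natExtend w)
      (a := fun i => coefA (natExtend A i)) (b := fun i => coefB (natExtend A i))
      (c := fun i => coefC (natExtend A i))
      (g := logCoeff w fun i => coefB (A i)) ((f6.idx 0 rfl).trans v0) ((f6.idx 1 rfl).trans v1)
      ((f6.idx 2 rfl).trans v2) ((f6.idx 3 rfl).trans v3) ((f6.idx 4 rfl).trans m4)
      ((f6.idx 5 rfl).trans v5) (by rw [f6.cell 1 rfl, e1]; exact c1)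
      (by rw [f6.cell 11 rfl, e11]; exact k11) (by rw [f6.cell 12 rfl, e12]; exact k12)
      (by rw [f6.cell 13 rfl, e13]; exact k13) ?_
      (fun j _ => (congrFun (f6.cell 41 rfl) j).trans (e41 j))) ?_
    · intro j hj
      rw [l40 j hj, ← Fin.sum_univ_eq_sum_range
        (fun i => natExtend w i * -((-coefB (natExtend A i)) ^ j / j))]
      simp [logCoeff]
    rintro s7 f7 x40
    refine Total.instr trivial ?_
    have y2 : s7.idx 2 = 0 := by rw [f7.idx 2 rfl, f6.idx 2 rfl, v2]
    have y30 : s7.cell 30 0 = ∑ i, w i * logSum ((halfSum (A i) - 1) / (halfSum (A i) + 1))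
        (M + 1) := by
      rw [f7.cell 30 rfl, l30, ← Fin.sum_univ_eq_sum_range (fun i => natExtend w i *
        logSum ((halfSum (natExtend A i) - 1) / (halfSum (natExtend A i) + 1)) (M + 1))]
      simp
    have y40 := x40 0 (Nat.succ_pos M)
    rw [seqTransfer_natExtend] at y40
    simp only [Memory.output, Instr.apply, scalar, Ref.read, Ref.write_cell, y2, if_true, y30, y40]
    rfl
  · exact step_count_le m N M

/-- The gap hypothesis keeps z = (d-1)/(d+1) away from ±1, namely |z| ≤ 1 - S ≤ `rate S`. The series
of log(1-z) and log(1+z) contribute one remainder each. -/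
theorem abs_log_sub_logSum_le {d S : ℝ} (hS : 0 < S) (hS1 : S ≤ 1) (hd : 0 < d)
    (hSd : S ≤ d / (1 + d) ^ 2) (M : ℕ) :
    |Real.log d - logSum ((d - 1) / (d + 1)) (M + 1)| ≤ 2 * (growth S * rate S ^ M) := by
  set z := (d - 1) / (d + 1) with hz
  have hr := rate_pos S
  have hr1 := rate_lt_one hS
  have hC := three_le_growth hS hS1
  have hzabs : |z| ≤ rate S := by
    refine le_trans ?_ (one_sub_le_rate hS)
    have h1 : S * (1 + d) ^ 2 ≤ d := (le_div_iff₀ (by positivity)).1 hSd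
    have h2 : S * (1 + d) ≤ d ∧ S * (1 + d) ≤ 1 := by
      constructor
      · nlinarith [mul_pos hS hd, mul_pos hS (pow_pos hd 2)]
      · by_contra hcon
        nlinarith
    rw [hz, abs_le]
    constructor
    · rw [le_div_iff₀ (by linarith)]; nlinarith
    · rw [div_le_iff₀ (by linarith)]; nlinarith
  have hlog : Real.log d = Real.log (1 - -z) - Real.log (1 - z) := by
    have e1 : 1 - -z = 2 * d / (d + 1) := by rw [hz]; field_simp; ring
    have e2 : 1 - z = 2 / (d + 1) := by rw [hz]; field_simp; ring
    rw [e1, e2, ← Real.log_div (by positivity) (by positivity)]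
    congr 1; field_simp
  have bd : ∀ x : ℝ, |x| ≤ rate S →
      |(∑ i ∈ Finset.range M, x ^ (i + 1) / (i + 1)) + Real.log (1 - x)| ≤
        growth S * rate S ^ M := by
    intro x hx
    refine (Real.abs_log_sub_add_sum_range_le (by linarith) M).trans ?_
    rw [div_eq_mul_inv, mul_comm]
    have h1 : (1 - |x|)⁻¹ ≤ growth S := by
      rw [growth_eq hS]
      apply inv_anti₀ <;> linarith
    refine mul_le_mul h1 ?_ (by positivity) (by linarith)
    calc |x| ^ (M + 1) ≤ rate S ^ (M + 1) := pow_le_pow_left₀ (abs_nonneg _) hx _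
      _ ≤ rate S ^ M := pow_le_pow_of_le_one hr.le hr1.le (Nat.le_succ M)
  have h1 := bd z hzabs
  have h2 := bd (-z) (by rwa [abs_neg])
  have e : Real.log d - logSum z (M + 1) =
      ((∑ i ∈ Finset.range M, (-z) ^ (i + 1) / (i + 1)) + Real.log (1 - -z)) -
      ((∑ i ∈ Finset.range M, z ^ (i + 1) / (i + 1)) + Real.log (1 - z)) := by
    rw [hlog, logSum, Finset.sum_range_succ']
    simp only [sub_div, Finset.sum_sub_distrib]
    push_cast
    simp
    ring
  rw [e]
  refine (abs_sub _ _).trans ?_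
  linarith

theorem PositiveFamily.abs_logMean_sub_le (h : PositiveFamily A w) (M : ℕ) :
    |logMean A w - ∑ i, w i * logSum ((halfSum (A i) - 1) / (halfSum (A i) + 1)) (M + 1)| ≤
      2 * (growth (familyGap A) * rate (familyGap A) ^ M) := by
  unfold logMean
  rw [← Finset.sum_sub_distrib]
  simp_rw [← mul_sub]
  refine abs_weighted_sum_le h.weight_pos h.weight_sum fun i => ?_
  exact abs_log_sub_logSum_le h.familyGap_pos h.familyGap_le_one (halfSum_pos (h.entry_pos i))
    ((h.familyGap_le i).trans (matGap_le (h.entry_pos i)).2.2.2.2.1) M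

theorem PositiveFamily.bounds_le (h : PositiveFamily A w) {e : ℝ} (he : 0 < e) :
    growth (familyGap A) ^ 2 * rate (familyGap A) ^ iterCount (familyGap A) e ≤ e / 8 ∧
      growth (familyGap A) ^ (iterCount (familyGap A) e + 3) *
        rate (familyGap A) ^ truncOrder (familyGap A) e ≤ e / 8 := by
  have hC := three_le_growth h.familyGap_pos h.familyGap_le_one
  have hr1 := rate_lt_one h.familyGap_pos
  have he8 : 0 < e / 8 := by positivity
  refine ⟨firstBelow_spec (by positivity) hr1 he8, ?_⟩
  rw [pow_add, mul_comm (growth _ ^ iterCount _ _)]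
  exact firstBelow_spec (by positivity) hr1 he8

/-- Each of the four errors is at most e/8. The logarithmic ones need no search of their own,
because `growth` ≤ `growth` ^ (N + 3). -/
theorem PositiveFamily.abs_sub_exponentApprox_lt (h : PositiveFamily A w) {lam e : ℝ}
    (he : 0 < e) (hlam : ∀ N M, |lam - (logMean A w + coeffIterate A w (M + 1) N 0)| ≤
        growth (familyGap A) ^ 2 * rate (familyGap A) ^ N +
          growth (familyGap A) ^ (N + 3) * rate (familyGap A) ^ M) :
    |lam - exponentApprox A w (iterCount (familyGap A) e) (truncOrder (familyGap A) e + 1)| <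
      e := by
  obtain ⟨h1, h2⟩ := h.bounds_le he
  have h3 := hlam (iterCount (familyGap A) e) (truncOrder (familyGap A) e)
  have h4 := h.abs_logMean_sub_le (truncOrder (familyGap A) e)
  have hC := three_le_growth h.familyGap_pos h.familyGap_le_one
  have hr := rate_pos (familyGap A)
  have h5 : growth (familyGap A) * rate (familyGap A) ^ truncOrder (familyGap A) e ≤ e / 8 := by
    refine le_trans ?_ h2
    gcongr
    exact le_self_pow₀ (by linarith) (by lia)
  set X := coeffIterate A w (truncOrder (familyGap A) e + 1) (iterCount (familyGap A) e) 0
  have e1 : lam - exponentApprox A w (iterCount (familyGap A) e) (truncOrder (familyGap A) e + 1) =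
      (lam - (logMean A w + X)) + (logMean A w - ∑ i, w i *
        logSum ((halfSum (A i) - 1) / (halfSum (A i) + 1)) (truncOrder (familyGap A) e + 1)) := by
    unfold exponentApprox; ring
  rw [e1]
  have := abs_add_le (lam - (logMean A w + X)) (logMean A w - ∑ i, w i *
        logSum ((halfSum (A i) - 1) / (halfSum (A i) + 1)) (truncOrder (familyGap A) e + 1))
  linarith

/-! ### Growth of the parameters -/

/-- The exponent before the first admissible one violates the inequality; take logarithms there. -/
theorem firstBelow_mul_le {p r E : ℝ} (hp : 0 < p) (hr0 : 0 < r) (hr1 : r < 1) (hE : 0 < E) :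
    (firstBelow p r E : ℝ) * -Real.log r ≤ -Real.log r + |Real.log p| + |Real.log E| := by
  have hl : Real.log r < 0 := Real.log_neg hr0 hr1
  rcases Nat.eq_zero_or_pos (firstBelow p r E) with h0 | h0
  · rw [h0]
    have := abs_nonneg (Real.log p)
    have := abs_nonneg (Real.log E)
    push_cast; linarith
  · have h1 := lt_of_lt_firstBelow (p := p) (r := r) (E := E) (Nat.sub_lt h0 one_pos)
    have h2 := Real.log_lt_log hE h1
    rw [Real.log_mul hp.ne' (by positivity), Real.log_pow, Nat.cast_pred h0] at h2
    have := le_abs_self (Real.log p)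
    have := neg_abs_le (Real.log E)
    linarith

theorem exists_parameter_bound {S : ℝ} (hS : 0 < S) (hS1 : S ≤ 1) :
    ∃ K : ℝ, 0 < K ∧ ∀ e : ℝ, 0 < e →
      (iterCount S e + 1 : ℝ) ≤ K * (1 + |Real.log e|) ∧
      (truncOrder S e + 1 : ℝ) ≤ K * (1 + |Real.log e|) := by
  have hC := three_le_growth hS hS1
  have hr := rate_pos S
  have hr1 := rate_lt_one hS
  set L := -Real.log (rate S) with hL
  have hL0 : 0 < L := by rw [hL, neg_pos]; exact Real.log_neg hr hr1
  set c := Real.log (growth S) with hc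
  have hc0 : 0 < c := Real.log_pos (by linarith)
  have h8 : 0 < Real.log 8 := Real.log_pos (by norm_num)
  have hlog8 : ∀ e : ℝ, 0 < e → |Real.log (e / 8)| ≤ Real.log 8 + |Real.log e| := by
    intro e he
    rw [Real.log_div he.ne' (by norm_num)]
    have := abs_sub (Real.log e) (Real.log 8)
    rw [abs_of_pos h8] at this
    linarith
  -- In `firstBelow_mul_le` the prefactor `growth S ^ 2` contributes 2c and e/8 contributes log 8 +
  -- |log e|; the second L pays for the + 1 in the count.
  set K₁ := (2 * L + 2 * c + Real.log 8 + 1) / L with hK₁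
  have hK₁0 : 0 < K₁ := by positivity
  -- Now the prefactor is a power with exponent 3 + N, and N is at most K₁ (1 + |log e|).
  set K₂ := (2 * L + 3 * c + K₁ * c + Real.log 8 + 1) / L with hK₂
  have hK₂0 : 0 < K₂ := by positivity
  have b1 : ∀ e : ℝ, 0 < e → (iterCount S e + 1 : ℝ) ≤ K₁ * (1 + |Real.log e|) := by
    intro e he
    have h1 := firstBelow_mul_le (p := growth S ^ 2) (by positivity) hr hr1
      (by positivity : 0 < e / 8)
    rw [← hL, Real.log_pow, ← hc, abs_of_pos (by positivity)] at h1
    have h2 := hlog8 e he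
    have ha := abs_nonneg (Real.log e)
    rw [hK₁, div_mul_eq_mul_div, le_div_iff₀ hL0]
    unfold iterCount
    push_cast at h1
    nlinarith [mul_nonneg hL0.le ha, mul_nonneg hc0.le ha, mul_nonneg h8.le ha]
  have b2 : ∀ e : ℝ, 0 < e → (truncOrder S e + 1 : ℝ) ≤ K₂ * (1 + |Real.log e|) := by
    intro e he
    have h0 := b1 e he
    have h1 := firstBelow_mul_le (p := growth S ^ 3 * growth S ^ iterCount S e) (by positivity)
      hr hr1 (by positivity : 0 < e / 8)
    rw [← hL, ← pow_add, Real.log_pow, ← hc, abs_of_nonneg (by positivity), pow_add] at h1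
    have h2 := hlog8 e he
    have ha := abs_nonneg (Real.log e)
    rw [hK₂, div_mul_eq_mul_div, le_div_iff₀ hL0]
    unfold truncOrder
    push_cast at h1
    have h3 : (iterCount S e : ℝ) * c ≤ K₁ * (1 + |Real.log e|) * c :=
      mul_le_mul_of_nonneg_right (by linarith) hc0.le
    nlinarith [mul_nonneg hL0.le ha, mul_nonneg hc0.le ha, mul_nonneg h8.le ha]
  refine ⟨K₁ + K₂, by positivity, fun e he => ⟨(b1 e he).trans ?_, (b2 e he).trans ?_⟩⟩ <;>
    gcongr <;> linarith

theorem eventually_small : ∀ᶠ e : ℝ in 𝓝[>] 0, 0 < e ∧ 1 ≤ Real.log (1 / e) ∧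
    1 + |Real.log e| ≤ 2 * Real.log (1 / e) := by
  have h : Set.Ioo (0 : ℝ) (Real.exp (-1)) ∈ 𝓝[>] (0 : ℝ) := Ioo_mem_nhdsGT (Real.exp_pos _)
  filter_upwards [h] with e he
  have h1 : Real.log e < -1 := (Real.log_lt_iff_lt_exp he.1).2 he.2
  rw [one_div, Real.log_inv, abs_of_neg (by linarith)]
  exact ⟨he.1, by linarith, by linarith⟩

end Correctness

end LyapunovKernel

/-! ### Assembly: the truncated series and the operation count -/

theorem theorem2 :
    (∀ (m : ℕ) (A : Fin m → Matrix (Fin 2) (Fin 2) ℝ) (w : Fin m → ℝ),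
      LyapunovKernel.PositiveFamily A w →
      ∃ lam : ℝ, LyapunovKernel.IsTopLyapunovExponent A w lam ∧
        ∃ N M : ℝ → ℕ+,
          ((fun ε => (N ε : ℝ)) =O[𝓝[>] (0 : ℝ)] fun ε => Real.log (1 / ε)) ∧
          ((fun ε => (M ε : ℝ)) =O[𝓝[>] (0 : ℝ)] fun ε => Real.log ((N ε : ℝ) / ε)) ∧
          ∀ ε : ℝ, 0 < ε → |lam - LyapunovKernel.truncSum A w (N ε) (M ε)| < ε) ∧
    (∃ P : LyapunovKernel.Program,
      ∀ (m : ℕ) (A : Fin m → Matrix (Fin 2) (Fin 2) ℝ) (w : Fin m → ℝ),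
      LyapunovKernel.PositiveFamily A w →
      ∀ lam : ℝ, LyapunovKernel.IsTopLyapunovExponent A w lam →
        ∃ (steps : ℝ → ℕ) (final : ℝ → LyapunovKernel.Memory),
          (∀ ε : ℝ, 0 < ε →
            LyapunovKernel.Runs P (LyapunovKernel.inputMemory A w ε) (steps ε) (final ε) ∧
            |lam - (final ε).output| < ε) ∧
          ((fun ε => (steps ε : ℝ)) =O[𝓝[>] (0 : ℝ)] fun ε => Real.log (1 / ε) ^ 3)) := by
  refine ⟨fun m A w h => ?_, LyapunovKernel.exponentProgram, fun m A w h lam hlam => ?_⟩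
  · obtain ⟨lam, hlam, herr⟩ := h.exists_exponent
    obtain ⟨K, hK, hbd⟩ := LyapunovKernel.exists_parameter_bound h.familyGap_pos h.familyGap_le_one
    -- One is added twice: N + 1 terms of the series amount to N applications of the operator, and M
    -- is the degree bound of vectors of length M + 1.
    refine ⟨lam, hlam, fun e => ⟨LyapunovKernel.iterCount (LyapunovKernel.familyGap A) e + 1,
      Nat.succ_pos _⟩, fun e => ⟨LyapunovKernel.truncOrder (LyapunovKernel.familyGap A) e + 1,
      Nat.succ_pos _⟩, ?_, ?_, fun e he => ?_⟩
    · refine IsBigO.of_bound (K * 2) ?_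
      filter_upwards [LyapunovKernel.eventually_small] with e he
      rw [Real.norm_of_nonneg (Nat.cast_nonneg _), Real.norm_of_nonneg (by linarith), PNat.mk_coe]
      push_cast
      refine ((hbd e he.1).1).trans ?_
      rw [mul_assoc]
      exact mul_le_mul_of_nonneg_left he.2.2 hK.le
    · refine IsBigO.of_bound (K * 2) ?_
      filter_upwards [LyapunovKernel.eventually_small] with e he
      -- Since N ≥ 1, the bound M = O(log(1/ε)) implies the stated one.
      have h1 : Real.log (1 / e) ≤ Real.log
          (((LyapunovKernel.iterCount (LyapunovKernel.familyGap A) e + 1 : ℕ) : ℝ) / e) := by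
        have he0 := he.1
        refine Real.log_le_log (by positivity) ?_
        gcongr
        exact_mod_cast Nat.succ_le_succ (Nat.zero_le _)
      simp only [PNat.mk_coe]
      rw [Real.norm_of_nonneg (Nat.cast_nonneg _), Real.norm_of_nonneg (by linarith [he.2.1])]
      push_cast at h1 ⊢
      refine ((hbd e he.1).2).trans ?_
      rw [mul_assoc]
      exact mul_le_mul_of_nonneg_left (he.2.2.trans (by linarith)) hK.le
    · obtain ⟨h1, h2⟩ := h.bounds_le he
      have h3 := herr (LyapunovKernel.iterCount (LyapunovKernel.familyGap A) e)
        (LyapunovKernel.truncOrder (LyapunovKernel.familyGap A) e)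
      rw [← h.truncSum_eq] at h3
      exact h3.trans_lt (by linarith)
  · obtain ⟨lam', hlam', herr⟩ := h.exists_exponent
    obtain rfl := hlam.unique h hlam'
    obtain ⟨K, hK, hbd⟩ := LyapunovKernel.exists_parameter_bound h.familyGap_pos h.familyGap_le_one
    have hrun : ∀ e : ℝ, ∃ (t : ℕ) (s : LyapunovKernel.Memory), 0 < e →
        LyapunovKernel.Runs LyapunovKernel.exponentProgram (LyapunovKernel.inputMemory A w e) t s ∧
        t ≤ 200 * ((m + 1) * (LyapunovKernel.iterCount (LyapunovKernel.familyGap A) e + 1) *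
          (LyapunovKernel.truncOrder (LyapunovKernel.familyGap A) e + 1) ^ 2) ∧
        s.output = LyapunovKernel.exponentApprox A w
          (LyapunovKernel.iterCount (LyapunovKernel.familyGap A) e)
          (LyapunovKernel.truncOrder (LyapunovKernel.familyGap A) e + 1) := by
      intro e
      by_cases he : 0 < e
      · obtain ⟨t, s, hts⟩ := h.total_exponentProgram he
        exact ⟨t, s, fun _ => hts⟩
      -- A dummy value for nonpositive tolerances, so that the choice is made for all reals.
      · exact ⟨0, LyapunovKernel.inputMemory A w e, fun h => absurd h he⟩
    choose steps final hsf using hrun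
    refine ⟨steps, final, fun e he => ⟨(hsf e he).1, ?_⟩, ?_⟩
    · rw [(hsf e he).2.2]
      exact h.abs_sub_exponentApprox_lt he herr
    · refine IsBigO.of_bound (200 * (m + 1) * (K * 2) ^ 3) ?_
      filter_upwards [LyapunovKernel.eventually_small] with e he
      have hl : 0 ≤ Real.log (1 / e) := by linarith [he.2.1]
      rw [Real.norm_of_nonneg (Nat.cast_nonneg _), Real.norm_of_nonneg (by positivity)]
      have h1 : (steps e : ℝ) ≤ 200 * ((m + 1) *
          (LyapunovKernel.iterCount (LyapunovKernel.familyGap A) e + 1) *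
          (LyapunovKernel.truncOrder (LyapunovKernel.familyGap A) e + 1) ^ 2) := by
        exact_mod_cast (hsf e he.1).2.1
      refine h1.trans ?_
      have h2 : K * (1 + |Real.log e|) ≤ K * 2 * Real.log (1 / e) := by
        rw [mul_assoc]; exact mul_le_mul_of_nonneg_left he.2.2 hK.le
      have h3 := ((hbd e he.1).1).trans h2
      have h4 := ((hbd e he.1).2).trans h2
      -- One logarithm comes from the number of iterations and two from the square of the truncation
      -- order.
      calc _ ≤ 200 * (((m : ℝ) + 1) * (K * 2 * Real.log (1 / e)) *
            (K * 2 * Real.log (1 / e)) ^ 2) := by gcongr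
        _ = _ := by ring
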